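/- Let $N$ be a complete (connected) smooth Riemannian manifold, let $m\ge 3$, and let $\varphi:M\to N\times\mathbb{R}$ be a smooth immersion of a non-empty compact $m$-dimensional manifold $M$ (without boundary) into the Riemannian product $N\times\mathbb{R}$. Let $H=\sum_{i=1}^m\alpha(e_i,e_i)$ be its mean curvature vector, where $\alpha$ is the second fundamental form and $e_1,\dots,e_m$ is an orthonormal basis of $T_xM$ for the induced metric. Let $p_1:N\times\mathbb{R}\to N$ be the projection and write $p_1(M)=p_1(\varphi(M))$. For $\kappa\in\mathbb{R}$ let $S_\kappa(t)=\sin(\sqrt{\kappa}\,t)/\sqrt{\kappa}$ if $\kappa>0$, $S_\kappa(t)=t$ if $\kappa=0$, $S_\kappa(t)=\sinh(\sqrt{-\kappa}\,t)/\sqrt{-\kappa}$ if $\kappa<0$, and let $C_\kappa=S_\kappa'$. The function $C_\kappa/S_\kappa$ is injective on $(0,\pi/\sqrt{\kappa})$ (on $(0,\infty)$ if $\kappa\le 0$), and $(C_\kappa/S_\kappa)^{-1}$ denotes its inverse there. (1) Let $x_0\in N$ be a point such that the radial sectional curvatures of $N$ along the geodesics issuing from $x_0$ are at most $\kappa$: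 $K(\gamma'(t),v)\le\kappa$ for every unit-speed geodesic $\gamma$ with $\gamma(0)=x_0$, every $t>0$ in its domain, and every unit vector $v\perp\gamma'(t)$. Let $R$ be the radius of the smallest closed ball with centre $x_0$ that contains $p_1(M)$. If $R<\mathrm{inj}_N(x_0)$, then $\sup_M|H|/(m-2)$ is a value of $C_\kappa/S_\kappa$ on the above interval and $$R\ \ge\ \Big(\frac{C_\kappa}{S_\kappa}\Big)^{-1}\Big(\frac{\sup_M|H|}{m-2}\Big).$$ (2) Suppose that the radial curvature condition in (1) holds at every point of $N$ (that is, the sectional curvatures of $N$ are at most $\kappa$), and let $R_{p_1(M)}$ be the infimum of the radii of the balls of $N$, of any centre, that contain $p_1(M)$. If $R_{p_1(M)}<\inf_{x\in N}\mathrm{inj}_N(x)$, then $\sup_M|H|/(m-2)$ is a value of $C_\kappa/S_\kappa$ on the above interval and $$R_{p_1(M)}\ \ge\ \Big(\frac{C_\kappa}{S_\kappa}\Big)^{-1}\Big(\frac{\sup_M|H|}{m-2}\Big).$$ -/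

import Mathlib

open Set Manifold Bundle
open scoped ContDiff ENNReal

noncomputable section

/-! ### The functions `S_κ`, `C_κ = S_κ'` and the inverse of `C_κ / S_κ` -/

/-- `S_κ(t)`: the solution of `S'' + κ S = 0`, `S(0) = 0`, `S'(0) = 1`. -/
def snK (κ t : ℝ) : ℝ :=
  if 0 < κ then Real.sin (√κ * t) / √κ
  else if κ < 0 then Real.sinh (√(-κ) * t) / √(-κ)
  else t

/-- `C_κ = S_κ'`. -/
def csK (κ t : ℝ) : ℝ := deriv (snK κ) t

/-- The quotient `C_κ / S_κ`. -/
def ctK (κ t : ℝ) : ℝ := csK κ t / snK κ t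

/-- The interval on which `C_κ / S_κ` is considered: `(0, π / √κ)` for `κ > 0`, and `(0, ∞)` for
`κ ≤ 0`. -/
def ctDomain (κ : ℝ) : Set ℝ := {t | 0 < t ∧ (0 < κ → t < Real.pi / √κ)}

theorem csK_eq (κ t : ℝ) : csK κ t =
    if 0 < κ then Real.cos (√κ * t) else if κ < 0 then Real.cosh (√(-κ) * t) else 1 := by
  unfold csK
  rcases lt_trichotomy κ 0 with h | h | h
  · have h0 : √(-κ) ≠ 0 := (Real.sqrt_pos.2 (by linarith)).ne'
    have : snK κ = fun t => Real.sinh (√(-κ) * t) / √(-κ) := by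
      funext t; simp [snK, h, not_lt.2 h.le]
    rw [this]
    have hd : HasDerivAt (fun t => Real.sinh (√(-κ) * t) / √(-κ))
        (Real.cosh (√(-κ) * t) * (√(-κ) * 1) / √(-κ)) t :=
      (((hasDerivAt_id t).const_mul (√(-κ))).sinh).div_const _
    rw [hd.deriv, if_neg (not_lt.2 h.le), if_pos h]
    field_simp
  · subst h
    have : snK 0 = fun t => t := by funext t; simp [snK]
    rw [this]; simp
  · have h0 : √κ ≠ 0 := (Real.sqrt_pos.2 h).ne'
    have : snK κ = fun t => Real.sin (√κ * t) / √κ := by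
      funext t; simp [snK, h]
    rw [this]
    have hd : HasDerivAt (fun t => Real.sin (√κ * t) / √κ)
        (Real.cos (√κ * t) * (√κ * 1) / √κ) t :=
      (((hasDerivAt_id t).const_mul (√κ)).sin).div_const _
    rw [hd.deriv, if_pos h]
    field_simp

/-- `C_κ / S_κ` is injective on its interval, so that its inverse is well defined. -/
theorem ctK_injOn (κ : ℝ) : InjOn (ctK κ) (ctDomain κ) := by
  rintro a ⟨ha, ha'⟩ b ⟨hb, hb'⟩ hab
  simp only [ctK, csK_eq, snK] at hab
  rcases lt_trichotomy κ 0 with h | h | h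
  · have h0 : 0 < √(-κ) := Real.sqrt_pos.2 (by linarith)
    have h1 : 0 < Real.sinh (√(-κ) * a) := Real.sinh_pos_iff.2 (by positivity)
    have h2 : 0 < Real.sinh (√(-κ) * b) := Real.sinh_pos_iff.2 (by positivity)
    simp only [not_lt.2 h.le, h, if_true, if_false] at hab
    have h3 : Real.sinh (√(-κ) * a - √(-κ) * b) = 0 := by
      rw [Real.sinh_sub]
      field_simp at hab
      linarith
    have h4 := Real.sinh_eq_zero.1 h3
    have h5 : √(-κ) * (a - b) = 0 := by linarith
    rcases mul_eq_zero.1 h5 with h6 | h6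
    · exact absurd h6 h0.ne'
    · linarith
  · subst h
    simpa using hab
  · have h0 : 0 < √κ := Real.sqrt_pos.2 h
    have ha2 : √κ * a < Real.pi := by
      have := ha' h; rw [lt_div_iff₀ h0] at this; linarith
    have hb2 : √κ * b < Real.pi := by
      have := hb' h; rw [lt_div_iff₀ h0] at this; linarith
    have ha3 : 0 < √κ * a := by positivity
    have hb3 : 0 < √κ * b := by positivity
    have h1 : 0 < Real.sin (√κ * a) := Real.sin_pos_of_pos_of_lt_pi ha3 ha2
    have h2 : 0 < Real.sin (√κ * b) := Real.sin_pos_of_pos_of_lt_pi hb3 hb2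
    simp only [h, if_true] at hab
    have h3 : Real.sin (√κ * a - √κ * b) = 0 := by
      rw [Real.sin_sub]
      field_simp at hab
      linarith
    have h4 := (Real.sin_eq_zero_iff_of_lt_of_lt (by linarith) (by linarith)).1 h3
    have h5 : √κ * (a - b) = 0 := by linarith
    rcases mul_eq_zero.1 h5 with h6 | h6
    · exact absurd h6 h0.ne'
    · linarith

/-- The inverse function `(C_κ / S_κ)⁻¹`; it is meaningful at the values of `C_κ / S_κ` on
`ctDomain κ`. -/
def ctInv (κ s : ℝ) : ℝ := Function.invFunOn (ctK κ) (ctDomain κ) s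

/-! ### Riemannian geometry in charts

The tangent space `TangentSpace I x` is, as in Mathlib, the model space `E` through the preferred
chart at `x`. -/

section Riemannian

variable {E : Type*} [NormedAddCommGroup E] [NormedSpace ℝ E]
  {H : Type*} [TopologicalSpace H] (I : ModelWithCorners ℝ E H)
  (W : Type*) [TopologicalSpace W] [ChartedSpace H W]

/-- A field of scalar-valued functions of two tangent vectors (used for Riemannian metrics). -/
abbrev MetricField := ∀ x : W, TangentSpace I x → TangentSpace I x → ℝ

/-- The metric of a Riemannian manifold as a `MetricField`. -/
def riemannianMetric [RiemannianBundle (fun x : W => TangentSpace I x)] : MetricField I W :=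
  fun _ u v => inner ℝ u v

variable {I W}

/-- The product metric on `W × ℝ`, `⟨u, v⟩ = g (dp₁ u, dp₁ v) + dp₂ u * dp₂ v`. -/
def prodLineMetric (g : MetricField I W) : MetricField (I.prod 𝓘(ℝ, ℝ)) (W × ℝ) :=
  fun p u v =>
    g p.1 (mfderiv (I.prod 𝓘(ℝ, ℝ)) I Prod.fst p u) (mfderiv (I.prod 𝓘(ℝ, ℝ)) I Prod.fst p v)
    + (show ℝ from mfderiv (I.prod 𝓘(ℝ, ℝ)) 𝓘(ℝ, ℝ) Prod.snd p u)
      * (show ℝ from mfderiv (I.prod 𝓘(ℝ, ℝ)) 𝓘(ℝ, ℝ) Prod.snd p v)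

/-- The coordinate expression, in the chart at `p`, of a metric `g` at the point with
coordinates `y`. -/
def chartMetric (g : MetricField I W) (p : W) (y u v : E) : ℝ :=
  g ((extChartAt I p).symm y)
    (mfderiv 𝓘(ℝ, E) I (extChartAt I p).symm y u)
    (mfderiv 𝓘(ℝ, E) I (extChartAt I p).symm y v)

/-- The Christoffel symbols of the first kind in the chart at `p`:
`(1/2) (∂_u g(v, w) + ∂_v g(u, w) - ∂_w g(u, v))` for coordinate vectors `u, v, w`. -/
def christoffelFirst (g : MetricField I W) (p : W) (y u v w : E) : ℝ :=
  (1 / 2) * (fderiv ℝ (fun z => chartMetric g p z v w) y u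
    + fderiv ℝ (fun z => chartMetric g p z u w) y v
    - fderiv ℝ (fun z => chartMetric g p z u v) y w)

variable [FiniteDimensional ℝ E]

/-- The Gram matrix `g_{ij}` in the chart at `p`. -/
def chartGram (g : MetricField I W) (p : W) (y : E) :
    Matrix (Fin (Module.finrank ℝ E)) (Fin (Module.finrank ℝ E)) ℝ :=
  Matrix.of fun i j => chartMetric g p y (Module.finBasis ℝ E i) (Module.finBasis ℝ E j)

/-- The Christoffel symbols of the second kind: `Γ(u, v) = u^i v^j Γ_{ij}^k ∂_k`, i.e. the
coordinate vector of the Levi-Civita derivative `∇_u v` of constant coordinate fields. -/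
def christoffel (g : MetricField I W) (p : W) (y u v : E) : E :=
  ∑ i, ∑ j, ((chartGram g p y)⁻¹ i j * christoffelFirst g p y u v (Module.finBasis ℝ E j)) •
    Module.finBasis ℝ E i

/-- The velocity of a curve. -/
def velocity (γ : ℝ → W) (t : ℝ) : TangentSpace I (γ t) :=
  mfderiv 𝓘(ℝ, ℝ) I γ t (1 : ℝ)

/-- The covariant acceleration `∇_{γ'} γ'` at time `t`, computed in the chart at `γ t`. -/
def covAccel (g : MetricField I W) (γ : ℝ → W) (t : ℝ) : TangentSpace I (γ t) :=
  (deriv (deriv fun s => extChartAt I (γ t) (γ s)) t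
    + christoffel g (γ t) (extChartAt I (γ t) (γ t))
        (deriv (fun s => extChartAt I (γ t) (γ s)) t)
        (deriv (fun s => extChartAt I (γ t) (γ s)) t) : E)

/-- `γ` is a geodesic on the open set `s` of times. -/
def IsGeodesicOn (g : MetricField I W) (γ : ℝ → W) (s : Set ℝ) : Prop :=
  ContMDiffOn 𝓘(ℝ, ℝ) I ∞ γ s ∧ ∀ t ∈ s, covAccel g γ t = 0

/-- The Riemann curvature tensor `R(u, v) w = ∇_u ∇_v w - ∇_v ∇_u w - ∇_{[u, v]} w` at `x`,
computed in the chart at `x` with constant coordinate fields. -/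
def riemannTensor (g : MetricField I W) (x : W) (u v w : TangentSpace I x) : TangentSpace I x :=
  let y : E := extChartAt I x x
  (fderiv ℝ (fun z => christoffel g x z v w) y u - fderiv ℝ (fun z => christoffel g x z u w) y v
    + christoffel g x y u (christoffel g x y v w)
    - christoffel g x y v (christoffel g x y u w) : E)

/-- The sectional curvature of the plane spanned by `u` and `v`. -/
def sectionalCurvature (g : MetricField I W) (x : W) (u v : TangentSpace I x) : ℝ :=
  g x (riemannTensor g x u v v) u / (g x u u * g x v v - g x u v ^ 2)

/-- The radial sectional curvatures along the geodesics issuing from `x₀` are at most `κ`. -/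
def RadialCurvatureLE (g : MetricField I W) (x₀ : W) (κ : ℝ) : Prop :=
  ∀ (γ : ℝ → W) (a b : ℝ), a < 0 → 0 < b → IsGeodesicOn g γ (Ioo a b) → γ 0 = x₀ →
    g (γ 0) (velocity γ 0) (velocity γ 0) = 1 →
    ∀ t ∈ Ioo 0 b, ∀ v : TangentSpace I (γ t),
      g (γ t) v v = 1 → g (γ t) (velocity γ t) v = 0 →
      sectionalCurvature g (γ t) (velocity γ t) v ≤ κ

/-- The exponential map at `x₀` is defined on the open ball of radius `r` of the tangent space
`T_{x₀} W` and is a diffeomorphism from this ball onto its image, an open set. The map `Φ` is the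
exponential map: it sends the rays `t ↦ t u`, `u` a unit vector, to the geodesics with initial
velocity `u`. -/
def IsNormalRadius (g : MetricField I W) (x₀ : W) (r : ℝ) : Prop :=
  ∃ Φ : OpenPartialHomeomorph E W,
    Φ.source = {v : E | g x₀ (v : TangentSpace I x₀) (v : TangentSpace I x₀) < r ^ 2} ∧
    ContMDiffOn 𝓘(ℝ, E) I ∞ Φ Φ.source ∧
    ContMDiffOn I 𝓘(ℝ, E) ∞ Φ.symm Φ.target ∧
    Φ 0 = x₀ ∧
    ∀ u : TangentSpace I x₀, g x₀ u u = 1 →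
      IsGeodesicOn g (fun t : ℝ => Φ (t • (u : E))) (Ioo (-r) r) ∧
      (⟨Φ ((0 : ℝ) • (u : E)), velocity (fun t : ℝ => Φ (t • (u : E))) 0⟩ : TangentBundle I W) =
        ⟨x₀, u⟩

/-- The injectivity radius at `x₀`. -/
def injRadius (g : MetricField I W) (x₀ : W) : ℝ≥0∞ :=
  ⨆ (r : ℝ) (_ : 0 < r ∧ IsNormalRadius g x₀ r), ENNReal.ofReal r

end Riemannian

/-! ### Immersed submanifolds and the mean curvature vector -/

section Immersion

variable {E' : Type*} [NormedAddCommGroup E'] [NormedSpace ℝ E'] [FiniteDimensional ℝ E']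
  {H' : Type*} [TopologicalSpace H'] {J : ModelWithCorners ℝ E' H'}
  {M : Type*} [TopologicalSpace M] [ChartedSpace H' M]
  {E : Type*} [NormedAddCommGroup E] [NormedSpace ℝ E] [FiniteDimensional ℝ E]
  {H : Type*} [TopologicalSpace H] {I : ModelWithCorners ℝ E H}
  {W : Type*} [TopologicalSpace W] [ChartedSpace H W]

variable (J I) in
/-- A smooth immersion of finite-dimensional manifolds: a smooth map with injective
differentials. -/
def IsSmoothImmersion (φ : M → W) : Prop :=
  ContMDiff J I ∞ φ ∧ ∀ x, Function.Injective (mfderiv J I φ x)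

/-- The Gram matrix of the induced metric on `T_x M`, in the coordinate basis of the chart
at `x`. -/
def inducedGram (g : MetricField I W) (φ : M → W) (x : M) :
    Matrix (Fin (Module.finrank ℝ E')) (Fin (Module.finrank ℝ E')) ℝ :=
  Matrix.of fun i j => g (φ x)
    (mfderiv J I φ x (Module.finBasis ℝ E' i)) (mfderiv J I φ x (Module.finBasis ℝ E' j))

/-- The component of `a ∈ T_{φ x} W` normal to `dφ (T_x M)`. -/
def normalPart (g : MetricField I W) (φ : M → W) (x : M) (a : TangentSpace I (φ x)) :
    TangentSpace I (φ x) :=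
  a - ∑ i, ∑ j, ((inducedGram (J := J) g φ x)⁻¹ i j
      * g (φ x) a (mfderiv J I φ x (Module.finBasis ℝ E' j))) •
    mfderiv J I φ x (Module.finBasis ℝ E' i)

/-- The second fundamental form `α(u, v) = (∇_u dφ(v))^⊥` of an immersion, where the covariant
derivative is computed in the charts at `x` and `φ x`, with `v` extended as a constant coordinate
field. -/
def secondFundamentalForm (g : MetricField I W) (φ : M → W) (x : M) (u v : TangentSpace J x) :
    TangentSpace I (φ x) :=
  let F : E' → E := fun z => extChartAt I (φ x) (φ ((extChartAt J x).symm z))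
  let y : E' := extChartAt J x x
  normalPart (J := J) g φ x
    (fderiv ℝ (fun z => fderiv ℝ F z v) y u
      + christoffel g (φ x) (F y) (fderiv ℝ F y u) (fderiv ℝ F y v) : E)

/-- The mean curvature vector: the (unnormalized) trace of the second fundamental form with respect
to the induced metric, `∑ α(e_i, e_i)` for an orthonormal basis `e_i` of `T_x M`. -/
def meanCurvatureVector (g : MetricField I W) (φ : M → W) (x : M) : TangentSpace I (φ x) :=
  ∑ i, ∑ j, (inducedGram (J := J) g φ x)⁻¹ i j •
    secondFundamentalForm (J := J) g φ x (Module.finBasis ℝ E' i) (Module.finBasis ℝ E' j)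

variable (J) in
/-- `|H|(x)`. -/
def meanCurvatureNorm (g : MetricField I W) (φ : M → W) (x : M) : ℝ :=
  √(g (φ x) (meanCurvatureVector (J := J) g φ x) (meanCurvatureVector (J := J) g φ x))

variable (J) in
/-- `sup_M |H|`. -/
def supMeanCurvature (g : MetricField I W) (φ : M → W) : ℝ :=
  ⨆ x : M, meanCurvatureNorm J g φ x

end Immersion

/-! ### Extrinsic radius -/

/-- The radius of the smallest closed ball with centre `x₀` that contains `A`. -/
def extrinsicRadiusAt {X : Type*} [MetricSpace X] (x₀ : X) (A : Set X) : ℝ :=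
  sInf {r : ℝ | A ⊆ Metric.closedBall x₀ r}

/-- The extrinsic radius of `A`: the infimum of the radii of the balls, of any centre, that
contain `A`. -/
def extrinsicRadius {X : Type*} [MetricSpace X] (A : Set X) : ℝ :=
  sInf {r : ℝ | ∃ x : X, A ⊆ Metric.closedBall x r}

end

/-!
In a normal chart around the centre `x₀`, put `e x = |x|² / 2`, half the squared distance to `x₀`.
Along a ray, the Hessian of `e` is governed by a Jacobi field, and Sturm comparison with
`y'' + κ y = 0` shows that at distance `ρ` from `x₀` it is at least `ρ C_κ(ρ) / S_κ(ρ)` times the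
metric on the directions orthogonal to the ray.

At a point of `M` where the distance of `p₁ ∘ φ` to `x₀` is maximal, `M` is orthogonal to the
gradient of `e`, and the Hessian of `e ∘ p₁ ∘ φ` has trace at most `0`. By the Gauss formula that
trace is the trace of the Hessian of `e` over the tangent space of `M` plus the derivative of `e` in
the direction of `H`. By Bessel's inequality the direction of `ℝ` takes at most one unit from the
trace of the metric, which leaves at least `m - 1`, and Cauchy-Schwarz gives
`|H| ≥ (m - 1) C_κ(ρ) / S_κ(ρ)`.
-/

noncomputable section

open Filter Topology

set_option maxSynthPendingDepth 3

section NormedSpaces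

-- `TangentSpace I x` unfolds to the model space, so in the normed-space part of the argument these
-- instances would be tried on every vector space.
attribute [-instance]
  Bundle.instNormedAddCommGroupOfRiemannianBundleOfIsTopologicalAddGroupOfContinuousConstSMulReal
  Bundle.instInnerProductSpaceReal

section SecondDerivative

variable {X Y Z : Type*} [NormedAddCommGroup X] [NormedSpace ℝ X]
  [NormedAddCommGroup Y] [NormedSpace ℝ Y] [NormedAddCommGroup Z] [NormedSpace ℝ Z]

theorem hasFDerivAt_fderiv {f : X → Y} {x : X} (hf : ContDiffAt ℝ 2 f x) :
    HasFDerivAt (fderiv ℝ f) (fderiv ℝ (fderiv ℝ f) x) x :=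
  ((hf.fderiv_right (m := 1) (by norm_num)).differentiableAt (by simp)).hasFDerivAt

theorem fderiv_fderiv_comm {f : X → Y} {x : X} (hf : ContDiffAt ℝ 2 f x) (a b : X) :
    fderiv ℝ (fderiv ℝ f) x a b = fderiv ℝ (fderiv ℝ f) x b a :=
  (hf.isSymmSndFDerivAt (by simp)).eq a b

theorem fderiv_fderiv_apply {f : X → Y} {x : X} (hf : ContDiffAt ℝ 2 f x) (a b : X) :
    fderiv ℝ (fun y => fderiv ℝ f y b) x a = fderiv ℝ (fderiv ℝ f) x a b := by
  rw [((hasFDerivAt_fderiv hf).clm_apply (hasFDerivAt_const b x)).fderiv]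
  simp

theorem fderiv_fderiv_comp {f : Y → Z} {g : X → Y} {x : X} (hf : ContDiffAt ℝ 2 f (g x))
    (hg : ContDiffAt ℝ 2 g x) (a b : X) :
    fderiv ℝ (fderiv ℝ (f ∘ g)) x a b
      = fderiv ℝ (fderiv ℝ f) (g x) (fderiv ℝ g x a) (fderiv ℝ g x b)
        + fderiv ℝ f (g x) (fderiv ℝ (fderiv ℝ g) x a b) := by
  have chain_rule : fderiv ℝ (f ∘ g) =ᶠ[𝓝 x] fun y => (fderiv ℝ f (g y)).comp (fderiv ℝ g y) := by
    filter_upwards [hg.eventually (by simp), hg.continuousAt.eventually (hf.eventually (by simp))]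
      with y hgy hfy
    exact fderiv_comp y (hfy.differentiableAt (by simp)) (hgy.differentiableAt (by simp))
  have product_rule := ((hasFDerivAt_fderiv hf).comp x
    (hg.differentiableAt (by simp)).hasFDerivAt).clm_comp (hasFDerivAt_fderiv hg)
  rw [(product_rule.congr_of_eventuallyEq chain_rule).fderiv]
  simp [add_comm]

theorem deriv_deriv_nonpos_of_isLocalMax {f : ℝ → ℝ} {t : ℝ} (hf : ContinuousAt f t)
    (hmax : IsLocalMax f t) : deriv (deriv f) t ≤ 0 := by
  by_contra! hpos
  have hmin : IsLocalMin f t := isLocalMin_of_deriv_deriv_pos hpos hmax.deriv_eq_zero hf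
  have hconst : f =ᶠ[𝓝 t] fun _ => f t := by
    filter_upwards [hmin, hmax] with s hs hs' using le_antisymm hs' hs
  rw [hconst.deriv.deriv_eq] at hpos
  simp at hpos

theorem deriv_deriv_comp_add_smul {f : X → Y} {x a : X} {t : ℝ}
    (hf : ContDiffAt ℝ 2 f (x + t • a)) :
    deriv (deriv fun s : ℝ => f (x + s • a)) t = fderiv ℝ (fderiv ℝ f) (x + t • a) a a := by
  have hline (s : ℝ) : HasDerivAt (fun s : ℝ => x + s • a) a s := by
    simpa using ((hasDerivAt_id s).smul_const a).const_add x
  have hfirst : deriv (fun s : ℝ => f (x + s • a)) =ᶠ[𝓝 t] fun s => fderiv ℝ f (x + s • a) a := by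
    filter_upwards [(hline t).continuousAt.eventually (hf.eventually (by simp))] with s hs
    exact ((hs.differentiableAt (by simp)).hasFDerivAt.comp_hasDerivAt s (hline s)).deriv
  have hsecond : HasFDerivAt (fun y => fderiv ℝ f y a) ((fderiv ℝ (fderiv ℝ f) (x + t • a)).flip a)
      (x + t • a) := by
    simpa using (hasFDerivAt_fderiv hf).clm_apply (hasFDerivAt_const a _)
  rw [hfirst.deriv_eq]
  exact (hsecond.comp_hasDerivAt t (hline t)).deriv

theorem fderiv_fderiv_nonpos_of_isLocalMax {f : X → ℝ} {x : X} (hf : ContDiffAt ℝ 2 f x)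
    (hmax : IsLocalMax f x) (a : X) : fderiv ℝ (fderiv ℝ f) x a a ≤ 0 := by
  have hx : x + (0 : ℝ) • a = x := by simp
  have hline : Tendsto (fun t : ℝ => x + t • a) (𝓝 0) (𝓝 x) :=
    (show Continuous fun t : ℝ => x + t • a by fun_prop).tendsto' 0 x hx
  have hsecond := deriv_deriv_comp_add_smul (hx.symm ▸ hf)
  rw [hx] at hsecond
  rw [← hsecond]
  refine deriv_deriv_nonpos_of_isLocalMax ?_ ?_
  · simpa [ContinuousAt, Function.comp_def] using hf.continuousAt.tendsto.comp hline
  · simpa [IsLocalMax, IsMaxFilter] using hline.eventually hmax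

end SecondDerivative

section InnerForm

/-- An inner product on a vector space, given as a continuous bilinear form. -/
structure IsInnerForm {V : Type*} [NormedAddCommGroup V] [NormedSpace ℝ V]
    (k : V →L[ℝ] V →L[ℝ] ℝ) : Prop where
  symm : ∀ a b, k a b = k b a
  pos : ∀ a, a ≠ 0 → 0 < k a a

variable {V V' W : Type*} [NormedAddCommGroup V] [NormedSpace ℝ V]
  [NormedAddCommGroup V'] [NormedSpace ℝ V'] [NormedAddCommGroup W] [NormedSpace ℝ W]
  {k : V →L[ℝ] V →L[ℝ] ℝ}

theorem sum_apply_smul_coord [FiniteDimensional ℝ V] {ι : Type*} [Fintype ι]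
    (b : Module.Basis ι ℝ V) (f : V →L[ℝ] ℝ) :
    ∑ i, f (b i) • (b.coord i).toContinuousLinearMap = f := by
  ext c
  simpa using congr($(b.sum_dual_apply_smul_coord (f : V →ₗ[ℝ] ℝ)) c)

namespace IsInnerForm

theorem nonneg (hk : IsInnerForm k) (a : V) : 0 ≤ k a a := by
  rcases eq_or_ne a 0 with rfl | ha
  · simp
  · exact (hk.pos a ha).le

theorem eq_zero_of_apply_self_eq_zero (hk : IsInnerForm k) {a : V} (ha : k a a = 0) : a = 0 :=
  by_contra fun h => (hk.pos a h).ne' ha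

theorem ext_left (hk : IsInnerForm k) {a b : V} (hab : ∀ c, k a c = k b c) : a = b :=
  sub_eq_zero.1 <| hk.eq_zero_of_apply_self_eq_zero <| by simp [hab]

theorem apply_sq_le (hk : IsInnerForm k) (a b : V) : k a b ^ 2 ≤ k a a * k b b :=
  k.toBilinForm.apply_sq_le_of_symm hk.nonneg ⟨hk.symm⟩ a b

theorem bilinearComp (hk : IsInnerForm k) {L : V' →L[ℝ] V} (hL : Function.Injective L) :
    IsInnerForm (k.bilinearComp L L) where
  symm a b := hk.symm (L a) (L b)
  pos a ha := hk.pos (L a) fun h => ha (hL (h.trans L.map_zero.symm))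

theorem exists_sqrt_smul_eq (hk : IsInnerForm k) {a : V} (ha : a ≠ 0) :
    ∃ u, k u u = 1 ∧ √(k a a) • u = a := by
  have hpos := hk.pos a ha
  have hsq := Real.mul_self_sqrt hpos.le
  refine ⟨(√(k a a))⁻¹ • a, ?_, smul_inv_smul₀ (Real.sqrt_ne_zero'.2 hpos) a⟩
  simp only [map_smul, smul_apply, smul_eq_mul]
  rw [← mul_assoc, ← mul_inv, hsq, inv_mul_cancel₀ hpos.ne']

theorem isInvertible [FiniteDimensional ℝ V] (hk : IsInnerForm k) : k.IsInvertible := by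
  have hinj : Function.Injective (k : V →ₗ[ℝ] V →L[ℝ] ℝ) := fun a b hab =>
    hk.ext_left fun c => congr($hab c)
  have hdim : Module.finrank ℝ V = Module.finrank ℝ (V →L[ℝ] ℝ) := by
    rw [← (LinearMap.toContinuousLinearMap (𝕜 := ℝ) (E := V) (F' := ℝ)).finrank_eq]
    exact Subspace.dual_finrank_eq.symm
  exact ⟨(LinearMap.linearEquivOfInjective _ hinj hdim).toContinuousLinearEquiv, by ext; simp⟩

theorem exists_orthonormal_basis [FiniteDimensional ℝ V] (hk : IsInnerForm k) :
    ∃ e : Module.Basis (Fin (Module.finrank ℝ V)) ℝ V,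
      ∀ i j, k (e i) (e j) = if i = j then 1 else 0 := by
  obtain ⟨v, hv⟩ := LinearMap.BilinForm.exists_orthogonal_basis (B := k.toBilinForm) ⟨hk.symm⟩
  have hpos (i) : 0 < √(k (v i) (v i)) := Real.sqrt_pos.2 (hk.pos _ (v.ne_zero i))
  refine ⟨v.isUnitSMul fun i => (inv_ne_zero (hpos i).ne').isUnit, fun i j => ?_⟩
  rw [Module.Basis.isUnitSMul_apply, Module.Basis.isUnitSMul_apply, map_smul, map_smul,
    smul_apply, smul_eq_mul, smul_eq_mul]
  split_ifs with hij
  · subst hij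
    have hsq := Real.mul_self_sqrt (hk.nonneg (v i))
    field_simp [(hpos i).ne']
    linarith
  · have horth : k (v i) (v j) = 0 := hv hij
    rw [horth, mul_zero, mul_zero]

theorem inv_gram_apply [FiniteDimensional ℝ V] (hk : IsInnerForm k) {ι : Type*} [Fintype ι]
    [DecidableEq ι] (b : Module.Basis ι ℝ V) (i j : ι) :
    (Matrix.of fun i j => k (b i) (b j))⁻¹ i j
      = b.coord i (k.inverse (b.coord j).toContinuousLinearMap) := by
  suffices h : (Matrix.of fun i j => b.coord i (k.inverse (b.coord j).toContinuousLinearMap))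
      * (Matrix.of fun i j => k (b i) (b j)) = 1 by
    rw [Matrix.inv_eq_left_inv h, Matrix.of_apply]
  ext i l
  calc ∑ j, b.coord i (k.inverse (b.coord j).toContinuousLinearMap) * k (b j) (b l)
      = b.coord i (k.inverse (∑ j, k (b j) (b l) • (b.coord j).toContinuousLinearMap)) := by
        simp only [map_sum, map_smul, smul_eq_mul, mul_comm]
    _ = b.coord i (k.inverse (k (b l))) := by simp_rw [hk.symm _ (b l), sum_apply_smul_coord]
    _ = (1 : Matrix ι ι ℝ) i l := by
        rw [hk.isInvertible.inverse_apply_self]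
        simp [Matrix.one_apply, Finsupp.single_apply, eq_comm]

theorem inverse_eq_sum_inv_gram [FiniteDimensional ℝ V] (hk : IsInnerForm k) {ι : Type*}
    [Fintype ι] [DecidableEq ι] (b : Module.Basis ι ℝ V) (f : V →L[ℝ] ℝ) :
    k.inverse f
      = ∑ i, ∑ j, ((Matrix.of fun i j => k (b i) (b j))⁻¹ i j * f (b j)) • b i := by
  simp_rw [hk.inv_gram_apply, ← Finset.sum_smul]
  conv_lhs => rw [← sum_apply_smul_coord b f, ← b.sum_repr (k.inverse _)]
  simp [mul_comm]

end IsInnerForm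

/-- The trace of a bilinear map `Q` with respect to the inner product `k`, i.e. `∑ Q (e i) (e i)`
for a `k`-orthonormal basis `e`; it is defined through a basis and its `k`-dual basis. -/
def metricTrace [FiniteDimensional ℝ V] (k : V →L[ℝ] V →L[ℝ] ℝ) (Q : V →L[ℝ] V →L[ℝ] W) : W :=
  ∑ i, Q (k.inverse ((Module.finBasis ℝ V).coord i).toContinuousLinearMap) (Module.finBasis ℝ V i)

/-- The orthogonal projection, with respect to the inner product `k`, onto the orthogonal
complement of the range of `L`. -/
def normalProjection (k : V →L[ℝ] V →L[ℝ] ℝ) (L : V' →L[ℝ] V) : V →L[ℝ] V :=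
  .id ℝ V - L ∘L (k.bilinearComp L L).inverse ∘L ContinuousLinearMap.precomp ℝ L ∘L k

section MetricTrace

variable [FiniteDimensional ℝ V]

theorem metricTrace_eq_sum_inv_gram (hk : IsInnerForm k) (Q : V →L[ℝ] V →L[ℝ] W) :
    metricTrace k Q
      = ∑ i, ∑ j, (Matrix.of fun i j => k (Module.finBasis ℝ V i) (Module.finBasis ℝ V j))⁻¹ i j
          • Q (Module.finBasis ℝ V i) (Module.finBasis ℝ V j) := by
  rw [Finset.sum_comm]
  refine Finset.sum_congr rfl fun j _ => ?_
  simp_rw [hk.inv_gram_apply]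
  conv_lhs => rw [← (Module.finBasis ℝ V).sum_repr (k.inverse _)]
  simp only [map_sum, map_smul, sum_apply, smul_apply, Module.Basis.coord_apply]

theorem metricTrace_eq_sum_orthonormal (hk : IsInnerForm k) {ι : Type*} [Fintype ι]
    [DecidableEq ι] (e : Module.Basis ι ℝ V) (he : ∀ i j, k (e i) (e j) = if i = j then 1 else 0)
    (Q : V →L[ℝ] V →L[ℝ] W) : metricTrace k Q = ∑ i, Q (e i) (e i) := by
  set b := Module.finBasis ℝ V
  have hdual (l : ι) : k.inverse (e.coord l).toContinuousLinearMap = e l := by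
    rw [hk.isInvertible.inverse_apply_eq]
    refine ContinuousLinearMap.coe_injective (e.ext fun i => ?_)
    simp [he, Finsupp.single_apply, eq_comm]
  have hcoord (i) : (b.coord i).toContinuousLinearMap
      = ∑ l, b.coord i (e l) • (e.coord l).toContinuousLinearMap :=
    (sum_apply_smul_coord e (b.coord i).toContinuousLinearMap).symm
  calc metricTrace k Q = ∑ i, ∑ l, b.coord i (e l) • Q (e l) (b i) := by
        simp only [metricTrace, b, hcoord, map_sum, map_smul, hdual, sum_apply, smul_apply]
    _ = ∑ l, Q (e l) (∑ i, b.coord i (e l) • b i) := by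
        rw [Finset.sum_comm]
        simp only [map_sum, map_smul]
    _ = ∑ l, Q (e l) (e l) := by simp only [Module.Basis.coord_apply, b.sum_repr]

theorem map_metricTrace {W' : Type*} [NormedAddCommGroup W'] [NormedSpace ℝ W'] (A : W →L[ℝ] W')
    (k : V →L[ℝ] V →L[ℝ] ℝ) (Q : V →L[ℝ] V →L[ℝ] W) :
    A (metricTrace k Q) = metricTrace k ((ContinuousLinearMap.compL ℝ V W W' A).comp Q) := by
  simp [metricTrace]

theorem metricTrace_sub (k : V →L[ℝ] V →L[ℝ] ℝ) (Q Q' : V →L[ℝ] V →L[ℝ] W) :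
    metricTrace k (Q - Q') = metricTrace k Q - metricTrace k Q' := by
  simp [metricTrace]

theorem metricTrace_smul (k : V →L[ℝ] V →L[ℝ] ℝ) (c : ℝ) (Q : V →L[ℝ] V →L[ℝ] W) :
    metricTrace k (c • Q) = c • metricTrace k Q := by
  simp [metricTrace, Finset.smul_sum]

theorem metricTrace_self (hk : IsInnerForm k) : metricTrace k k = Module.finrank ℝ V := by
  obtain ⟨e, he⟩ := hk.exists_orthonormal_basis
  simp [metricTrace_eq_sum_orthonormal hk e he, he]

theorem metricTrace_le_metricTrace (hk : IsInnerForm k) {Q Q' : V →L[ℝ] V →L[ℝ] ℝ}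
    (h : ∀ a, Q a a ≤ Q' a a) : metricTrace k Q ≤ metricTrace k Q' := by
  obtain ⟨e, he⟩ := hk.exists_orthonormal_basis
  simp only [metricTrace_eq_sum_orthonormal hk e he]
  exact Finset.sum_le_sum fun i _ => h (e i)

/-- Bessel's inequality: the trace of `ℓ ⊗ ℓ` is the squared dual norm of `ℓ`. -/
theorem metricTrace_smulRight_le_one (hk : IsInnerForm k) {l : V →L[ℝ] ℝ}
    (hl : ∀ a, l a ^ 2 ≤ k a a) : metricTrace k (l.smulRight l) ≤ 1 := by
  set a := k.inverse l with ha
  have htrace : metricTrace k (l.smulRight l) = l a := by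
    suffices h : metricTrace k (l.smulRight l) = l (k.inverse (∑ i, l (Module.finBasis ℝ V i) •
        ((Module.finBasis ℝ V).coord i).toContinuousLinearMap)) by
      rw [h, sum_apply_smul_coord]
    simp only [metricTrace, map_sum, map_smul, ContinuousLinearMap.smulRight_apply, smul_apply,
      smul_eq_mul, mul_comm]
  have hka : k a a = l a := by rw [ha, hk.isInvertible.self_apply_inverse]
  rw [htrace]
  nlinarith [hl a]

theorem metricTrace_bilinearComp (hk : IsInnerForm k) {T : V' →L[ℝ] V}
    (hT : Function.Bijective T) [FiniteDimensional ℝ V'] (Q : V →L[ℝ] V →L[ℝ] W) :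
    metricTrace (k.bilinearComp T T) (Q.bilinearComp T T) = metricTrace k Q := by
  have hkT := hk.bilinearComp hT.injective
  obtain ⟨e, he⟩ := hkT.exists_orthonormal_basis
  rw [metricTrace_eq_sum_orthonormal hkT e he,
    metricTrace_eq_sum_orthonormal hk (e.map (LinearEquiv.ofBijective (T : V' →ₗ[ℝ] V) hT))
      (by simpa using he)]
  simp

end MetricTrace

section NormalProjection

variable {L : V' →L[ℝ] V}

theorem normalProjection_apply (k : V →L[ℝ] V →L[ℝ] ℝ) (L : V' →L[ℝ] V) (w : V) :
    normalProjection k L w = w - L ((k.bilinearComp L L).inverse ((k w).comp L)) := rfl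

theorem map_normalProjection {A : W →L[ℝ] V} (L : V' →L[ℝ] W) (w : W) :
    A (normalProjection (k.bilinearComp A A) L w) = normalProjection k (A ∘L L) (A w) := by
  simp only [normalProjection_apply, map_sub]
  rfl

variable [FiniteDimensional ℝ V']

theorem normalProjection_eq_sub_sum (hk : IsInnerForm k) (hL : Function.Injective L)
    {ι : Type*} [Fintype ι] [DecidableEq ι] (b : Module.Basis ι ℝ V') (w : V) :
    normalProjection k L w = w - ∑ i, ∑ j,
      ((Matrix.of fun i j => k.bilinearComp L L (b i) (b j))⁻¹ i j * k w (L (b j))) • L (b i) := by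
  rw [normalProjection_apply, (hk.bilinearComp hL).inverse_eq_sum_inv_gram b]
  simp only [map_sum, map_smul, ContinuousLinearMap.comp_apply]

theorem normalProjection_orthogonal (hk : IsInnerForm k) (hL : Function.Injective L) (w : V)
    (a : V') : k (normalProjection k L w) (L a) = 0 := by
  have h := congr($((hk.bilinearComp hL).isInvertible.self_apply_inverse ((k w).comp L)) a)
  simpa [normalProjection_apply, sub_eq_zero] using h.symm

theorem eq_normalProjection (hk : IsInnerForm k) (hL : Function.Injective L) {w x : V} {a : V'}
    (ha : w - x = L a) (hx : ∀ a, k x (L a) = 0) : x = normalProjection k L w := by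
  have hinv : (k.bilinearComp L L).inverse ((k w).comp L) = a := by
    rw [(hk.bilinearComp hL).isInvertible.inverse_apply_eq]
    ext c
    have := congr(k $ha (L c))
    simpa [hx] using this
  rw [normalProjection_apply, hinv, ← ha, sub_sub_cancel]

theorem normalProjection_range (hk : IsInnerForm k) (hL : Function.Injective L) (a : V') :
    normalProjection k L (L a) = 0 :=
  (eq_normalProjection hk hL (sub_zero _) (by simp)).symm

theorem normalProjection_comp (hk : IsInnerForm k) (hL : Function.Injective L)
    {T : W →L[ℝ] V'} (hT : Function.Bijective T) (w : V) [FiniteDimensional ℝ W] :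
    normalProjection k (L ∘L T) w = normalProjection k L w := by
  refine eq_normalProjection hk hL (a := T _) (sub_sub_cancel w _) fun a => ?_
  obtain ⟨b, rfl⟩ := hT.surjective a
  exact normalProjection_orthogonal (L := L ∘L T) hk (hL.comp hT.injective) w b

end NormalProjection

end InnerForm

section MetricField

variable {E : Type*} [NormedAddCommGroup E] [NormedSpace ℝ E]

/-- `h` is a smooth Riemannian metric on the open subset `U` of the vector space `E`. -/
structure IsMetricOn (h : E → E →L[ℝ] E →L[ℝ] ℝ) (U : Set E) : Prop where
  isOpen : IsOpen U
  contDiffOn : ContDiffOn ℝ ∞ h U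
  isInnerForm : ∀ y ∈ U, IsInnerForm (h y)

/-- The Christoffel symbols of the first kind of `h`, as a trilinear form. -/
def christoffelForm (h : E → E →L[ℝ] E →L[ℝ] ℝ) (y : E) : E →L[ℝ] E →L[ℝ] E →L[ℝ] ℝ :=
  (1 / 2 : ℝ) • (fderiv ℝ h y + (fderiv ℝ h y).flip
    - ((ContinuousLinearMap.flipₗᵢ ℝ E E ℝ).toContinuousLinearEquiv :
        (E →L[ℝ] E →L[ℝ] ℝ) →L[ℝ] E →L[ℝ] E →L[ℝ] ℝ).comp (fderiv ℝ h y).flip)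

/-- The Levi-Civita connection of `h`: the covariant derivatives of constant vector fields, i.e.
the Christoffel symbols of the second kind as a bilinear map. -/
def leviCivita (h : E → E →L[ℝ] E →L[ℝ] ℝ) (y : E) : E →L[ℝ] E →L[ℝ] E :=
  (ContinuousLinearMap.compL ℝ E (E →L[ℝ] ℝ) E (h y).inverse).comp (christoffelForm h y)

/-- The curvature `∇_u ∇_v w - ∇_v ∇_u w`, on constant vector fields, of the connection with
Christoffel symbols `Γ`. -/
def connectionCurvature (Γ : E → E →L[ℝ] E →L[ℝ] E) (y u v w : E) : E :=
  fderiv ℝ Γ y u v w - fderiv ℝ Γ y v u w + Γ y u (Γ y v w) - Γ y v (Γ y u w)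

theorem connectionCurvature_smul (Γ : E → E →L[ℝ] E →L[ℝ] E) (y u v w : E) (a b c : ℝ) :
    connectionCurvature Γ y (a • u) (b • v) (c • w)
      = (a * b * c) • connectionCurvature Γ y u v w := by
  simp only [connectionCurvature, map_smul, smul_apply]
  module

theorem christoffelForm_apply (h : E → E →L[ℝ] E →L[ℝ] ℝ) (y a b c : E) :
    christoffelForm h y a b c
      = (1 / 2) * (fderiv ℝ h y a b c + fderiv ℝ h y b a c - fderiv ℝ h y c a b) := by
  simp [christoffelForm]

namespace IsMetricOn

variable {h : E → E →L[ℝ] E →L[ℝ] ℝ} {U : Set E} {y : E}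

theorem mono {V : Set E} (hh : IsMetricOn h U) (hV : IsOpen V) (hVU : V ⊆ U) : IsMetricOn h V :=
  ⟨hV, hh.contDiffOn.mono hVU, fun y hy => hh.isInnerForm y (hVU hy)⟩

theorem mem_nhds (hh : IsMetricOn h U) (hy : y ∈ U) : U ∈ 𝓝 y := hh.isOpen.mem_nhds hy

theorem contDiffAt (hh : IsMetricOn h U) (hy : y ∈ U) : ContDiffAt ℝ ∞ h y :=
  hh.contDiffOn.contDiffAt (hh.mem_nhds hy)

theorem hasFDerivAt (hh : IsMetricOn h U) (hy : y ∈ U) : HasFDerivAt h (fderiv ℝ h y) y :=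
  ((hh.contDiffAt hy).differentiableAt (by simp)).hasFDerivAt

theorem hasFDerivAt_apply (hh : IsMetricOn h U) (hy : y ∈ U) (a b : E) :
    HasFDerivAt (fun z => h z a b) (((fderiv ℝ h y).flip a).flip b) y := by
  have hcomp := ((hh.hasFDerivAt hy).clm_apply (hasFDerivAt_const a y)).clm_apply
    (hasFDerivAt_const b y)
  refine hcomp.congr_fderiv ?_
  ext c; simp

theorem fderiv_symm (hh : IsMetricOn h U) (hy : y ∈ U) (c a b : E) :
    fderiv ℝ h y c a b = fderiv ℝ h y c b a := by
  have hswap : (fun z => h z a b) =ᶠ[𝓝 y] fun z => h z b a := by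
    filter_upwards [hh.mem_nhds hy] with z hz using (hh.isInnerForm z hz).symm a b
  simpa using congr($(((hh.hasFDerivAt_apply hy a b).congr_of_eventuallyEq hswap.symm).unique
    (hh.hasFDerivAt_apply hy b a)) c)

theorem contDiffOn_christoffelForm (hh : IsMetricOn h U) :
    ContDiffOn ℝ ∞ (christoffelForm h) U := by
  have hderiv : ContDiffOn ℝ ∞ (fderiv ℝ h) U := hh.contDiffOn.fderiv_of_isOpen hh.isOpen (by simp)
  have hflip : ContDiffOn ℝ ∞ (fun y => (fderiv ℝ h y).flip) U :=
    (ContinuousLinearMap.flipₗᵢ ℝ E E (E →L[ℝ] ℝ)).contDiff.comp_contDiffOn hderiv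
  exact ((hderiv.add hflip).sub (contDiffOn_const.clm_comp hflip)).const_smul _

variable [FiniteDimensional ℝ E]

theorem leviCivita_apply (hh : IsMetricOn h U) (hy : y ∈ U) (a b c : E) :
    h y (leviCivita h y a b) c = christoffelForm h y a b c :=
  congr($((hh.isInnerForm y hy).isInvertible.self_apply_inverse (christoffelForm h y a b)) c)

theorem eq_leviCivita (hh : IsMetricOn h U) (hy : y ∈ U) {a b x : E}
    (hx : ∀ c, h y x c = christoffelForm h y a b c) : x = leviCivita h y a b :=
  (hh.isInnerForm y hy).ext_left fun c => by rw [hx, hh.leviCivita_apply hy]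

theorem leviCivita_symm (hh : IsMetricOn h U) (hy : y ∈ U) (a b : E) :
    leviCivita h y a b = leviCivita h y b a :=
  hh.eq_leviCivita hy fun c => by
    rw [hh.leviCivita_apply hy, christoffelForm_apply, christoffelForm_apply,
      hh.fderiv_symm hy c a b]
    ring

theorem fderiv_eq_leviCivita (hh : IsMetricOn h U) (hy : y ∈ U) (a b c : E) :
    fderiv ℝ h y a b c = h y (leviCivita h y a b) c + h y b (leviCivita h y a c) := by
  rw [(hh.isInnerForm y hy).symm b, hh.leviCivita_apply hy, hh.leviCivita_apply hy,
    christoffelForm_apply, christoffelForm_apply,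
    hh.fderiv_symm hy a b c, hh.fderiv_symm hy b a c, hh.fderiv_symm hy c a b]
  ring

theorem contDiffOn_leviCivita (hh : IsMetricOn h U) : ContDiffOn ℝ ∞ (leviCivita h) U := by
  have hinverse : ContDiffOn ℝ ∞ (fun y => (h y).inverse) U := fun y hy =>
    ((hh.isInnerForm y hy).isInvertible.contDiffAt_map_inverse).comp_contDiffWithinAt y
      (hh.contDiffOn y hy)
  exact ((ContinuousLinearMap.compL ℝ E (E →L[ℝ] ℝ) E).contDiff.comp_contDiffOn hinverse).clm_comp
    hh.contDiffOn_christoffelForm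

theorem hasFDerivAt_leviCivita (hh : IsMetricOn h U) (hy : y ∈ U) :
    HasFDerivAt (leviCivita h) (fderiv ℝ (leviCivita h) y) y :=
  ((hh.contDiffOn_leviCivita.contDiffAt (hh.mem_nhds hy)).differentiableAt (by simp)).hasFDerivAt

theorem fderiv_leviCivita_symm (hh : IsMetricOn h U) (hy : y ∈ U) (a b c : E) :
    fderiv ℝ (leviCivita h) y a b c = fderiv ℝ (leviCivita h) y a c b := by
  have hsymm : (fun z => leviCivita h z b c) =ᶠ[𝓝 y] fun z => leviCivita h z c b := by
    filter_upwards [hh.mem_nhds hy] with z hz using hh.leviCivita_symm hz b c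
  have hderiv (b c : E) := ((hh.hasFDerivAt_leviCivita hy).clm_apply
    (hasFDerivAt_const b y)).clm_apply (hasFDerivAt_const c y)
  simpa using congr($(((hderiv b c).congr_of_eventuallyEq hsymm.symm).unique (hderiv c b)) a)

theorem fderiv_fderiv_eq_leviCivita (hh : IsMetricOn h U) (hy : y ∈ U) (a b c d : E) :
    fderiv ℝ (fderiv ℝ h) y a b c d
      = fderiv ℝ h y a (leviCivita h y b c) d + h y (fderiv ℝ (leviCivita h) y a b c) d
        + (fderiv ℝ h y a c (leviCivita h y b d) + h y c (fderiv ℝ (leviCivita h) y a b d)) := by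
  have hΓ (c : E) : HasFDerivAt (fun z => leviCivita h z b c)
      (((fderiv ℝ (leviCivita h) y).flip b).flip c) y := by
    have hcomp := ((hh.hasFDerivAt_leviCivita hy).clm_apply (hasFDerivAt_const b y)).clm_apply
      (hasFDerivAt_const c y)
    refine hcomp.congr_fderiv ?_
    ext; simp
  have hleft : HasFDerivAt (fun z => fderiv ℝ h z b c d) _ y :=
    (((hasFDerivAt_fderiv ((hh.contDiffAt hy).of_le ENat.LEInfty.out)).clm_apply
      (hasFDerivAt_const b y)).clm_apply (hasFDerivAt_const c y)).clm_apply (hasFDerivAt_const d y)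
  have hright : HasFDerivAt
      (fun z => h z (leviCivita h z b c) d + h z c (leviCivita h z b d)) _ y :=
    (((hh.hasFDerivAt hy).clm_apply (hΓ c)).clm_apply (hasFDerivAt_const d y)).add
      (((hh.hasFDerivAt hy).clm_apply (hasFDerivAt_const c y)).clm_apply (hΓ d))
  have heq : (fun z => fderiv ℝ h z b c d)
      =ᶠ[𝓝 y] fun z => h z (leviCivita h z b c) d + h z c (leviCivita h z b d) := by
    filter_upwards [hh.mem_nhds hy] with z hz using hh.fderiv_eq_leviCivita hz b c d
  have happly := congr($((hleft.congr_of_eventuallyEq heq.symm).unique hright) a)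
  simp only [ContinuousLinearMap.comp_zero, add_apply, zero_add,
    ContinuousLinearMap.flip_apply, ContinuousLinearMap.comp_apply] at happly
  rw [happly]
  ring

theorem connectionCurvature_skew (hh : IsMetricOn h U) (hy : y ∈ U) (a b c d : E) :
    h y (connectionCurvature (leviCivita h) y a b c) d
      = - h y c (connectionCurvature (leviCivita h) y a b d) := by
  have hcomm := congr($(fderiv_fderiv_comm
    ((hh.contDiffAt hy).of_le ENat.LEInfty.out) a b) c d)
  rw [hh.fderiv_fderiv_eq_leviCivita hy, hh.fderiv_fderiv_eq_leviCivita hy,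
    hh.fderiv_eq_leviCivita hy a (leviCivita h y b c) d,
    hh.fderiv_eq_leviCivita hy b (leviCivita h y a c) d,
    hh.fderiv_eq_leviCivita hy a c (leviCivita h y b d),
    hh.fderiv_eq_leviCivita hy b c (leviCivita h y a d)] at hcomm
  simp only [connectionCurvature, map_add, map_sub, add_apply, sub_apply]
  linarith

end IsMetricOn

end MetricField

section LocalIsometry

variable {E : Type*} [NormedAddCommGroup E] [NormedSpace ℝ E]

/-- `ψ` is a local isometry from the open set `V` with the metric `G` to the open set `U` with the
metric `h`. -/
structure IsLocalIsometryOn (ψ : E → E) (G : E → E →L[ℝ] E →L[ℝ] ℝ) (V : Set E)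
    (h : E → E →L[ℝ] E →L[ℝ] ℝ) (U : Set E) : Prop where
  source : IsMetricOn G V
  target : IsMetricOn h U
  contDiffOn : ContDiffOn ℝ ∞ ψ V
  mapsTo : MapsTo ψ V U
  apply_eq : ∀ y ∈ V, ∀ a b, G y a b = h (ψ y) (fderiv ℝ ψ y a) (fderiv ℝ ψ y b)

namespace IsLocalIsometryOn

variable {ψ : E → E} {G h : E → E →L[ℝ] E →L[ℝ] ℝ} {V U : Set E} {y : E}

theorem contDiffAt (H : IsLocalIsometryOn ψ G V h U) (hy : y ∈ V) : ContDiffAt ℝ ∞ ψ y :=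
  H.contDiffOn.contDiffAt (H.source.mem_nhds hy)

theorem hasFDerivAt (H : IsLocalIsometryOn ψ G V h U) (hy : y ∈ V) :
    HasFDerivAt ψ (fderiv ℝ ψ y) y :=
  ((H.contDiffAt hy).differentiableAt (by simp)).hasFDerivAt

theorem hasFDerivAt_fderiv_apply (H : IsLocalIsometryOn ψ G V h U) (hy : y ∈ V) (b : E) :
    HasFDerivAt (fun z => fderiv ℝ ψ z b) ((fderiv ℝ (fderiv ℝ ψ) y).flip b) y := by
  simpa using (hasFDerivAt_fderiv ((H.contDiffAt hy).of_le ENat.LEInfty.out)).clm_apply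
    (hasFDerivAt_const b y)

theorem fderiv_fderiv_symm (H : IsLocalIsometryOn ψ G V h U) (hy : y ∈ V) (a b : E) :
    fderiv ℝ (fderiv ℝ ψ) y a b = fderiv ℝ (fderiv ℝ ψ) y b a :=
  fderiv_fderiv_comm ((H.contDiffAt hy).of_le ENat.LEInfty.out) a b

theorem injective (H : IsLocalIsometryOn ψ G V h U) (hy : y ∈ V) :
    Function.Injective (fderiv ℝ ψ y) := by
  refine (injective_iff_map_eq_zero _).2 fun a ha => ?_
  exact (H.source.isInnerForm y hy).eq_zero_of_apply_self_eq_zero (by simp [H.apply_eq y hy, ha])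

theorem fderiv_eq (H : IsLocalIsometryOn ψ G V h U) (hy : y ∈ V) (a b c : E) :
    fderiv ℝ G y a b c = fderiv ℝ h (ψ y) (fderiv ℝ ψ y a) (fderiv ℝ ψ y b) (fderiv ℝ ψ y c)
      + h (ψ y) (fderiv ℝ (fderiv ℝ ψ) y a b) (fderiv ℝ ψ y c)
      + h (ψ y) (fderiv ℝ ψ y b) (fderiv ℝ (fderiv ℝ ψ) y a c) := by
  have hright := (((H.target.hasFDerivAt (H.mapsTo hy)).comp y (H.hasFDerivAt hy)).clm_apply
    (H.hasFDerivAt_fderiv_apply hy b)).clm_apply (H.hasFDerivAt_fderiv_apply hy c)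
  have heq : (fun z => G z b c) =ᶠ[𝓝 y] fun z => h (ψ z) (fderiv ℝ ψ z b) (fderiv ℝ ψ z c) := by
    filter_upwards [H.source.mem_nhds hy] with z hz using H.apply_eq z hz b c
  have happly := congr($(((H.source.hasFDerivAt_apply hy b c).congr_of_eventuallyEq
    heq.symm).unique hright) a)
  simp only [ContinuousLinearMap.flip_apply, ContinuousLinearMap.comp_apply, add_apply,
    Function.comp_apply] at happly
  rw [happly]
  ring

theorem christoffelForm_eq (H : IsLocalIsometryOn ψ G V h U) (hy : y ∈ V) (a b c : E) :
    christoffelForm G y a b c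
      = christoffelForm h (ψ y) (fderiv ℝ ψ y a) (fderiv ℝ ψ y b) (fderiv ℝ ψ y c)
        + h (ψ y) (fderiv ℝ (fderiv ℝ ψ) y a b) (fderiv ℝ ψ y c) := by
  have hsymm := (H.target.isInnerForm _ (H.mapsTo hy)).symm
  simp only [christoffelForm_apply, H.fderiv_eq hy]
  rw [H.fderiv_fderiv_symm hy b a, H.fderiv_fderiv_symm hy c a, H.fderiv_fderiv_symm hy c b,
    hsymm (fderiv ℝ ψ y b) (fderiv ℝ (fderiv ℝ ψ) y a c),
    hsymm (fderiv ℝ ψ y a) (fderiv ℝ (fderiv ℝ ψ) y b c)]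
  ring

variable [FiniteDimensional ℝ E]

theorem surjective (H : IsLocalIsometryOn ψ G V h U) (hy : y ∈ V) :
    Function.Surjective (fderiv ℝ ψ y) :=
  (LinearMap.injective_iff_surjective (f := (fderiv ℝ ψ y : E →ₗ[ℝ] E))).1 (H.injective hy)

theorem map_leviCivita (H : IsLocalIsometryOn ψ G V h U) (hy : y ∈ V) (a b : E) :
    fderiv ℝ ψ y (leviCivita G y a b) = fderiv ℝ (fderiv ℝ ψ) y a b
      + leviCivita h (ψ y) (fderiv ℝ ψ y a) (fderiv ℝ ψ y b) := by
  refine (H.target.isInnerForm _ (H.mapsTo hy)).ext_left fun c => ?_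
  obtain ⟨c, rfl⟩ := H.surjective hy c
  rw [← H.apply_eq y hy, H.source.leviCivita_apply hy, H.christoffelForm_eq hy, map_add, add_apply,
    H.target.leviCivita_apply (H.mapsTo hy)]
  ring

theorem map_fderiv_leviCivita (H : IsLocalIsometryOn ψ G V h U) (hy : y ∈ V) (a b c : E) :
    fderiv ℝ ψ y (fderiv ℝ (leviCivita G) y a b c)
      = fderiv ℝ (fderiv ℝ (fderiv ℝ ψ)) y a b c
        + fderiv ℝ (leviCivita h) (ψ y) (fderiv ℝ ψ y a) (fderiv ℝ ψ y b) (fderiv ℝ ψ y c)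
        + leviCivita h (ψ y) (fderiv ℝ (fderiv ℝ ψ) y a b) (fderiv ℝ ψ y c)
        + leviCivita h (ψ y) (fderiv ℝ ψ y b) (fderiv ℝ (fderiv ℝ ψ) y a c)
        - fderiv ℝ (fderiv ℝ ψ) y a (leviCivita G y b c) := by
  have hψ' : ContDiffAt ℝ ∞ (fderiv ℝ ψ) y := (H.contDiffAt hy).fderiv_right (by simp)
  have hleft := (hasFDerivAt_fderiv ((H.contDiffAt hy).of_le ENat.LEInfty.out)).clm_apply
    (((H.source.hasFDerivAt_leviCivita hy).clm_apply (hasFDerivAt_const b y)).clm_apply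
      (hasFDerivAt_const c y))
  have hright := (((hasFDerivAt_fderiv (hψ'.of_le ENat.LEInfty.out)).clm_apply
      (hasFDerivAt_const b y)).clm_apply (hasFDerivAt_const c y)).add
    ((((H.target.hasFDerivAt_leviCivita (H.mapsTo hy)).comp y (H.hasFDerivAt hy)).clm_apply
      (H.hasFDerivAt_fderiv_apply hy b)).clm_apply (H.hasFDerivAt_fderiv_apply hy c))
  have heq : (fun z => fderiv ℝ ψ z (leviCivita G z b c)) =ᶠ[𝓝 y]
      fun z => fderiv ℝ (fderiv ℝ ψ) z b c
        + leviCivita h (ψ z) (fderiv ℝ ψ z b) (fderiv ℝ ψ z c) := by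
    filter_upwards [H.source.mem_nhds hy] with z hz using H.map_leviCivita hz b c
  have happly := congr($((hleft.congr_of_eventuallyEq heq.symm).unique hright) a)
  simp only [ContinuousLinearMap.comp_zero, zero_add, add_apply, ContinuousLinearMap.comp_apply,
    ContinuousLinearMap.flip_apply, Function.comp_apply, ContinuousLinearMap.flip_add] at happly
  rw [eq_sub_iff_add_eq, happly]
  abel

theorem map_connectionCurvature (H : IsLocalIsometryOn ψ G V h U) (hy : y ∈ V) (a b c : E) :
    fderiv ℝ ψ y (connectionCurvature (leviCivita G) y a b c)
      = connectionCurvature (leviCivita h) (ψ y)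
          (fderiv ℝ ψ y a) (fderiv ℝ ψ y b) (fderiv ℝ ψ y c) := by
  have hψ' : ContDiffAt ℝ ∞ (fderiv ℝ ψ) y := (H.contDiffAt hy).fderiv_right (by simp)
  simp only [connectionCurvature, map_add, map_sub, H.map_fderiv_leviCivita hy,
    H.map_leviCivita hy, H.fderiv_fderiv_symm hy b a,
    fderiv_fderiv_comm (hψ'.of_le ENat.LEInfty.out) b a]
  abel

end IsLocalIsometryOn

end LocalIsometry

section ModelFunctions

theorem hasDerivAt_snK (κ t : ℝ) : HasDerivAt (snK κ) (csK κ t) t := by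
  have hdiff : DifferentiableAt ℝ (snK κ) t := by
    unfold snK
    split_ifs
    · fun_prop
    · exact (differentiableAt_id.const_mul _).sinh.div_const _
    · fun_prop
  exact hdiff.hasDerivAt

theorem hasDerivAt_csK (κ t : ℝ) : HasDerivAt (csK κ) (-κ * snK κ t) t := by
  rw [show csK κ = _ from funext fun t => csK_eq κ t]
  unfold snK
  rcases lt_trichotomy κ 0 with hneg | rfl | hpos
  · have hsqrt : 0 < √(-κ) := Real.sqrt_pos.2 (by linarith)
    have hsq : √(-κ) * √(-κ) = -κ := Real.mul_self_sqrt (by linarith)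
    simp only [not_lt.2 hneg.le, hneg, if_true, if_false]
    refine ((hasDerivAt_id t).const_mul (√(-κ))).cosh.congr_deriv ?_
    field_simp
    simp only [id]
    linear_combination Real.sinh (√(-κ) * t) * hsq
  · simpa using hasDerivAt_const t (1 : ℝ)
  · have hsq : √κ * √κ = κ := Real.mul_self_sqrt hpos.le
    simp only [hpos, if_true]
    refine ((hasDerivAt_id t).const_mul (√κ)).cos.congr_deriv ?_
    field_simp
    simp only [id]
    linear_combination -Real.sin (√κ * t) * hsq

theorem snK_zero (κ : ℝ) : snK κ 0 = 0 := by simp [snK]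

theorem csK_zero (κ : ℝ) : csK κ 0 = 1 := by simp [csK_eq]

theorem snK_pos {κ t : ℝ} (ht : t ∈ ctDomain κ) : 0 < snK κ t := by
  obtain ⟨ht0, htpi⟩ := ht
  unfold snK
  split_ifs with hpos hneg
  · have hsqrt := Real.sqrt_pos.2 hpos
    have hlt : t * √κ < Real.pi := (lt_div_iff₀ hsqrt).1 (htpi hpos)
    exact div_pos (Real.sin_pos_of_pos_of_lt_pi (by positivity) (by linarith)) hsqrt
  · have hsqrt : 0 < √(-κ) := Real.sqrt_pos.2 (by linarith)
    exact div_pos (Real.sinh_pos_iff.2 (by positivity)) hsqrt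
  · exact ht0

theorem snK_sub (κ a b : ℝ) : snK κ (b - a) = snK κ b * csK κ a - csK κ b * snK κ a := by
  simp only [csK_eq]
  unfold snK
  split_ifs
  · rw [mul_sub, Real.sin_sub]; ring
  · rw [mul_sub, Real.sinh_sub]; ring
  · ring

theorem mem_ctDomain_of_le {κ s t : ℝ} (ht : t ∈ ctDomain κ) (hs : 0 < s) (hst : s ≤ t) :
    s ∈ ctDomain κ :=
  ⟨hs, fun h => hst.trans_lt (ht.2 h)⟩

theorem antitoneOn_ctK (κ : ℝ) : AntitoneOn (ctK κ) (ctDomain κ) := by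
  intro a ha b hb hab
  rcases hab.eq_or_lt with rfl | hlt
  · exact le_rfl
  have hsub := snK_sub κ a b
  have hpos := snK_pos (mem_ctDomain_of_le hb (sub_pos.2 hlt) (by linarith [ha.1]))
  rw [ctK, ctK, div_le_div_iff₀ (snK_pos hb) (snK_pos ha)]
  linarith

theorem ctK_le_iff {κ a b : ℝ} (ha : a ∈ ctDomain κ) (hb : b ∈ ctDomain κ) :
    ctK κ b ≤ ctK κ a ↔ a ≤ b :=
  ((antitoneOn_ctK κ).strictAntiOn_of_injOn (ctK_injOn κ)).le_iff_ge hb ha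

theorem continuousOn_ctK (κ : ℝ) : ContinuousOn (ctK κ) (ctDomain κ) := fun t ht =>
  ((hasDerivAt_csK κ t).continuousAt.div (hasDerivAt_snK κ t).continuousAt
    (snK_pos ht).ne').continuousWithinAt

theorem tendsto_ctK_atTop {κ t₀ : ℝ} (ht₀ : t₀ ∈ ctDomain κ) :
    Tendsto (ctK κ) (𝓝[>] 0) atTop := by
  have hcs : Tendsto (csK κ) (𝓝[>] 0) (𝓝 1) :=
    (csK_zero κ ▸ (hasDerivAt_csK κ 0).continuousAt.tendsto).mono_left nhdsWithin_le_nhds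
  have hsn : Tendsto (snK κ) (𝓝[>] 0) (𝓝[>] 0) := by
    refine tendsto_nhdsWithin_iff.2 ⟨(snK_zero κ ▸
      (hasDerivAt_snK κ 0).continuousAt.tendsto).mono_left nhdsWithin_le_nhds, ?_⟩
    filter_upwards [Ioc_mem_nhdsGT ht₀.1] with t ht
    exact snK_pos (mem_ctDomain_of_le ht₀ ht.1 ht.2)
  exact hcs.pos_mul_atTop one_pos hsn.inv_tendsto_nhdsGT_zero

theorem mem_image_ctK {κ t₀ s : ℝ} (ht₀ : t₀ ∈ ctDomain κ) (hs : ctK κ t₀ ≤ s) :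
    s ∈ ctK κ '' ctDomain κ := by
  obtain ⟨t₁, hst₁, ht₁⟩ := ((tendsto_ctK_atTop ht₀).eventually_ge_atTop s |>.and
    (Ioc_mem_nhdsGT ht₀.1)).exists
  have hsub : Icc t₁ t₀ ⊆ ctDomain κ := fun t ht =>
    mem_ctDomain_of_le ht₀ (ht₁.1.trans_le ht.1) ht.2
  exact image_mono hsub
    (intermediate_value_Icc' ht₁.2 ((continuousOn_ctK κ).mono hsub) ⟨hs, hst₁⟩)

theorem mem_image_ctK_of_nonneg {κ s : ℝ} (hκ : 0 < κ) (hs : 0 ≤ s) :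
    s ∈ ctK κ '' ctDomain κ := by
  have hsqrt := Real.sqrt_pos.2 hκ
  have hmem : Real.pi / 2 / √κ ∈ ctDomain κ :=
    ⟨by positivity, fun _ => div_lt_div_of_pos_right (by linarith [Real.pi_pos]) hsqrt⟩
  refine mem_image_ctK hmem ?_
  rwa [ctK, csK_eq, if_pos hκ, mul_div_cancel₀ _ hsqrt.ne', Real.cos_pi_div_two, zero_div]

theorem pi_div_sqrt_le_of_notMem_ctDomain {κ t : ℝ} (ht : 0 < t) (hmem : t ∉ ctDomain κ) :
    0 < κ ∧ Real.pi / √κ ≤ t := by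
  by_contra! hlt
  exact hmem ⟨ht, hlt⟩

theorem ctInv_le_of_ctK_le {κ s t : ℝ} (ht : t ∈ ctDomain κ) (hs : ctK κ t ≤ s) :
    ctInv κ s ≤ t := by
  have himage := mem_image_ctK ht hs
  refine (ctK_le_iff (Function.invFunOn_mem himage) ht).1 ?_
  exact hs.trans_eq (Function.invFunOn_eq himage).symm

theorem mem_image_ctK_and_ctInv_le {κ s ρ R : ℝ} (hs : 0 ≤ s) (hρ : 0 < ρ) (hρR : ρ ≤ R)
    (hle : ρ ∈ ctDomain κ → ctK κ ρ ≤ s) :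
    s ∈ ctK κ '' ctDomain κ ∧ ctInv κ s ≤ R := by
  by_cases hmem : ρ ∈ ctDomain κ
  · exact ⟨mem_image_ctK hmem (hle hmem), (ctInv_le_of_ctK_le hmem (hle hmem)).trans hρR⟩
  · obtain ⟨hκ, hpi⟩ := pi_div_sqrt_le_of_notMem_ctDomain hρ hmem
    have himage := mem_image_ctK_of_nonneg hκ hs
    have hinv : ctInv κ s ∈ ctDomain κ := Function.invFunOn_mem himage
    exact ⟨himage, ((hinv.2 hκ).le.trans hpi).trans hρR⟩

theorem mem_image_ctK_and_ctInv_le_mono {κ s s' R : ℝ} (hss' : s ≤ s')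
    (hs : s ∈ ctK κ '' ctDomain κ ∧ ctInv κ s ≤ R) :
    s' ∈ ctK κ '' ctDomain κ ∧ ctInv κ s' ≤ R := by
  have hmem : ctInv κ s ∈ ctDomain κ := Function.invFunOn_mem hs.1
  have hle : ctK κ (ctInv κ s) ≤ s' := (Function.invFunOn_eq hs.1).trans_le hss'
  exact ⟨mem_image_ctK hmem hle, (ctInv_le_of_ctK_le hmem hle).trans hs.2⟩

/-- Sturm comparison of a supersolution of `y'' + κ y = 0` with the solution `S_κ`: the Wronskian
`y' S_κ - y C_κ` is nondecreasing. -/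
theorem mul_csK_le_mul_snK {κ ρ : ℝ} {y y' y'' : ℝ → ℝ} (hρ : ρ ∈ ctDomain κ)
    (hy : ∀ t ∈ Icc 0 ρ, HasDerivAt y (y' t) t) (hy'cont : ContinuousOn y' (Icc 0 ρ))
    (hy' : ∀ t ∈ Ioo 0 ρ, HasDerivAt y' (y'' t) t) (hy'' : ∀ t ∈ Ioo 0 ρ, -κ * y t ≤ y'' t)
    (hy0 : y 0 = 0) : y ρ * csK κ ρ ≤ y' ρ * snK κ ρ := by
  have hwronskian : MonotoneOn (fun t => y' t * snK κ t - y t * csK κ t) (Icc 0 ρ) := by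
    refine monotoneOn_of_hasDerivWithinAt_nonneg (f' := fun t => (y'' t + κ * y t) * snK κ t)
      (convex_Icc 0 ρ) ?_ ?_ ?_
    · exact (hy'cont.mul fun t _ => (hasDerivAt_snK κ t).continuousAt.continuousWithinAt).sub
        (fun t ht => ((hy t ht).mul (hasDerivAt_csK κ t)).continuousAt.continuousWithinAt)
    · intro t ht
      rw [interior_Icc] at ht
      refine ((((hy' t ht).mul (hasDerivAt_snK κ t)).sub
        ((hy t (Ioo_subset_Icc_self ht)).mul (hasDerivAt_csK κ t))).congr_deriv ?_).hasDerivWithinAt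
      ring
    · intro t ht
      rw [interior_Icc] at ht
      exact mul_nonneg (by linarith [hy'' t ht]) (snK_pos (mem_ctDomain_of_le hρ ht.1 ht.2.le)).le
  have hle := hwronskian ⟨le_rfl, hρ.1.le⟩ ⟨hρ.1.le, le_rfl⟩ hρ.1.le
  simp only [snK_zero, mul_zero, hy0, zero_mul, sub_zero] at hle
  linarith

/-- If `g t = |J t|² / t²` for a Jacobi field `J` vanishing at `0`, then `q t = ⟪J t, J' t⟫ / t`,
and the Sturm comparison is applied to `y t = |J t| = t * √(g t)`. -/
theorem mul_csK_le_mul_snK_of_sq {κ ρ : ℝ} {g c q q' : ℝ → ℝ} (hρ : ρ ∈ ctDomain κ)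
    (hg : ∀ t ∈ Icc 0 ρ, HasDerivAt g (2 * c t) t) (hgpos : ∀ t ∈ Icc 0 ρ, 0 < g t)
    (hqg : ∀ t, q t = g t + t * c t) (hqcont : ContinuousOn q (Icc 0 ρ))
    (hq : ∀ t ∈ Ioo 0 ρ, HasDerivAt q (q' t) t)
    (hq' : ∀ t ∈ Ioo 0 ρ, (q t ^ 2 / g t - q t) / t - κ * t * g t ≤ q' t) :
    ρ * g ρ * csK κ ρ ≤ q ρ * snK κ ρ := by
  have hsqrt : ∀ t ∈ Icc 0 ρ, HasDerivAt (fun t => √(g t)) (2 * c t / (2 * √(g t))) t :=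
    fun t ht => (hg t ht).sqrt (hgpos t ht).ne'
  have hne : ∀ t ∈ Icc 0 ρ, √(g t) ≠ 0 := fun t ht => (Real.sqrt_pos.2 (hgpos t ht)).ne'
  have hy : ∀ t ∈ Icc 0 ρ, HasDerivAt (fun t => t * √(g t)) (q t / √(g t)) t := fun t ht => by
    refine ((hasDerivAt_id' t).fun_mul (hsqrt t ht)).congr_deriv ?_
    have hsq := Real.sq_sqrt (hgpos t ht).le
    have := hne t ht
    rw [hqg]
    field_simp
    linear_combination hsq
  have hcont : ContinuousOn (fun t => q t / √(g t)) (Icc 0 ρ) :=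
    hqcont.div (fun t ht => (hsqrt t ht).continuousAt.continuousWithinAt) hne
  have hle := mul_csK_le_mul_snK hρ hy hcont
    (fun t ht => (hq t ht).fun_div (hsqrt t (Ioo_subset_Icc_self ht))
      (hne t (Ioo_subset_Icc_self ht)))
    (fun t ht => ?_) (zero_mul _)
  · have hsq := Real.sq_sqrt (hgpos ρ ⟨hρ.1.le, le_rfl⟩).le
    have hpos := Real.sqrt_pos.2 (hgpos ρ ⟨hρ.1.le, le_rfl⟩)
    rw [div_mul_eq_mul_div, le_div_iff₀ hpos] at hle
    rw [← hsq]
    linarith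
  · have hsq := Real.sq_sqrt (hgpos t (Ioo_subset_Icc_self ht)).le
    have hpos := Real.sqrt_pos.2 (hgpos t (Ioo_subset_Icc_self ht))
    have ht0 := ht.1
    have hc : c t = (q t - g t) / t := by rw [hqg]; field_simp; ring
    have hbound := hq' t ht
    rw [hc]
    generalize √(g t) = s at hsq hpos
    rw [← hsq] at hbound ⊢
    rw [← sub_nonneg]
    calc (0 : ℝ) ≤ (q' t - ((q t ^ 2 / s ^ 2 - q t) / t - κ * t * s ^ 2)) / s :=
          div_nonneg (sub_nonneg.2 hbound) hpos.le
      _ = _ := by field_simp; ring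

end ModelFunctions

section NormalMetric

variable {E : Type*} [NormedAddCommGroup E] [NormedSpace ℝ E]

/-- The open ball of radius `r` about the origin for the inner product `G 0`. -/
def normalBall (G : E → E →L[ℝ] E →L[ℝ] ℝ) (r : ℝ) : Set E := {v | G 0 v v < r ^ 2}

/-- `G` is a metric on `normalBall G r` in normal coordinates: the rays from the origin are
geodesics. -/
structure IsNormalMetric (G : E → E →L[ℝ] E →L[ℝ] ℝ) (r : ℝ) : Prop where
  pos : 0 < r
  isMetricOn : IsMetricOn G (normalBall G r)
  leviCivita_self : ∀ v ∈ normalBall G r, leviCivita G v v v = 0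

/-- The radial sectional curvatures of `G` about the origin are at most `κ`, cleared of
denominators. -/
def HasRadialCurvatureLE (G : E → E →L[ℝ] E →L[ℝ] ℝ) (r κ : ℝ) : Prop :=
  ∀ v ∈ normalBall G r, v ≠ 0 → ∀ a, G v v a = 0 →
    G v (connectionCurvature (leviCivita G) v v a a) v ≤ κ * (G v v v * G v a a)

/-- The covariant derivative at time `t` of the Jacobi field `t ↦ t • a` along the ray
`t ↦ t • u`. -/
def jacobiDeriv (G : E → E →L[ℝ] E →L[ℝ] ℝ) (u a : E) (t : ℝ) : E :=
  a + t • leviCivita G (t • u) u a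

theorem apply_jacobiDeriv (G : E → E →L[ℝ] E →L[ℝ] ℝ) (u a : E) (t : ℝ) :
    G (t • u) a (jacobiDeriv G u a t)
      = G (t • u) a a + t * G (t • u) a (leviCivita G (t • u) u a) := by
  rw [jacobiDeriv, map_add, map_smul, smul_eq_mul]

namespace IsNormalMetric

variable {G : E → E →L[ℝ] E →L[ℝ] ℝ} {r t : ℝ} {u v : E}

theorem zero_mem (hG : IsNormalMetric G r) : (0 : E) ∈ normalBall G r := by
  simpa [normalBall] using pow_pos hG.pos 2

theorem isInnerForm_zero (hG : IsNormalMetric G r) : IsInnerForm (G 0) :=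
  hG.isMetricOn.isInnerForm 0 hG.zero_mem

theorem smul_mem (hG : IsNormalMetric G r) (hv : v ∈ normalBall G r) (ht : t ∈ Icc (0 : ℝ) 1) :
    t • v ∈ normalBall G r := by
  simp only [normalBall, mem_ofPred_eq, map_smul, smul_apply, smul_eq_mul] at hv ⊢
  have hnonneg := hG.isInnerForm_zero.nonneg v
  have hsq : t * t ≤ 1 := by nlinarith [ht.1, ht.2]
  nlinarith

theorem hasDerivAt_ray_apply (hG : IsNormalMetric G r) (ht : t • u ∈ normalBall G r)
    {X Y : ℝ → E} {X' Y' : E} (hX : HasDerivAt X X' t) (hY : HasDerivAt Y Y' t) :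
    HasDerivAt (fun t : ℝ => G (t • u) (X t) (Y t))
      (fderiv ℝ G (t • u) u (X t) (Y t) + G (t • u) X' (Y t) + G (t • u) (X t) Y') t := by
  have hray : HasDerivAt (fun t : ℝ => G (t • u)) (fderiv ℝ G (t • u) u) t := by
    simpa [Function.comp_def] using
      (hG.isMetricOn.hasFDerivAt ht).comp_hasDerivAt t ((hasDerivAt_id t).smul_const u)
  refine ((hray.clm_apply hX).clm_apply hY).congr_deriv ?_
  simp only [add_apply]

theorem leviCivita_ray (hG : IsNormalMetric G r) (ht : t ≠ 0) (hu : t • u ∈ normalBall G r) :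
    leviCivita G (t • u) u u = 0 := by
  have hself := hG.leviCivita_self _ hu
  simp only [map_smul, smul_apply, smul_smul] at hself
  exact (smul_eq_zero.1 hself).resolve_left (mul_ne_zero ht ht)

theorem hasFDerivAt_zero_apply_self (hG : IsNormalMetric G r) (v : E) :
    HasFDerivAt (fun z => G 0 z z) ((2 : ℝ) • G 0 v) v := by
  refine (((G 0).hasFDerivAt (x := v)).clm_apply (hasFDerivAt_id v)).congr_fderiv ?_
  ext w
  simp [hG.isInnerForm_zero.symm w v, two_mul]

variable [FiniteDimensional ℝ E]

theorem apply_self (hG : IsNormalMetric G r) (hv : v ∈ normalBall G r) : G v v v = G 0 v v := by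
  have hderiv : ∀ t ∈ Icc (0 : ℝ) 1,
      HasDerivAt (fun t : ℝ => G (t • v) v v) (fderiv ℝ G (t • v) v v v) t := fun t ht => by
    simpa using hG.hasDerivAt_ray_apply (hG.smul_mem hv ht) (hasDerivAt_const t v)
      (hasDerivAt_const t v)
  have hconst := exists_hasDerivAt_eq_slope _ _ one_pos
    (fun t ht => (hderiv t ht).continuousAt.continuousWithinAt)
    (fun t ht => hderiv t (Ioo_subset_Icc_self ht))
  obtain ⟨t, ht, hslope⟩ := hconst
  have hmem := hG.smul_mem hv (Ioo_subset_Icc_self ht)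
  rw [hG.isMetricOn.fderiv_eq_leviCivita hmem, hG.leviCivita_ray ht.1.ne' hmem] at hslope
  simp only [map_zero, zero_apply, add_zero, one_smul, zero_smul, sub_zero, div_one] at hslope
  linarith

theorem apply_ray_self (hG : IsNormalMetric G r) (ht : t ≠ 0) (hu : t • u ∈ normalBall G r) :
    G (t • u) u u = G 0 u u := by
  have hself := hG.apply_self hu
  simp only [map_smul, smul_apply, smul_eq_mul] at hself
  exact mul_left_cancel₀ ht (mul_left_cancel₀ ht hself)

theorem fderiv_radial (hG : IsNormalMetric G r) (hv : v ∈ normalBall G r) (w : E) :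
    fderiv ℝ G v v v w = G 0 v w - G v v w := by
  have hchristoffel : christoffelForm G v v v w = 0 := by
    rw [← hG.isMetricOn.leviCivita_apply hv, hG.leviCivita_self v hv, map_zero, zero_apply]
  rw [christoffelForm_apply] at hchristoffel
  have hself : (fun z => G z z z) =ᶠ[𝓝 v] fun z => G 0 z z := by
    filter_upwards [hG.isMetricOn.mem_nhds hv] with z hz using hG.apply_self hz
  have hderiv := congr($(((((hG.isMetricOn.hasFDerivAt hv).clm_apply (hasFDerivAt_id v)).clm_apply
    (hasFDerivAt_id v)).congr_of_eventuallyEq hself.symm).unique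
      (hG.hasFDerivAt_zero_apply_self v)) w)
  simp only [id_eq, ContinuousLinearMap.comp_id, ContinuousLinearMap.flip_add, add_apply,
    ContinuousLinearMap.flip_apply, smul_apply, smul_eq_mul] at hderiv
  rw [(hG.isMetricOn.isInnerForm v hv).symm w v] at hderiv
  linarith

/-- The function `t ↦ t * G (t • v) v w` has constant derivative `G 0 v w`. -/
theorem gauss_lemma (hG : IsNormalMetric G r) (hv : v ∈ normalBall G r) (w : E) :
    G v v w = G 0 v w := by
  have hderiv : ∀ t ∈ Icc (0 : ℝ) 1, HasDerivAt (fun t : ℝ => t * G (t • v) v w)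
      (G (t • v) v w + t * fderiv ℝ G (t • v) v v w) t := fun t ht => by
    have hray : HasDerivAt (fun t : ℝ => G (t • v) v w) (fderiv ℝ G (t • v) v v w) t := by
      simpa using hG.hasDerivAt_ray_apply (hG.smul_mem hv ht) (hasDerivAt_const t v)
        (hasDerivAt_const t w)
    simpa using (hasDerivAt_id' t).fun_mul hray
  obtain ⟨t, ht, hslope⟩ := exists_hasDerivAt_eq_slope _ _ one_pos
    (fun t ht => (hderiv t ht).continuousAt.continuousWithinAt)
    (fun t ht => hderiv t (Ioo_subset_Icc_self ht))
  have hradial := hG.fderiv_radial (hG.smul_mem hv (Ioo_subset_Icc_self ht)) w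
  simp only [map_smul, smul_apply, smul_eq_mul] at hradial
  have hcancel := mul_left_cancel₀ ht.1.ne' (hradial.trans (mul_sub t _ _).symm)
  simp only [one_mul, one_smul, zero_mul, sub_zero, div_one] at hslope
  linarith

theorem hessian_eq (hG : IsNormalMetric G r) (hv : v ∈ normalBall G r) (a : E) :
    G 0 a a - G v v (leviCivita G v a a) = G v a a + G v a (leviCivita G v v a) := by
  have hgauss : (fun z => G z z a) =ᶠ[𝓝 v] fun z => G 0 z a := by
    filter_upwards [hG.isMetricOn.mem_nhds hv] with z hz using hG.gauss_lemma hz a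
  have hderiv := congr($(((((hG.isMetricOn.hasFDerivAt hv).clm_apply (hasFDerivAt_id v)).clm_apply
    (hasFDerivAt_const a v)).congr_of_eventuallyEq hgauss.symm).unique
      (((G 0).hasFDerivAt (x := v)).clm_apply (hasFDerivAt_const a v))) a)
  simp only [id_eq, ContinuousLinearMap.comp_zero, ContinuousLinearMap.comp_id,
    ContinuousLinearMap.flip_add, add_apply, zero_add, ContinuousLinearMap.flip_apply] at hderiv
  rw [hG.isMetricOn.fderiv_eq_leviCivita hv, hG.isMetricOn.leviCivita_symm hv a v,
    (hG.isMetricOn.isInnerForm v hv).symm (leviCivita G v v a) a] at hderiv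
  linarith

theorem smul_fderiv_leviCivita_ray (hG : IsNormalMetric G r) (ht : t ≠ 0)
    (hu : t • u ∈ normalBall G r) (a : E) :
    t • fderiv ℝ (leviCivita G) (t • u) a u u = (-2 : ℝ) • leviCivita G (t • u) u a := by
  have hself : (fun z => leviCivita G z z z) =ᶠ[𝓝 (t • u)] fun _ => 0 := by
    filter_upwards [hG.isMetricOn.mem_nhds hu] with z hz using hG.leviCivita_self z hz
  have hderiv := congr($((((hG.isMetricOn.hasFDerivAt_leviCivita hu).clm_apply
    (hasFDerivAt_id (t • u))).clm_apply (hasFDerivAt_id (t • u))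
      |>.congr_of_eventuallyEq hself.symm).unique (hasFDerivAt_const 0 _)) a)
  simp only [id_eq, map_smul, ContinuousLinearMap.comp_id, ContinuousLinearMap.flip_add,
    ContinuousLinearMap.flip_smul, add_apply, smul_apply, smul_add,
    ContinuousLinearMap.flip_apply, zero_apply] at hderiv
  rw [hG.isMetricOn.leviCivita_symm hu a u] at hderiv
  have hsmul : t • (t • fderiv ℝ (leviCivita G) (t • u) a u u
      + (2 : ℝ) • leviCivita G (t • u) u a) = 0 := by
    rw [← hderiv]; module
  rw [eq_neg_of_add_eq_zero_left ((smul_eq_zero.1 hsmul).resolve_left ht), neg_smul]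

theorem hasDerivAt_jacobiDeriv (hG : IsNormalMetric G r) (hu : t • u ∈ normalBall G r) (a : E) :
    HasDerivAt (jacobiDeriv G u a)
      (leviCivita G (t • u) u a + t • fderiv ℝ (leviCivita G) (t • u) u u a) t := by
  have hΓ : HasDerivAt (fun t : ℝ => leviCivita G (t • u))
      (fderiv ℝ (leviCivita G) (t • u) u) t := by
    simpa [Function.comp_def] using (hG.isMetricOn.hasFDerivAt_leviCivita hu).comp_hasDerivAt t
      ((hasDerivAt_id t).smul_const u)
  refine (((hasDerivAt_id' t).smul ((hΓ.clm_apply (hasDerivAt_const t u)).clm_apply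
    (hasDerivAt_const t a))).const_add a).congr_deriv ?_
  simp [add_comm]

theorem jacobi_equation (hG : IsNormalMetric G r) (ht : t ≠ 0) (hu : t • u ∈ normalBall G r)
    (a : E) :
    leviCivita G (t • u) u (jacobiDeriv G u a t)
        + (leviCivita G (t • u) u a + t • fderiv ℝ (leviCivita G) (t • u) u u a)
      = t • connectionCurvature (leviCivita G) (t • u) u a u := by
  rw [connectionCurvature, smul_sub, smul_add, smul_sub, hG.smul_fderiv_leviCivita_ray ht hu,
    hG.leviCivita_ray ht hu, map_zero, hG.isMetricOn.fderiv_leviCivita_symm hu u a u,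
    hG.isMetricOn.leviCivita_symm hu a u, jacobiDeriv, map_add, map_smul]
  module

theorem hasDerivAt_apply_jacobiDeriv (hG : IsNormalMetric G r) (ht : t ≠ 0)
    (hu : t • u ∈ normalBall G r) (a : E) :
    HasDerivAt (fun t => G (t • u) a (jacobiDeriv G u a t))
      ((G (t • u) (jacobiDeriv G u a t) (jacobiDeriv G u a t)
          - G (t • u) a (jacobiDeriv G u a t)) / t
        - t * G (t • u) (connectionCurvature (leviCivita G) (t • u) u a a) u) t := by
  have hinner := hG.isMetricOn.isInnerForm _ hu
  refine (hG.hasDerivAt_ray_apply hu (hasDerivAt_const t a)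
    (hG.hasDerivAt_jacobiDeriv hu a)).congr_deriv ?_
  have hsub : t * G (t • u) (leviCivita G (t • u) u a) (jacobiDeriv G u a t)
      = G (t • u) (jacobiDeriv G u a t) (jacobiDeriv G u a t)
        - G (t • u) a (jacobiDeriv G u a t) := by
    rw [← smul_eq_mul, ← smul_apply, ← map_smul, ← sub_apply, ← map_sub, jacobiDeriv,
      add_sub_cancel_left]
  have hskew : G (t • u) a (connectionCurvature (leviCivita G) (t • u) u a u)
      = - G (t • u) (connectionCurvature (leviCivita G) (t • u) u a a) u := by
    rw [hinner.symm, hG.isMetricOn.connectionCurvature_skew hu, hinner.symm]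
  rw [← hsub, mul_div_cancel_left₀ _ ht, hG.isMetricOn.fderiv_eq_leviCivita hu, map_zero,
    zero_apply, add_zero, add_assoc, ← map_add, hG.jacobi_equation ht hu, map_smul, hskew,
    smul_eq_mul, mul_neg, sub_eq_add_neg]

theorem hasDerivAt_apply_ray (hG : IsNormalMetric G r) (hu : t • u ∈ normalBall G r) (a : E) :
    HasDerivAt (fun t : ℝ => G (t • u) a a) (2 * G (t • u) a (leviCivita G (t • u) u a)) t := by
  refine (hG.hasDerivAt_ray_apply hu (hasDerivAt_const t a) (hasDerivAt_const t a)).congr_deriv ?_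
  rw [hG.isMetricOn.fderiv_eq_leviCivita hu,
    (hG.isMetricOn.isInnerForm _ hu).symm (leviCivita G (t • u) u a), map_zero, map_zero,
    zero_apply]
  ring

theorem apply_curvature_le (hG : IsNormalMetric G r) {κ : ℝ} (hκ : HasRadialCurvatureLE G r κ)
    (ht : t ≠ 0) (hu : t • u ∈ normalBall G r) (hunit : G 0 u u = 1) {a : E} (hua : G 0 u a = 0) :
    G (t • u) (connectionCurvature (leviCivita G) (t • u) u a a) u ≤ κ * G (t • u) a a := by
  have hu0 : u ≠ 0 := fun h => by simp [h] at hunit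
  have hle := hκ _ hu (smul_ne_zero ht hu0) a (by rw [hG.gauss_lemma hu]; simp [hua])
  have hsmul : connectionCurvature (leviCivita G) (t • u) (t • u) a a
      = t • connectionCurvature (leviCivita G) (t • u) u a a := by
    simpa using connectionCurvature_smul (leviCivita G) (t • u) u a a t 1 1
  rw [hG.apply_self hu, hsmul] at hle
  simp only [map_smul, smul_apply, smul_eq_mul, hunit, mul_one] at hle
  have hsq : 0 < t * t := mul_self_pos.2 ht
  refine le_of_mul_le_mul_left ?_ hsq
  linarith

/-- Sturm comparison for the length of the Jacobi field `t ↦ t • a`. -/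
theorem mul_csK_le_apply_jacobiDeriv (hG : IsNormalMetric G r) {κ ρ : ℝ}
    (hκ : HasRadialCurvatureLE G r κ) (hρ : ρ ∈ ctDomain κ)
    (hmem : ∀ t ∈ Icc 0 ρ, t • u ∈ normalBall G r) (hunit : G 0 u u = 1) {a : E}
    (hua : G 0 u a = 0) :
    ρ * G (ρ • u) a a * csK κ ρ ≤ G (ρ • u) a (jacobiDeriv G u a ρ) * snK κ ρ := by
  rcases eq_or_ne a 0 with rfl | ha
  · simp
  refine mul_csK_le_mul_snK_of_sq (g := fun t => G (t • u) a a) hρ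
    (fun t ht => hG.hasDerivAt_apply_ray (hmem t ht) a)
    (fun t ht => (hG.isMetricOn.isInnerForm _ (hmem t ht)).pos a ha) (apply_jacobiDeriv G u a)
    (fun t ht => (hG.hasDerivAt_ray_apply (hmem t ht) (hasDerivAt_const t a)
      (hG.hasDerivAt_jacobiDeriv (hmem t ht) a)).continuousAt.continuousWithinAt)
    (fun t ht => hG.hasDerivAt_apply_jacobiDeriv ht.1.ne' (hmem t (Ioo_subset_Icc_self ht)) a)
    fun t ht => ?_
  have hmemt := hmem t (Ioo_subset_Icc_self ht)
  have hinner := hG.isMetricOn.isInnerForm _ hmemt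
  have hcurv := hG.apply_curvature_le hκ ht.1.ne' hmemt hunit hua
  have hcauchy : G (t • u) a (jacobiDeriv G u a t) ^ 2 / G (t • u) a a
      ≤ G (t • u) (jacobiDeriv G u a t) (jacobiDeriv G u a t) := by
    rw [div_le_iff₀' (hinner.pos a ha)]
    exact hinner.apply_sq_le a (jacobiDeriv G u a t)
  have hcurvt := mul_le_mul_of_nonneg_left hcurv ht.1.le
  have hcauchyt := div_le_div_of_nonneg_right
    (sub_le_sub_right hcauchy (G (t • u) a (jacobiDeriv G u a t))) ht.1.le
  linarith

theorem le_hessian (hG : IsNormalMetric G r) (hv : v ∈ normalBall G r) {κ : ℝ}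
    (hκ : HasRadialCurvatureLE G r κ) (hρ : √(G 0 v v) ∈ ctDomain κ) {a : E} (ha : G 0 v a = 0) :
    √(G 0 v v) * ctK κ (√(G 0 v v)) * G v a a ≤ G 0 a a - G v v (leviCivita G v a a) := by
  have hρsq : √(G 0 v v) * √(G 0 v v) = G 0 v v :=
    Real.mul_self_sqrt (hG.isInnerForm_zero.nonneg v)
  generalize √(G 0 v v) = ρ at hρ hρsq ⊢
  have hρ0 : 0 < ρ := hρ.1
  obtain ⟨u, rfl⟩ : ∃ u, ρ • u = v := ⟨ρ⁻¹ • v, smul_inv_smul₀ hρ0.ne' v⟩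
  have hunit : G 0 u u = 1 := by
    simp only [map_smul, smul_apply, smul_eq_mul] at hρsq
    field_simp at hρsq
    exact hρsq.symm
  have hua : G 0 u a = 0 := by simpa [hρ0.ne'] using ha
  have hmem : ∀ t ∈ Icc 0 ρ, t • u ∈ normalBall G r := fun t ht => by
    simpa [smul_smul, hρ0.ne'] using hG.smul_mem hv (t := t / ρ)
      ⟨div_nonneg ht.1 hρ0.le, (div_le_one hρ0).2 ht.2⟩
  have hcompare := hG.mul_csK_le_apply_jacobiDeriv hκ hρ hmem hunit hua
  rw [hG.hessian_eq hv, ctK, mul_right_comm, mul_div_assoc', div_le_iff₀ (snK_pos hρ)]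
  simpa [jacobiDeriv] using hcompare

end IsNormalMetric
end NormalMetric

section Continuity

variable {X V W E : Type*} [TopologicalSpace X] [NormedAddCommGroup V] [NormedSpace ℝ V]
  [NormedAddCommGroup W] [NormedSpace ℝ W] [NormedAddCommGroup E] [NormedSpace ℝ E] {x : X}

theorem continuousAt_flip {B : X → V →L[ℝ] E →L[ℝ] W} (hB : ContinuousAt B x) :
    ContinuousAt (fun x => (B x).flip) x :=
  (ContinuousLinearMap.flipₗᵢ ℝ V E W).continuous.continuousAt.comp_of_eq hB rfl

theorem continuousAt_bilinearComp {B : X → V →L[ℝ] V →L[ℝ] W} {L : X → E →L[ℝ] V}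
    (hB : ContinuousAt B x) (hL : ContinuousAt L x) :
    ContinuousAt (fun x => (B x).bilinearComp (L x) (L x)) x := by
  have hleft : ContinuousAt (fun x => ((B x).comp (L x)).flip) x :=
    continuousAt_flip (hB.clm_comp hL)
  exact continuousAt_flip (hleft.clm_comp hL)

variable [FiniteDimensional ℝ E]

theorem IsInnerForm.continuousAt_inverse {k : X → E →L[ℝ] E →L[ℝ] ℝ} (hk : IsInnerForm (k x))
    (hkc : ContinuousAt k x) : ContinuousAt (fun x => (k x).inverse) x :=
  (hk.isInvertible.contDiffAt_map_inverse (n := 0)).continuousAt.comp_of_eq hkc rfl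

theorem continuousAt_metricTrace {k : X → E →L[ℝ] E →L[ℝ] ℝ} {Q : X → E →L[ℝ] E →L[ℝ] W}
    (hk : IsInnerForm (k x)) (hkc : ContinuousAt k x) (hQ : ContinuousAt Q x) :
    ContinuousAt (fun x => metricTrace (k x) (Q x)) x := by
  have hinv := hk.continuousAt_inverse hkc
  unfold metricTrace
  fun_prop

theorem continuousAt_normalProjection {k : X → V →L[ℝ] V →L[ℝ] ℝ} {L : X → E →L[ℝ] V}
    (hk : IsInnerForm (k x)) (hL : Function.Injective (L x)) (hkc : ContinuousAt k x)
    (hLc : ContinuousAt L x) : ContinuousAt (fun x => normalProjection (k x) (L x)) x := by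
  have hinduced := continuousAt_bilinearComp hkc hLc
  have hinv := (hk.bilinearComp hL).continuousAt_inverse
    (k := fun x => (k x).bilinearComp (L x) (L x)) hinduced
  have hprecomp : ContinuousAt (fun x => ContinuousLinearMap.precomp ℝ (L x)) x :=
    (ContinuousLinearMap.compL ℝ E V ℝ).flip.continuous.continuousAt.comp_of_eq hLc rfl
  unfold normalProjection
  fun_prop

end Continuity

section FlatMeanCurvature

variable {E V : Type*} [NormedAddCommGroup E] [NormedSpace ℝ E] [FiniteDimensional ℝ E]
  [NormedAddCommGroup V] [NormedSpace ℝ V]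

/-- The second covariant derivative of the map `F` at `z`, for the flat connection on the source
and the Levi-Civita connection of the metric `h` on the target. -/
def covSecondDeriv (h : V → V →L[ℝ] V →L[ℝ] ℝ) (F : E → V) (z : E) : E →L[ℝ] E →L[ℝ] V :=
  fderiv ℝ (fderiv ℝ F) z + (leviCivita h (F z)).bilinearComp (fderiv ℝ F z) (fderiv ℝ F z)

/-- The mean curvature vector at `z` of the immersion `F` into a vector space with the metric `h`:
the normal part of the trace of the second derivative of `F` for the induced metric. -/
def flatMeanCurvature (h : V → V →L[ℝ] V →L[ℝ] ℝ) (F : E → V) (z : E) : V :=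
  normalProjection (h (F z)) (fderiv ℝ F z)
    (metricTrace ((h (F z)).bilinearComp (fderiv ℝ F z) (fderiv ℝ F z)) (covSecondDeriv h F z))

/-- The Hessian of the function `q` for the Levi-Civita connection of the metric `h`. -/
def covHessian (h : V → V →L[ℝ] V →L[ℝ] ℝ) (q : V → ℝ) (y : V) : V →L[ℝ] V →L[ℝ] ℝ :=
  fderiv ℝ (fderiv ℝ q) y - (ContinuousLinearMap.compL ℝ V V ℝ (fderiv ℝ q y)).comp (leviCivita h y)

variable {h : V → V →L[ℝ] V →L[ℝ] ℝ} {U : Set V} {F : E → V} {z : E}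

omit [FiniteDimensional ℝ E] in
theorem covSecondDeriv_apply (h : V → V →L[ℝ] V →L[ℝ] ℝ) (F : E → V) (z a b : E) :
    covSecondDeriv h F z a b = fderiv ℝ (fderiv ℝ F) z a b
      + leviCivita h (F z) (fderiv ℝ F z a) (fderiv ℝ F z b) := rfl

theorem covHessian_apply (h : V → V →L[ℝ] V →L[ℝ] ℝ) (q : V → ℝ) (y a b : V) :
    covHessian h q y a b = fderiv ℝ (fderiv ℝ q) y a b - fderiv ℝ q y (leviCivita h y a b) := rfl

theorem flatMeanCurvature_congr {F' : E → V} (hF : F =ᶠ[𝓝 z] F') :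
    flatMeanCurvature h F z = flatMeanCurvature h F' z := by
  simp only [flatMeanCurvature, covSecondDeriv, hF.eq_of_nhds, hF.fderiv_eq, hF.fderiv.fderiv_eq]

theorem IsMetricOn.flatMeanCurvature_comp (hh : IsMetricOn h U) {θ : E → E}
    (hz : F (θ z) ∈ U) (hF : ContDiffAt ℝ ∞ F (θ z)) (hθ : ContDiffAt ℝ ∞ θ z)
    (hFi : Function.Injective (fderiv ℝ F (θ z))) (hθi : Function.Injective (fderiv ℝ θ z)) :
    flatMeanCurvature h (F ∘ θ) z = flatMeanCurvature h F (θ z) := by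
  have hk := hh.isInnerForm _ hz
  have hθb : Function.Bijective (fderiv ℝ θ z) :=
    ⟨hθi, (LinearMap.injective_iff_surjective (f := (fderiv ℝ θ z : E →ₗ[ℝ] E))).1 hθi⟩
  have hfderiv : fderiv ℝ (F ∘ θ) z = (fderiv ℝ F (θ z)).comp (fderiv ℝ θ z) :=
    fderiv_comp z (hF.differentiableAt (by simp)) (hθ.differentiableAt (by simp))
  calc flatMeanCurvature h (F ∘ θ) z
      = normalProjection (h (F (θ z))) (fderiv ℝ F (θ z))
          (metricTrace (((h (F (θ z))).bilinearComp (fderiv ℝ F (θ z))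
            (fderiv ℝ F (θ z))).bilinearComp (fderiv ℝ θ z) (fderiv ℝ θ z))
            (covSecondDeriv h (F ∘ θ) z)) := by
        rw [flatMeanCurvature, hfderiv]
        exact normalProjection_comp hk hFi hθb _
    _ = flatMeanCurvature h F (θ z) := by
        rw [flatMeanCurvature, ← metricTrace_bilinearComp (hk.bilinearComp hFi) hθb,
          map_metricTrace, map_metricTrace]
        congr 1
        ext a b
        simp only [ContinuousLinearMap.comp_apply, ContinuousLinearMap.compL_apply,
          ContinuousLinearMap.bilinearComp_apply, covSecondDeriv_apply, hfderiv,
          fderiv_fderiv_comp (hF.of_le ENat.LEInfty.out) (hθ.of_le ENat.LEInfty.out), map_add,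
          normalProjection_range hk hFi, add_zero, Function.comp_apply]

theorem IsLocalIsometryOn.flatMeanCurvature_comp [FiniteDimensional ℝ V] {ψ : V → V}
    {G : V → V →L[ℝ] V →L[ℝ] ℝ} {V₀ : Set V} (H : IsLocalIsometryOn ψ G V₀ h U)
    (hz : F z ∈ V₀) (hF : ContDiffAt ℝ ∞ F z) :
    flatMeanCurvature h (ψ ∘ F) z = fderiv ℝ ψ (F z) (flatMeanCurvature G F z) := by
  have hfderiv : fderiv ℝ (ψ ∘ F) z = (fderiv ℝ ψ (F z)).comp (fderiv ℝ F z) :=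
    fderiv_comp z ((H.contDiffAt hz).differentiableAt (by simp)) (hF.differentiableAt (by simp))
  have hG : G (F z) = (h (ψ (F z))).bilinearComp (fderiv ℝ ψ (F z)) (fderiv ℝ ψ (F z)) := by
    ext a b
    exact H.apply_eq _ hz a b
  have hsecond : covSecondDeriv h (ψ ∘ F) z
      = (ContinuousLinearMap.compL ℝ E V V (fderiv ℝ ψ (F z))).comp (covSecondDeriv G F z) := by
    ext a b
    simp only [ContinuousLinearMap.comp_apply, ContinuousLinearMap.compL_apply,
      covSecondDeriv_apply, hfderiv, map_add, H.map_leviCivita hz, Function.comp_apply,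
      fderiv_fderiv_comp ((H.contDiffAt hz).of_le ENat.LEInfty.out) (hF.of_le ENat.LEInfty.out)]
    abel
  rw [flatMeanCurvature, hsecond, hfderiv, ← map_metricTrace, flatMeanCurvature, hG,
    map_normalProjection]
  rfl

theorem IsMetricOn.continuousAt_flatMeanCurvature [FiniteDimensional ℝ V] (hh : IsMetricOn h U)
    (hz : F z ∈ U) (hF : ContDiffAt ℝ ∞ F z) (hi : Function.Injective (fderiv ℝ F z)) :
    ContinuousAt (flatMeanCurvature h F) z := by
  have hF' : ContDiffAt ℝ ∞ (fderiv ℝ F) z := hF.fderiv_right (by simp)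
  have hF'c := hF'.continuousAt
  have hF'' := (hF'.fderiv_right (m := ∞) (by simp)).continuousAt
  have hmetric : ContinuousAt (fun z => h (F z)) z :=
    (hh.contDiffAt hz).continuousAt.comp_of_eq hF.continuousAt rfl
  have hΓ : ContinuousAt (fun z => leviCivita h (F z)) z :=
    (hh.hasFDerivAt_leviCivita hz).continuousAt.comp_of_eq hF.continuousAt rfl
  have hinduced := continuousAt_bilinearComp hmetric hF'c
  have hsecond : ContinuousAt (covSecondDeriv h F) z :=
    hF''.add (continuousAt_bilinearComp hΓ hF'c)
  have hk := hh.isInnerForm _ hz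
  have hproj := continuousAt_normalProjection (k := fun z => h (F z)) hk hi hmetric hF'c
  have htrace := continuousAt_metricTrace
    (k := fun z => (h (F z)).bilinearComp (fderiv ℝ F z) (fderiv ℝ F z))
    (hk.bilinearComp hi) hinduced hsecond
  exact hproj.clm_apply htrace

section LocalMax

variable {q : V → ℝ}

omit [FiniteDimensional ℝ E] in
theorem fderiv_apply_fderiv_eq_zero_of_isLocalMax (hF : DifferentiableAt ℝ F z)
    (hq : DifferentiableAt ℝ q (F z)) (hmax : IsLocalMax (q ∘ F) z) (a : E) :
    fderiv ℝ q (F z) (fderiv ℝ F z a) = 0 := by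
  have hcrit := hmax.fderiv_eq_zero
  rw [fderiv_comp z hq hF] at hcrit
  exact congr($hcrit a)

theorem IsMetricOn.fderiv_flatMeanCurvature_le (hh : IsMetricOn h U) (hz : F z ∈ U)
    (hF : ContDiffAt ℝ ∞ F z) (hi : Function.Injective (fderiv ℝ F z))
    (hq : ContDiffAt ℝ ∞ q (F z)) (hmax : IsLocalMax (q ∘ F) z) :
    fderiv ℝ q (F z) (flatMeanCurvature h F z)
      ≤ -metricTrace ((h (F z)).bilinearComp (fderiv ℝ F z) (fderiv ℝ F z))
          ((covHessian h q (F z)).bilinearComp (fderiv ℝ F z) (fderiv ℝ F z)) := by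
  have hq2 : ContDiffAt ℝ 2 q (F z) := hq.of_le ENat.LEInfty.out
  have hF2 : ContDiffAt ℝ 2 F z := hF.of_le ENat.LEInfty.out
  have hcrit := fderiv_apply_fderiv_eq_zero_of_isLocalMax (hF.differentiableAt (by simp))
    (hq.differentiableAt (by simp)) hmax
  rw [flatMeanCurvature, normalProjection_apply, map_sub, hcrit, sub_zero, map_metricTrace,
    ← neg_one_smul ℝ (metricTrace _ _), ← metricTrace_smul]
  refine metricTrace_le_metricTrace ((hh.isInnerForm _ hz).bilinearComp hi) fun a => ?_
  have hnonpos := fderiv_fderiv_nonpos_of_isLocalMax (hq2.comp z hF2) hmax a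
  rw [fderiv_fderiv_comp hq2 hF2] at hnonpos
  simp only [ContinuousLinearMap.comp_apply, ContinuousLinearMap.compL_apply,
    covSecondDeriv_apply, map_add, ContinuousLinearMap.bilinearComp_apply,
    covHessian_apply, neg_smul, one_smul, neg_apply]
  linarith

end LocalMax

end FlatMeanCurvature

section LineProd

variable {E : Type*} [NormedAddCommGroup E] [NormedSpace ℝ E]

/-- The product of the metric `G` with the standard metric of the line. -/
def lineProd (G : E → E →L[ℝ] E →L[ℝ] ℝ) (p : E × ℝ) : E × ℝ →L[ℝ] E × ℝ →L[ℝ] ℝ :=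
  (G p.1).bilinearComp (ContinuousLinearMap.fst ℝ E ℝ) (ContinuousLinearMap.fst ℝ E ℝ)
    + (ContinuousLinearMap.mul ℝ ℝ).bilinearComp (ContinuousLinearMap.snd ℝ E ℝ)
      (ContinuousLinearMap.snd ℝ E ℝ)

variable {G : E → E →L[ℝ] E →L[ℝ] ℝ} {U : Set E}

theorem lineProd_apply (G : E → E →L[ℝ] E →L[ℝ] ℝ) (p a b : E × ℝ) :
    lineProd G p a b = G p.1 a.1 b.1 + a.2 * b.2 := rfl

theorem IsInnerForm.lineProd {p : E × ℝ} (hG : IsInnerForm (G p.1)) :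
    IsInnerForm (lineProd G p) where
  symm a b := by rw [lineProd_apply, lineProd_apply, hG.symm, mul_comm a.2]
  pos a ha := by
    rw [lineProd_apply]
    rcases eq_or_ne a.1 0 with ha₁ | ha₁
    · have ha₂ : a.2 ≠ 0 := fun ha₂ => ha (Prod.ext ha₁ ha₂)
      simpa [ha₁] using mul_self_pos.2 ha₂
    · exact add_pos_of_pos_of_nonneg (hG.pos a.1 ha₁) (mul_self_nonneg a.2)

variable [FiniteDimensional ℝ E]

theorem contDiffOn_lineProd (hG : ContDiffOn ℝ ∞ G U) :
    ContDiffOn ℝ ∞ (lineProd G) (U ×ˢ univ) := by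
  refine contDiffOn_clm_apply.2 fun a => contDiffOn_clm_apply.2 fun b => ?_
  have hfst : ContDiffOn ℝ ∞ (fun p : E × ℝ => G p.1) (U ×ˢ univ) :=
    hG.comp contDiff_fst.contDiffOn fun p hp => hp.1
  exact ((hfst.clm_apply contDiffOn_const).clm_apply contDiffOn_const).add contDiffOn_const

namespace IsMetricOn

theorem lineProd (hG : IsMetricOn G U) : IsMetricOn (lineProd G) (U ×ˢ univ) where
  isOpen := hG.isOpen.prod isOpen_univ
  contDiffOn := contDiffOn_lineProd hG.contDiffOn
  isInnerForm p hp := (hG.isInnerForm p.1 hp.1).lineProd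

theorem fderiv_lineProd (hG : IsMetricOn G U) {p : E × ℝ} (hp : p.1 ∈ U)
    (c a b : E × ℝ) : fderiv ℝ (_root_.lineProd G) p c a b = fderiv ℝ G p.1 c.1 a.1 b.1 := by
  have hleft := hG.lineProd.hasFDerivAt_apply (y := p) ⟨hp, trivial⟩ a b
  have hright := ((((hG.hasFDerivAt hp).comp p hasFDerivAt_fst).clm_apply
    (hasFDerivAt_const a.1 p)).clm_apply (hasFDerivAt_const b.1 p)).add_const (a.2 * b.2)
  simpa using congr($(hleft.unique hright) c)

theorem leviCivita_lineProd (hG : IsMetricOn G U) {p : E × ℝ} (hp : p.1 ∈ U)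
    (a b : E × ℝ) : leviCivita (_root_.lineProd G) p a b = (leviCivita G p.1 a.1 b.1, 0) := by
  refine (hG.lineProd.eq_leviCivita (y := p) ⟨hp, trivial⟩ fun c => ?_).symm
  simp only [lineProd_apply, christoffelForm_apply, hG.fderiv_lineProd hp, hG.leviCivita_apply hp,
    zero_mul, add_zero]

end IsMetricOn

end LineProd

section FarthestPoint

theorem hasFDerivAt_half_apply_self {V : Type*} [NormedAddCommGroup V] [NormedSpace ℝ V]
    {B : V →L[ℝ] V →L[ℝ] ℝ} (hB : ∀ a b, B a b = B b a) (p : V) :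
    HasFDerivAt (fun p => 1 / 2 * B p p) (B p) p := by
  refine ((B.hasFDerivAt.clm_apply (hasFDerivAt_id p)).const_mul (1 / 2)).congr_fderiv ?_
  ext a
  simp [hB a p]
  ring

variable {E E' : Type*} [NormedAddCommGroup E] [NormedSpace ℝ E]
  [NormedAddCommGroup E'] [NormedSpace ℝ E']

/-- Half the squared distance from the centre of normal coordinates for the metric `G`, as a
function on the product of the coordinate domain with the line. -/
def radialEnergy (G : E → E →L[ℝ] E →L[ℝ] ℝ) (p : E × ℝ) : ℝ :=
  1 / 2 * (G 0).bilinearComp (ContinuousLinearMap.fst ℝ E ℝ) (ContinuousLinearMap.fst ℝ E ℝ) p p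

theorem radialEnergy_apply (G : E → E →L[ℝ] E →L[ℝ] ℝ) (p : E × ℝ) :
    radialEnergy G p = 1 / 2 * G 0 p.1 p.1 := rfl

namespace IsNormalMetric

variable {G : E → E →L[ℝ] E →L[ℝ] ℝ} {r κ : ℝ} {p : E × ℝ}

theorem fderiv_radialEnergy (hG : IsNormalMetric G r) : fderiv ℝ (radialEnergy G)
    = (G 0).bilinearComp (ContinuousLinearMap.fst ℝ E ℝ) (ContinuousLinearMap.fst ℝ E ℝ) :=
  funext fun p => (hasFDerivAt_half_apply_self
    (fun a b => hG.isInnerForm_zero.symm a.1 b.1) p).fderiv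

variable [FiniteDimensional ℝ E]

theorem fderiv_radialEnergy_apply (hG : IsNormalMetric G r) (hp : p.1 ∈ normalBall G r)
    (a : E × ℝ) : fderiv ℝ (radialEnergy G) p a = G p.1 p.1 a.1 := by
  rw [hG.fderiv_radialEnergy, hG.gauss_lemma hp]
  rfl

theorem le_covHessian_radialEnergy (hG : IsNormalMetric G r) (hp : p.1 ∈ normalBall G r)
    (hκ : HasRadialCurvatureLE G r κ) (hρ : √(G 0 p.1 p.1) ∈ ctDomain κ) {a : E × ℝ}
    (ha : fderiv ℝ (radialEnergy G) p a = 0) :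
    √(G 0 p.1 p.1) * ctK κ √(G 0 p.1 p.1) * (lineProd G p a a - a.2 * a.2)
      ≤ covHessian (lineProd G) (radialEnergy G) p a a := by
  rw [covHessian_apply, hG.fderiv_radialEnergy_apply hp, hG.isMetricOn.leviCivita_lineProd hp,
    lineProd_apply, add_sub_cancel_right, hG.fderiv_radialEnergy, ContinuousLinearMap.fderiv]
  rw [hG.fderiv_radialEnergy] at ha
  exact hG.le_hessian hp hκ hρ ha

theorem neg_apply_le_mul_sqrt_lineProd (hG : IsNormalMetric G r) (hp : p.1 ∈ normalBall G r)
    (X : E × ℝ) : -G p.1 p.1 X.1 ≤ √(G 0 p.1 p.1) * √(lineProd G p X X) := by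
  have hform := hG.isMetricOn.isInnerForm _ hp
  refine (neg_le_abs _).trans (abs_le_of_sq_le_sq ?_ (by positivity))
  rw [mul_pow, Real.sq_sqrt (hG.isInnerForm_zero.nonneg _), Real.sq_sqrt (hform.lineProd.nonneg X),
    ← hG.apply_self hp]
  calc G p.1 p.1 X.1 ^ 2 ≤ G p.1 p.1 p.1 * G p.1 X.1 X.1 := hform.apply_sq_le _ _
    _ ≤ G p.1 p.1 p.1 * lineProd G p X X := by
      refine mul_le_mul_of_nonneg_left ?_ (hform.nonneg _)
      rw [lineProd_apply]
      linarith [mul_self_nonneg X.2]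

variable [FiniteDimensional ℝ E'] {F : E' → E × ℝ} {z : E'}

theorem le_metricTrace_covHessian_radialEnergy (hG : IsNormalMetric G r)
    (hp : p.1 ∈ normalBall G r) (hκ : HasRadialCurvatureLE G r κ)
    (hρ : √(G 0 p.1 p.1) ∈ ctDomain κ) (hct : 0 ≤ ctK κ √(G 0 p.1 p.1)) {L : E' →L[ℝ] E × ℝ}
    (hL : Function.Injective L) (hcrit : ∀ a, fderiv ℝ (radialEnergy G) p (L a) = 0) :
    √(G 0 p.1 p.1) * ctK κ √(G 0 p.1 p.1) * (Module.finrank ℝ E' - 1)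
      ≤ metricTrace ((lineProd G p).bilinearComp L L)
          ((covHessian (lineProd G) (radialEnergy G) p).bilinearComp L L) := by
  set ρ := √(G 0 p.1 p.1)
  set k := (lineProd G p).bilinearComp L L with hkdef
  set dt : E' →L[ℝ] ℝ := (ContinuousLinearMap.snd ℝ E ℝ).comp L with hdt
  have hform := hG.isMetricOn.isInnerForm _ hp
  have hk : IsInnerForm k := hform.lineProd.bilinearComp hL
  have hbessel : metricTrace k (dt.smulRight dt) ≤ 1 :=
    metricTrace_smulRight_le_one hk fun a => by
      simpa [hkdef, hdt, lineProd_apply, pow_two] using hform.nonneg (L a).1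
  calc ρ * ctK κ ρ * (Module.finrank ℝ E' - 1)
      ≤ ρ * ctK κ ρ * (metricTrace k k - metricTrace k (dt.smulRight dt)) := by
        rw [metricTrace_self hk]
        exact mul_le_mul_of_nonneg_left (sub_le_sub_left hbessel _) (mul_nonneg hρ.1.le hct)
    _ = metricTrace k ((ρ * ctK κ ρ) • (k - dt.smulRight dt)) := by
        rw [metricTrace_smul, metricTrace_sub, smul_eq_mul]
    _ ≤ _ := metricTrace_le_metricTrace hk fun a =>
        hG.le_covHessian_radialEnergy hp hκ hρ (hcrit a)

theorem ctK_mul_le_flatMeanCurvature (hG : IsNormalMetric G r)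
    (hz : (F z).1 ∈ normalBall G r) (hκ : HasRadialCurvatureLE G r κ)
    (hρ : √(G 0 (F z).1 (F z).1) ∈ ctDomain κ) (hF : ContDiffAt ℝ ∞ F z)
    (hi : Function.Injective (fderiv ℝ F z)) (hmax : IsLocalMax (radialEnergy G ∘ F) z)
    (hm : 1 ≤ Module.finrank ℝ E') :
    ctK κ √(G 0 (F z).1 (F z).1) * (Module.finrank ℝ E' - 1)
      ≤ √(lineProd G (F z) (flatMeanCurvature (lineProd G) F z)
          (flatMeanCurvature (lineProd G) F z)) := by
  set ρ := √(G 0 (F z).1 (F z).1)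
  set X := flatMeanCurvature (lineProd G) F z
  have hm' : (0 : ℝ) ≤ Module.finrank ℝ E' - 1 := sub_nonneg.2 (by exact_mod_cast hm)
  rcases le_total (ctK κ ρ) 0 with hct | hct
  · exact (mul_nonpos_of_nonpos_of_nonneg hct hm').trans (Real.sqrt_nonneg _)
  have hsmooth : ContDiffAt ℝ ∞ (radialEnergy G) (F z) :=
    (contDiff_const.mul ((ContinuousLinearMap.contDiff _).clm_apply contDiff_id)).contDiffAt
  have hcrit := fderiv_apply_fderiv_eq_zero_of_isLocalMax (hF.differentiableAt (by simp))
    (hsmooth.differentiableAt (by simp)) hmax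
  refine le_of_mul_le_mul_left ?_ hρ.1
  calc ρ * (ctK κ ρ * (Module.finrank ℝ E' - 1))
      = ρ * ctK κ ρ * (Module.finrank ℝ E' - 1) := by ring
    _ ≤ metricTrace _ _ := hG.le_metricTrace_covHessian_radialEnergy hz hκ hρ hct hi hcrit
    _ ≤ -fderiv ℝ (radialEnergy G) (F z) X :=
        le_neg.2 (hG.isMetricOn.lineProd.fderiv_flatMeanCurvature_le ⟨hz, trivial⟩ hF hi
          hsmooth hmax)
    _ = -G (F z).1 (F z).1 X.1 := by rw [hG.fderiv_radialEnergy_apply hz]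
    _ ≤ ρ * √(lineProd G (F z) X X) := hG.neg_apply_le_mul_sqrt_lineProd hz X

end IsNormalMetric

end FarthestPoint

section Charts

variable {E : Type*} [NormedAddCommGroup E] [NormedSpace ℝ E]
  {H : Type*} [TopologicalSpace H] {I : ModelWithCorners ℝ E H}
  {W : Type*} [TopologicalSpace W] [ChartedSpace H W]

theorem MetricField.apply_congr (g : MetricField I W) {p q : W} (hpq : p = q) (u v : E) :
    g p (u : TangentSpace I p) (v : TangentSpace I p)
      = g q (u : TangentSpace I q) (v : TangentSpace I q) := by
  rw [hpq]

/-- `h` is the coordinate expression of the metric `g` in the chart at `p`, on the open set `U`. -/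
structure IsChartMetric (g : MetricField I W) (p : W) (h : E → E →L[ℝ] E →L[ℝ] ℝ) (U : Set E) :
    Prop where
  isMetricOn : IsMetricOn h U
  chartMetric_eq : ∀ y ∈ U, ∀ u v, chartMetric g p y u v = h y u v

namespace IsChartMetric

variable {g : MetricField I W} {p : W} {h : E → E →L[ℝ] E →L[ℝ] ℝ} {U : Set E} {y : E}

theorem christoffelFirst_eq (hh : IsChartMetric g p h U) (hy : y ∈ U) (u v w : E) :
    christoffelFirst g p y u v w = christoffelForm h y u v w := by
  have hfderiv (a b c : E) :
      fderiv ℝ (fun z => chartMetric g p z a b) y c = fderiv ℝ h y c a b := by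
    have heq : (fun z => chartMetric g p z a b) =ᶠ[𝓝 y] fun z => h z a b := by
      filter_upwards [hh.isMetricOn.mem_nhds hy] with z hz using hh.chartMetric_eq z hz a b
    rw [heq.fderiv_eq, (hh.isMetricOn.hasFDerivAt_apply hy a b).fderiv]
    rfl
  rw [christoffelFirst, hfderiv, hfderiv, hfderiv, christoffelForm_apply]

theorem apply_center [I.Boundaryless] [IsManifold I 1 W] (hh : IsChartMetric g p h U)
    (hp : extChartAt I p p ∈ U) (u v : E) :
    g p (u : TangentSpace I p) (v : TangentSpace I p) = h (extChartAt I p p) u v := by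
  have hid : mfderiv 𝓘(ℝ, E) I (extChartAt I p).symm (extChartAt I p p)
      = ContinuousLinearMap.id ℝ E := by
    have := mfderivWithin_range_extChartAt_symm (I := I) (x := p)
    rwa [I.range_eq_univ, mfderivWithin_univ] at this
  rw [← hh.chartMetric_eq _ hp u v, chartMetric, hid]
  exact (g.apply_congr (extChartAt_to_inv p) u v).symm

variable [FiniteDimensional ℝ E]

theorem christoffel_eq (hh : IsChartMetric g p h U) (hy : y ∈ U) (u v : E) :
    christoffel g p y u v = leviCivita h y u v := by
  have hk := hh.isMetricOn.isInnerForm _ hy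
  have hgram : chartGram g p y
      = Matrix.of fun i j => h y (Module.finBasis ℝ E i) (Module.finBasis ℝ E j) := by
    ext i j
    exact hh.chartMetric_eq y hy _ _
  calc christoffel g p y u v = (h y).inverse (h y (leviCivita h y u v)) := by
        rw [christoffel, hgram, hk.inverse_eq_sum_inv_gram (Module.finBasis ℝ E)]
        simp only [hh.christoffelFirst_eq hy, hh.isMetricOn.leviCivita_apply hy]
    _ = leviCivita h y u v := hk.isInvertible.inverse_apply_self _

theorem riemannTensor_eq (hh : IsChartMetric g p h U) (hp : extChartAt I p p ∈ U) (u v w : E) :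
    (riemannTensor g p (u : TangentSpace I p) (v : TangentSpace I p) (w : TangentSpace I p) : E)
      = connectionCurvature (leviCivita h) (extChartAt I p p) u v w := by
  have hfderiv (a b c : E) : fderiv ℝ (fun z => christoffel g p z a b) (extChartAt I p p) c
      = fderiv ℝ (leviCivita h) (extChartAt I p p) c a b := by
    have heq : (fun z => christoffel g p z a b) =ᶠ[𝓝 (extChartAt I p p)]
        fun z => leviCivita h z a b := by
      filter_upwards [hh.isMetricOn.mem_nhds hp] with z hz using hh.christoffel_eq hz a b
    have hderiv := ((hh.isMetricOn.hasFDerivAt_leviCivita hp).clm_apply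
      (hasFDerivAt_const a _)).clm_apply (hasFDerivAt_const b _)
    rw [heq.fderiv_eq, hderiv.fderiv]
    simp
  simp only [riemannTensor, hfderiv, hh.christoffel_eq hp]
  rfl

end IsChartMetric

section Immersion

variable {E' : Type*} [NormedAddCommGroup E'] [NormedSpace ℝ E']
  {H' : Type*} [TopologicalSpace H'] {J : ModelWithCorners ℝ E' H'} [J.Boundaryless]
  {M : Type*} [TopologicalSpace M] [ChartedSpace H' M] {φ : M → W} {x : M}

/-- The coordinate expression of a map in the charts at `x` and `φ x`. -/
def chartRep (J : ModelWithCorners ℝ E' H') (I : ModelWithCorners ℝ E H) (φ : M → W) (x : M) :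
    E' → E := fun z => extChartAt I (φ x) (φ ((extChartAt J x).symm z))

omit [J.Boundaryless] in
theorem chartRep_center (φ : M → W) (x : M) :
    chartRep J I φ x (extChartAt J x x) = extChartAt I (φ x) (φ x) := by
  rw [chartRep, extChartAt_to_inv]

theorem contDiffAt_chartRep (hφ : ContMDiffAt J I ∞ φ x) :
    ContDiffAt ℝ ∞ (chartRep J I φ x) (extChartAt J x x) := by
  have := (contMDiffAt_iff.1 hφ).2
  rwa [J.range_eq_univ, contDiffWithinAt_univ] at this

theorem mfderiv_eq_fderiv_chartRep (hφ : MDifferentiableAt J I φ x) :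
    mfderiv J I φ x = fderiv ℝ (chartRep J I φ x) (extChartAt J x x) := by
  rw [hφ.mfderiv, J.range_eq_univ, fderivWithin_univ]
  rfl

namespace IsChartMetric

variable [FiniteDimensional ℝ E'] [I.Boundaryless] [IsManifold I 1 W]
  {g : MetricField I W} {h : E → E →L[ℝ] E →L[ℝ] ℝ} {U : Set E}

theorem inducedGram_eq (hh : IsChartMetric g (φ x) h U) (hx : extChartAt I (φ x) (φ x) ∈ U)
    (hφ : MDifferentiableAt J I φ x) :
    inducedGram (J := J) g φ x = Matrix.of fun i j =>
      (h (chartRep J I φ x (extChartAt J x x))).bilinearComp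
        (fderiv ℝ (chartRep J I φ x) (extChartAt J x x))
        (fderiv ℝ (chartRep J I φ x) (extChartAt J x x))
        (Module.finBasis ℝ E' i) (Module.finBasis ℝ E' j) := by
  ext i j
  rw [chartRep_center]
  simp only [inducedGram, Matrix.of_apply, mfderiv_eq_fderiv_chartRep hφ]
  exact hh.apply_center hx _ _

theorem normalPart_eq (hh : IsChartMetric g (φ x) h U) (hx : extChartAt I (φ x) (φ x) ∈ U)
    (hφ : MDifferentiableAt J I φ x)
    (hi : Function.Injective (fderiv ℝ (chartRep J I φ x) (extChartAt J x x))) (w : E) :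
    (normalPart (J := J) g φ x (w : TangentSpace I (φ x)) : E)
      = normalProjection (h (chartRep J I φ x (extChartAt J x x)))
          (fderiv ℝ (chartRep J I φ x) (extChartAt J x x)) w := by
  have hk : IsInnerForm (h (chartRep J I φ x (extChartAt J x x))) :=
    hh.isMetricOn.isInnerForm _ ((chartRep_center (J := J) (I := I) φ x).symm ▸ hx)
  rw [normalProjection_eq_sub_sum hk hi (Module.finBasis ℝ E'), ← hh.inducedGram_eq hx hφ,
    chartRep_center]
  simp only [normalPart, mfderiv_eq_fderiv_chartRep hφ, ← hh.apply_center hx]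
  rfl

variable [FiniteDimensional ℝ E]

theorem secondFundamentalForm_eq (hh : IsChartMetric g (φ x) h U)
    (hx : extChartAt I (φ x) (φ x) ∈ U) (hφ : ContMDiffAt J I ∞ φ x)
    (hi : Function.Injective (fderiv ℝ (chartRep J I φ x) (extChartAt J x x))) (u v : E') :
    (secondFundamentalForm (J := J) g φ x (u : TangentSpace J x) (v : TangentSpace J x) : E)
      = normalProjection (h (chartRep J I φ x (extChartAt J x x)))
          (fderiv ℝ (chartRep J I φ x) (extChartAt J x x))
          (covSecondDeriv h (chartRep J I φ x) (extChartAt J x x) u v) := by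
  have hF : ContDiffAt ℝ 2 (chartRep J I φ x) (extChartAt J x x) :=
    (contDiffAt_chartRep hφ).of_le ENat.LEInfty.out
  rw [covSecondDeriv_apply, ← fderiv_fderiv_apply hF,
    ← hh.christoffel_eq ((chartRep_center (J := J) (I := I) φ x).symm ▸ hx)]
  exact hh.normalPart_eq hx (hφ.mdifferentiableAt (by simp)) hi _

theorem meanCurvatureVector_eq (hh : IsChartMetric g (φ x) h U)
    (hx : extChartAt I (φ x) (φ x) ∈ U) (hφ : ContMDiffAt J I ∞ φ x)
    (hi : Function.Injective (fderiv ℝ (chartRep J I φ x) (extChartAt J x x))) :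
    (meanCurvatureVector (J := J) g φ x : E)
      = flatMeanCurvature h (chartRep J I φ x) (extChartAt J x x) := by
  have hk : IsInnerForm (h (chartRep J I φ x (extChartAt J x x))) :=
    hh.isMetricOn.isInnerForm _ ((chartRep_center (J := J) (I := I) φ x).symm ▸ hx)
  rw [flatMeanCurvature, map_metricTrace, metricTrace_eq_sum_inv_gram (hk.bilinearComp hi),
    ← hh.inducedGram_eq hx (hφ.mdifferentiableAt (by simp))]
  exact Finset.sum_congr rfl fun i _ => Finset.sum_congr rfl fun j _ =>
    congr(_ • $(hh.secondFundamentalForm_eq hx hφ hi _ _))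

theorem meanCurvatureNorm_eq (hh : IsChartMetric g (φ x) h U)
    (hx : extChartAt I (φ x) (φ x) ∈ U) (hφ : ContMDiffAt J I ∞ φ x)
    (hi : Function.Injective (fderiv ℝ (chartRep J I φ x) (extChartAt J x x))) :
    meanCurvatureNorm J g φ x = √(h (chartRep J I φ x (extChartAt J x x))
      (flatMeanCurvature h (chartRep J I φ x) (extChartAt J x x))
      (flatMeanCurvature h (chartRep J I φ x) (extChartAt J x x))) := by
  rw [chartRep_center, ← hh.meanCurvatureVector_eq hx hφ hi]
  exact congrArg Real.sqrt (hh.apply_center hx _ _)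

end IsChartMetric

end Immersion

end Charts

section RadialSpeed

variable {V : Type*} [NormedAddCommGroup V] [NormedSpace ℝ V] {k : V →L[ℝ] V →L[ℝ] ℝ}

namespace IsInnerForm

theorem hasDerivAt_sqrt_add_apply_self (hk : IsInnerForm k) {c : ℝ} (hc : 0 < c) {β : ℝ → V}
    {w : V} {t : ℝ} (hβ : HasDerivAt β w t) :
    HasDerivAt (fun t => √(c + k (β t) (β t))) (k (β t) w / √(c + k (β t) (β t))) t := by
  have hpos : 0 < c + k (β t) (β t) := add_pos_of_pos_of_nonneg hc (hk.nonneg _)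
  have hself : HasDerivAt (fun t => k (β t) (β t)) (2 * k (β t) w) t := by
    refine (((hasDerivAt_const t k).clm_apply hβ).clm_apply hβ).congr_deriv ?_
    simp [hk.symm w (β t), two_mul]
  refine ((hself.const_add c).sqrt hpos.ne').congr_deriv ?_
  field_simp

theorem norm_apply_le (hk : IsInnerForm k) (v : V) : ‖k v‖ ≤ √(k v v * ‖k‖) := by
  refine (k v).opNorm_le_bound (Real.sqrt_nonneg _) fun w => ?_
  rw [← Real.sqrt_sq (norm_nonneg w), ← Real.sqrt_mul (mul_nonneg (hk.nonneg v) (norm_nonneg k))]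
  refine Real.abs_le_sqrt ((hk.apply_sq_le v w).trans ?_)
  have hw : k w w ≤ ‖k‖ * ‖w‖ * ‖w‖ := (le_abs_self _).trans (k.le_opNorm₂ w w)
  calc k v v * k w w ≤ k v v * (‖k‖ * ‖w‖ * ‖w‖) := mul_le_mul_of_nonneg_left hw (hk.nonneg v)
    _ = k v v * ‖k‖ * ‖w‖ ^ 2 := by ring

theorem isCompact_sublevel [FiniteDimensional ℝ V] (hk : IsInnerForm k) (c : ℝ) :
    IsCompact {v : V | k v v ≤ c} := by
  have hcont : Continuous fun v : V => k v v := by fun_prop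
  refine Metric.isCompact_of_isClosed_isBounded (isClosed_le hcont continuous_const)
    (isBounded_iff_forall_norm_le.2 ⟨‖k.inverse‖ * √(c * ‖k‖), fun v hv => ?_⟩)
  calc ‖v‖ = ‖k.inverse (k v)‖ := by rw [hk.isInvertible.inverse_apply_eq.2 rfl]
    _ ≤ ‖k.inverse‖ * ‖k v‖ := k.inverse.le_opNorm _
    _ ≤ ‖k.inverse‖ * √(c * ‖k‖) := by
      gcongr
      exact (hk.norm_apply_le v).trans (by gcongr; exact hv)

end IsInnerForm

theorem IsNormalMetric.abs_apply_div_sqrt_le [FiniteDimensional ℝ V] {G : V → V →L[ℝ] V →L[ℝ] ℝ}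
    {r c : ℝ} {v : V} (hG : IsNormalMetric G r) (hc : 0 < c) (hv : v ∈ normalBall G r) (w : V) :
    |G 0 v w / √(c + G 0 v v)| ≤ √(G v w w) := by
  have hsum : 0 < c + G 0 v v := add_pos_of_pos_of_nonneg hc (hG.isInnerForm_zero.nonneg v)
  have hw : 0 ≤ G v w w := (hG.isMetricOn.isInnerForm v hv).nonneg w
  rw [abs_div, abs_of_pos (Real.sqrt_pos.2 hsum), div_le_iff₀ (Real.sqrt_pos.2 hsum),
    ← Real.sqrt_mul hw]
  have hcauchy := (hG.isMetricOn.isInnerForm v hv).apply_sq_le v w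
  rw [hG.gauss_lemma hv, hG.apply_self hv] at hcauchy
  exact Real.abs_le_sqrt (by nlinarith [mul_nonneg hc.le hw])

end RadialSpeed

section ProductChart

variable {E : Type*} [NormedAddCommGroup E] [NormedSpace ℝ E]
  {H : Type*} [TopologicalSpace H] {I : ModelWithCorners ℝ E H}
  {W : Type*} [TopologicalSpace W] [ChartedSpace H W]

theorem extChartAt_prod_line_symm (p : W × ℝ) :
    ⇑(extChartAt (I.prod 𝓘(ℝ, ℝ)) p).symm = Prod.map (extChartAt I p.1).symm id := by
  rw [extChartAt_prod]
  rfl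

variable [I.Boundaryless] [IsManifold I 1 W] {p : W × ℝ} {y : E × ℝ}

theorem mfderiv_extChartAt_prod_line_symm (hy : y.1 ∈ (extChartAt I p.1).target) (u : E × ℝ) :
    (mfderiv 𝓘(ℝ, E × ℝ) (I.prod 𝓘(ℝ, ℝ)) (extChartAt (I.prod 𝓘(ℝ, ℝ)) p).symm y u : E × ℝ)
      = (mfderiv 𝓘(ℝ, E) I (extChartAt I p.1).symm y.1 u.1, u.2) := by
  have hsymm : MDifferentiableAt 𝓘(ℝ, E) I (extChartAt I p.1).symm y.1 :=
    ((contMDiffOn_extChartAt_symm (n := 1) p.1).contMDiffAt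
      ((isOpen_extChartAt_target p.1).mem_nhds hy)).mdifferentiableAt one_ne_zero
  have hfst : HasMFDerivAt 𝓘(ℝ, E × ℝ) I (fun z : E × ℝ => (extChartAt I p.1).symm z.1) y
      ((mfderiv 𝓘(ℝ, E) I (extChartAt I p.1).symm y.1).comp (ContinuousLinearMap.fst ℝ E ℝ)) :=
    hsymm.hasMFDerivAt.comp (f := Prod.fst) y hasFDerivAt_fst.hasMFDerivAt
  have hsnd : HasMFDerivAt 𝓘(ℝ, E × ℝ) 𝓘(ℝ, ℝ) (fun z : E × ℝ => z.2) y
      (ContinuousLinearMap.snd ℝ E ℝ) := hasFDerivAt_snd.hasMFDerivAt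
  rw [extChartAt_prod_line_symm]
  exact congr($((hfst.prodMk hsnd).mfderiv) u)

theorem chartMetric_prodLineMetric (g : MetricField I W) (hy : y.1 ∈ (extChartAt I p.1).target)
    (u v : E × ℝ) :
    chartMetric (prodLineMetric g) p y u v = chartMetric g p.1 y.1 u.1 v.1 + u.2 * v.2 := by
  have hbase := congr(($(extChartAt_prod_line_symm (I := I) p) y).1)
  simp only [chartMetric, prodLineMetric, mfderiv_fst, mfderiv_snd]
  refine congr($(?_) + $(?_))
  · refine (g.apply_congr hbase _ _).trans ?_
    exact congr(g _ ($(mfderiv_extChartAt_prod_line_symm hy u)).1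
      ($(mfderiv_extChartAt_prod_line_symm hy v)).1)
  · exact congr(($(mfderiv_extChartAt_prod_line_symm hy u)).2
      * ($(mfderiv_extChartAt_prod_line_symm hy v)).2)

variable [FiniteDimensional ℝ E]

theorem IsChartMetric.prodLineMetric {g : MetricField I W} {h : E → E →L[ℝ] E →L[ℝ] ℝ}
    (hh : IsChartMetric g p.1 h (extChartAt I p.1).target) :
    IsChartMetric (prodLineMetric g) p (lineProd h) ((extChartAt I p.1).target ×ˢ univ) where
  isMetricOn := hh.isMetricOn.lineProd
  chartMetric_eq y hy u v := by
    rw [chartMetric_prodLineMetric g hy.1, hh.chartMetric_eq y.1 hy.1, lineProd_apply]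

theorem IsLocalIsometryOn.lineProd {ψ : E → E} {G h : E → E →L[ℝ] E →L[ℝ] ℝ} {V U : Set E}
    (hψ : IsLocalIsometryOn ψ G V h U) :
    IsLocalIsometryOn (Prod.map ψ id) (lineProd G) (V ×ˢ univ) (lineProd h) (U ×ˢ univ) where
  source := hψ.source.lineProd
  target := hψ.target.lineProd
  contDiffOn := hψ.contDiffOn.prodMap contDiffOn_id
  mapsTo _ hq := ⟨hψ.mapsTo hq.1, trivial⟩
  apply_eq q hq a b := by
    have hderiv : HasFDerivAt (Prod.map ψ id) _ q :=
      (hψ.hasFDerivAt hq.1).prodMap q (hasFDerivAt_id _)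
    rw [lineProd_apply, lineProd_apply, hψ.apply_eq q.1 hq.1, hderiv.fderiv]
    rfl

end ProductChart

section ChartTransition

variable {E' : Type*} [NormedAddCommGroup E'] [NormedSpace ℝ E']
  {H' : Type*} [TopologicalSpace H'] {J : ModelWithCorners ℝ E' H'}
  {M : Type*} [TopologicalSpace M] [ChartedSpace H' M]

/-- The change of coordinates from the chart at `x` to the chart at `x₁`. -/
def chartTransition (J : ModelWithCorners ℝ E' H') (x x₁ : M) : E' → E' :=
  extChartAt J x₁ ∘ (extChartAt J x).symm

theorem chartTransition_center (x x₁ : M) :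
    chartTransition J x x₁ (extChartAt J x x) = extChartAt J x₁ x := by
  rw [chartTransition, Function.comp_apply, extChartAt_to_inv]

variable {x x₁ x₂ : M}

theorem eventually_symm_chartTransition (hx : x ∈ (extChartAt J x₁).source) :
    ∀ᶠ z in 𝓝 (extChartAt J x x),
      (extChartAt J x₁).symm (chartTransition J x x₁ z) = (extChartAt J x).symm z := by
  have hmem := (continuousAt_extChartAt_symm (I := J) x).eventually
    ((isOpen_extChartAt_source x₁).mem_nhds (by rwa [extChartAt_to_inv x]))
  exact hmem.mono fun z hz => (extChartAt J x₁).left_inv hz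

variable [J.Boundaryless] [IsManifold J ∞ M]

theorem contDiffAt_chartTransition (hx : x₂ ∈ (extChartAt J x).source)
    (hx₁ : x₂ ∈ (extChartAt J x₁).source) :
    ContDiffAt ℝ ∞ (chartTransition J x x₁) (extChartAt J x x₂) := by
  have hsymm := (contMDiffOn_extChartAt_symm (n := ∞) x).contMDiffAt
    ((isOpen_extChartAt_target x).mem_nhds ((extChartAt J x).map_source hx))
  refine (ContMDiffAt.comp (I' := J) (extChartAt J x x₂) ?_ hsymm).contDiffAt
  rw [(extChartAt J x).left_inv hx]
  exact contMDiffAt_extChartAt' (extChartAt_source J x₁ ▸ hx₁)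

theorem injective_fderiv_chartTransition (hx : x ∈ (extChartAt J x₁).source) :
    Function.Injective (fderiv ℝ (chartTransition J x x₁) (extChartAt J x x)) := by
  have hθ := contDiffAt_chartTransition (mem_extChartAt_source (I := J) x) hx
  have hθ' := contDiffAt_chartTransition hx (mem_extChartAt_source (I := J) x)
  rw [← chartTransition_center x x₁] at hθ'
  have hid : id =ᶠ[𝓝 (extChartAt J x x)] chartTransition J x₁ x ∘ chartTransition J x x₁ := by
    filter_upwards [eventually_symm_chartTransition hx, extChartAt_target_mem_nhds (I := J) x]
      with z hsymm hz
    refine ((extChartAt J x).right_inv hz).symm.trans ?_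
    rw [← hsymm]
    rfl
  have hcomp := (((hθ'.differentiableAt (by simp)).hasFDerivAt.comp _
    (hθ.differentiableAt (by simp)).hasFDerivAt).congr_of_eventuallyEq hid).unique
    (hasFDerivAt_id _)
  exact Function.LeftInverse.injective fun a => congr($hcomp a)

end ChartTransition

section LineRep

theorem injective_fderiv_of_comp {E V : Type*} [NormedAddCommGroup E] [NormedSpace ℝ E]
    [FiniteDimensional ℝ E] [NormedAddCommGroup V] [NormedSpace ℝ V] {F : E → V} {θ : E → E} {z : E}
    (hF : DifferentiableAt ℝ F (θ z)) (hθ : DifferentiableAt ℝ θ z)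
    (hθi : Function.Injective (fderiv ℝ θ z)) (h : Function.Injective (fderiv ℝ (F ∘ θ) z)) :
    Function.Injective (fderiv ℝ F (θ z)) := by
  rw [fderiv_comp z hF hθ] at h
  exact Function.Injective.of_comp_right (f := fderiv ℝ F (θ z)) h
    ((LinearMap.injective_iff_surjective (f := (fderiv ℝ θ z : E →ₗ[ℝ] E))).1 hθi)

theorem finrank_le_one_of_fst_eventuallyEq {E E' : Type*} [NormedAddCommGroup E]
    [NormedSpace ℝ E] [NormedAddCommGroup E'] [NormedSpace ℝ E'] {F : E' → E × ℝ} {z : E'}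
    {c : E} (hF : DifferentiableAt ℝ F z) (hi : Function.Injective (fderiv ℝ F z))
    (hc : (fun y => (F y).1) =ᶠ[𝓝 z] fun _ => c) : Module.finrank ℝ E' ≤ 1 := by
  have hfst (a : E') : (fderiv ℝ F z a).1 = 0 :=
    congr($(hF.hasFDerivAt.fst.unique ((hasFDerivAt_const c z).congr_of_eventuallyEq hc)) a)
  have hsnd : Function.Injective
      ((LinearMap.snd ℝ E ℝ).comp (fderiv ℝ F z : E' →ₗ[ℝ] E × ℝ)) :=
    fun a b hab => hi (Prod.ext ((hfst a).trans (hfst b).symm) hab)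
  exact (LinearMap.finrank_le_finrank_of_injective hsnd).trans_eq (Module.finrank_self ℝ)

variable {E : Type*} [NormedAddCommGroup E] [NormedSpace ℝ E]
  {H : Type*} [TopologicalSpace H] {I : ModelWithCorners ℝ E H}
  {W : Type*} [TopologicalSpace W] [ChartedSpace H W]
  {E' : Type*} [NormedAddCommGroup E'] [NormedSpace ℝ E']
  {H' : Type*} [TopologicalSpace H'] {J : ModelWithCorners ℝ E' H'}
  {M : Type*} [TopologicalSpace M] [ChartedSpace H' M]
  {Φ : OpenPartialHomeomorph E W} {φ : M → W × ℝ} {x x₁ : M}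

/-- The coordinate expression of a map into `W × ℝ` in the chart at `x₁` and the parametrization
`Φ` of an open subset of `W`. -/
def lineRep (J : ModelWithCorners ℝ E' H') (Φ : OpenPartialHomeomorph E W) (φ : M → W × ℝ)
    (x₁ : M) : E' → E × ℝ :=
  fun z => Prod.map Φ.symm id (φ ((extChartAt J x₁).symm z))

omit [NormedSpace ℝ E] in
theorem lineRep_extChartAt (Φ : OpenPartialHomeomorph E W) (φ : M → W × ℝ)
    (hx : x ∈ (extChartAt J x₁).source) :
    lineRep J Φ φ x₁ (extChartAt J x₁ x) = (Φ.symm (φ x).1, (φ x).2) := by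
  rw [lineRep, (extChartAt J x₁).left_inv hx]
  rfl

omit [NormedSpace ℝ E] in
theorem lineRep_extChartAt_mem_prod_univ {V : Set E} (hx : x ∈ (extChartAt J x₁).source)
    (hxV : Φ.symm (φ x).1 ∈ V) : lineRep J Φ φ x₁ (extChartAt J x₁ x) ∈ V ×ˢ univ := by
  rw [lineRep_extChartAt Φ φ hx]
  exact ⟨hxV, trivial⟩

theorem contDiffAt_lineRep [J.Boundaryless] [IsManifold J ∞ M]
    (hΦ : ContMDiffOn I 𝓘(ℝ, E) ∞ Φ.symm Φ.target) (hφ : ContMDiff J (I.prod 𝓘(ℝ, ℝ)) ∞ φ)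
    (hx : x ∈ (extChartAt J x₁).source) (hxΦ : (φ x).1 ∈ Φ.target) :
    ContDiffAt ℝ ∞ (lineRep J Φ φ x₁) (extChartAt J x₁ x) := by
  have hsymm := (contMDiffOn_extChartAt_symm (n := ∞) x₁).contMDiffAt
    ((isOpen_extChartAt_target x₁).mem_nhds ((extChartAt J x₁).map_source hx))
  have hφsymm := hφ.contMDiffAt.comp (extChartAt J x₁ x) hsymm
  have hfst := contMDiffAt_fst.comp (extChartAt J x₁ x) hφsymm
  have hsnd := contMDiffAt_snd.comp (extChartAt J x₁ x) hφsymm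
  refine ContDiffAt.prodMk (ContMDiffAt.comp (I' := I) (g := Φ.symm) _ ?_ hfst).contDiffAt
    hsnd.contDiffAt
  simp only [Function.comp_apply, (extChartAt J x₁).left_inv hx]
  exact hΦ.contMDiffAt (Φ.open_target.mem_nhds hxΦ)

theorem chartRep_eventuallyEq (hφ : Continuous φ)
    (hx : x ∈ (extChartAt J x₁).source) (hxΦ : (φ x).1 ∈ Φ.target) :
    chartRep J (I.prod 𝓘(ℝ, ℝ)) φ x =ᶠ[𝓝 (extChartAt J x x)]
      (Prod.map (extChartAt I (φ x).1 ∘ Φ) id ∘ lineRep J Φ φ x₁) ∘ chartTransition J x x₁ := by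
  have hcont : ContinuousAt (fun z => (φ ((extChartAt J x).symm z)).1) (extChartAt J x x) :=
    (continuous_fst.comp hφ).continuousAt.comp (continuousAt_extChartAt_symm x)
  filter_upwards [eventually_symm_chartTransition hx, hcont.eventually
    (Φ.open_target.mem_nhds (by simpa only [extChartAt_to_inv] using hxΦ))] with z hsymm hz
  rw [chartRep, extChartAt_prod, Function.comp_apply, Function.comp_apply, lineRep, hsymm]
  exact Prod.ext congr(extChartAt I (φ x).1 $((Φ.right_inv hz).symm)) rfl

section MeanCurvature

variable [FiniteDimensional ℝ E] [FiniteDimensional ℝ E'] [J.Boundaryless] [IsManifold J ∞ M]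
  {G h : E → E →L[ℝ] E →L[ℝ] ℝ} {V U : Set E}

theorem injective_fderiv_lineRep
    (hiso : IsLocalIsometryOn (extChartAt I (φ x).1 ∘ Φ) G V h U)
    (hΦ : ContMDiffOn I 𝓘(ℝ, E) ∞ Φ.symm Φ.target) (hφ : IsSmoothImmersion J (I.prod 𝓘(ℝ, ℝ)) φ)
    (hx : x ∈ (extChartAt J x₁).source) (hxΦ : (φ x).1 ∈ Φ.target) (hxV : Φ.symm (φ x).1 ∈ V) :
    Function.Injective (fderiv ℝ (lineRep J Φ φ x₁) (extChartAt J x₁ x)) := by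
  have hθ := contDiffAt_chartTransition (mem_extChartAt_source (I := J) x) hx
  have hF := contDiffAt_lineRep hΦ hφ.1 hx hxΦ
  have hFV := lineRep_extChartAt_mem_prod_univ (J := J) hx hxV
  have hΨ := hiso.lineProd.contDiffAt hFV
  have hinj := hφ.2 x
  rw [mfderiv_eq_fderiv_chartRep (hφ.1.mdifferentiable (by simp) x),
    (chartRep_eventuallyEq hφ.1.continuous hx hxΦ).fderiv_eq] at hinj
  rw [← chartTransition_center x x₁] at hF hΨ ⊢
  have hΨF := injective_fderiv_of_comp ((hΨ.comp _ hF).differentiableAt (by simp))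
    (hθ.differentiableAt (by simp)) (injective_fderiv_chartTransition hx) hinj
  rw [fderiv_comp _ (hΨ.differentiableAt (by simp)) (hF.differentiableAt (by simp))] at hΨF
  exact Function.Injective.of_comp (f := fderiv ℝ (Prod.map _ _) _) hΨF

theorem flatMeanCurvature_chartRep
    (hiso : IsLocalIsometryOn (extChartAt I (φ x).1 ∘ Φ) G V h U)
    (hΦ : ContMDiffOn I 𝓘(ℝ, E) ∞ Φ.symm Φ.target) (hφ : IsSmoothImmersion J (I.prod 𝓘(ℝ, ℝ)) φ)
    (hx : x ∈ (extChartAt J x₁).source) (hxΦ : (φ x).1 ∈ Φ.target) (hxV : Φ.symm (φ x).1 ∈ V) :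
    flatMeanCurvature (lineProd h) (chartRep J (I.prod 𝓘(ℝ, ℝ)) φ x) (extChartAt J x x)
      = fderiv ℝ (Prod.map (extChartAt I (φ x).1 ∘ Φ) id)
          (lineRep J Φ φ x₁ (extChartAt J x₁ x))
          (flatMeanCurvature (lineProd G) (lineRep J Φ φ x₁) (extChartAt J x₁ x)) := by
  have hθ := contDiffAt_chartTransition (mem_extChartAt_source (I := J) x) hx
  have hF := contDiffAt_lineRep hΦ hφ.1 hx hxΦ
  have hFi := injective_fderiv_lineRep hiso hΦ hφ hx hxΦ hxV
  have hFV := lineRep_extChartAt_mem_prod_univ (J := J) hx hxV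
  have hΨ := hiso.lineProd.contDiffAt hFV
  have hΨF : Function.Injective (fderiv ℝ (Prod.map (extChartAt I (φ x).1 ∘ Φ) id
      ∘ lineRep J Φ φ x₁) (extChartAt J x₁ x)) := by
    rw [fderiv_comp _ (hΨ.differentiableAt (by simp)) (hF.differentiableAt (by simp))]
    exact (hiso.lineProd.injective hFV).comp hFi
  rw [flatMeanCurvature_congr (chartRep_eventuallyEq hφ.1.continuous hx hxΦ),
    ← hiso.lineProd.flatMeanCurvature_comp hFV hF]
  rw [← chartTransition_center x x₁] at hF hΨ hFV hΨF ⊢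
  exact hiso.lineProd.target.flatMeanCurvature_comp (hiso.lineProd.mapsTo hFV) (hΨ.comp _ hF) hθ
    hΨF (injective_fderiv_chartTransition hx)

theorem meanCurvatureNorm_prodLineMetric [I.Boundaryless] [IsManifold I 1 W] {g : MetricField I W}
    (hg : IsChartMetric g (φ x).1 h (extChartAt I (φ x).1).target)
    (hiso : IsLocalIsometryOn (extChartAt I (φ x).1 ∘ Φ) G V h U)
    (hΦ : ContMDiffOn I 𝓘(ℝ, E) ∞ Φ.symm Φ.target) (hφ : IsSmoothImmersion J (I.prod 𝓘(ℝ, ℝ)) φ)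
    (hx : x ∈ (extChartAt J x₁).source) (hxΦ : (φ x).1 ∈ Φ.target) (hxV : Φ.symm (φ x).1 ∈ V) :
    meanCurvatureNorm J (prodLineMetric g) φ x =
      √(lineProd G (lineRep J Φ φ x₁ (extChartAt J x₁ x))
        (flatMeanCurvature (lineProd G) (lineRep J Φ φ x₁) (extChartAt J x₁ x))
        (flatMeanCurvature (lineProd G) (lineRep J Φ φ x₁) (extChartAt J x₁ x))) := by
  have hFV := lineRep_extChartAt_mem_prod_univ (J := J) hx hxV
  have hcenter : extChartAt (I.prod 𝓘(ℝ, ℝ)) (φ x) (φ x)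
      ∈ (extChartAt I (φ x).1).target ×ˢ univ := by
    rw [extChartAt_prod]
    exact ⟨mem_extChartAt_target _, trivial⟩
  have hinj := hφ.2 x
  rw [mfderiv_eq_fderiv_chartRep (hφ.1.mdifferentiable (by simp) x)] at hinj
  rw [hg.prodLineMetric.meanCurvatureNorm_eq hcenter hφ.1.contMDiffAt hinj,
    flatMeanCurvature_chartRep hiso hΦ hφ hx hxΦ hxV, hiso.lineProd.apply_eq _ hFV,
    (chartRep_eventuallyEq hφ.1.continuous hx hxΦ).eq_of_nhds, Function.comp_apply,
    chartTransition_center]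
  rfl

end MeanCurvature

end LineRep

end NormedSpaces

section Parametrization

variable {E : Type*} [NormedAddCommGroup E] [NormedSpace ℝ E]
  {H : Type*} [TopologicalSpace H] {I : ModelWithCorners ℝ E H}
  {N : Type*} [TopologicalSpace N] [ChartedSpace H N]

/-- `σ` is a smooth immersion of the open subset `U` of the model space into the manifold. -/
structure IsParam (I : ModelWithCorners ℝ E H) {N : Type*} [TopologicalSpace N] [ChartedSpace H N]
    (σ : E → N) (U : Set E) : Prop where
  isOpen : IsOpen U
  contMDiffOn : ContMDiffOn 𝓘(ℝ, E) I ∞ σ U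
  injective : ∀ y ∈ U, Function.Injective (mfderiv 𝓘(ℝ, E) I σ y)

/-- The pullback of the Riemannian metric of `N` under a map from the model space. -/
def pullbackMetric (I : ModelWithCorners ℝ E H) {N : Type*} [TopologicalSpace N]
    [ChartedSpace H N] [RiemannianBundle (fun x : N => TangentSpace I x)] (σ : E → N) (y : E) :
    E →L[ℝ] E →L[ℝ] ℝ :=
  (innerSL ℝ : TangentSpace I (σ y) →L[ℝ] TangentSpace I (σ y) →L[ℝ] ℝ).bilinearComp
    (mfderiv 𝓘(ℝ, E) I σ y : E →L[ℝ] TangentSpace I (σ y))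
    (mfderiv 𝓘(ℝ, E) I σ y : E →L[ℝ] TangentSpace I (σ y))

theorem pullbackMetric_apply [RiemannianBundle (fun x : N => TangentSpace I x)] (σ : E → N)
    (y a b : E) : pullbackMetric I σ y a b
      = riemannianMetric I N (σ y) (mfderiv 𝓘(ℝ, E) I σ y a) (mfderiv 𝓘(ℝ, E) I σ y b) := rfl

theorem mfderiv_comp_apply_of_eventuallyEq {σ τ : E → N} {ψ : E → E} {y : E}
    (hτ : MDifferentiableAt 𝓘(ℝ, E) I τ (ψ y)) (hψ : DifferentiableAt ℝ ψ y)
    (h : σ =ᶠ[𝓝 y] τ ∘ ψ) (a : E) :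
    (mfderiv 𝓘(ℝ, E) I σ y a : E) = mfderiv 𝓘(ℝ, E) I τ (ψ y) (fderiv ℝ ψ y a) := by
  have hσ : HasMFDerivAt 𝓘(ℝ, E) I σ y
      ((mfderiv 𝓘(ℝ, E) I τ (ψ y)).comp (mfderiv 𝓘(ℝ, E) 𝓘(ℝ, E) ψ y)) :=
    (hτ.hasMFDerivAt.comp y hψ.mdifferentiableAt.hasMFDerivAt).congr_of_eventuallyEq h
  rw [hσ.mfderiv, mfderiv_eq_fderiv]
  rfl

namespace IsParam

variable {σ τ : E → N} {U U' : Set E}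

theorem mdifferentiableAt (hσ : IsParam I σ U) {y : E} (hy : y ∈ U) :
    MDifferentiableAt 𝓘(ℝ, E) I σ y :=
  (hσ.contMDiffOn.contMDiffAt (hσ.isOpen.mem_nhds hy)).mdifferentiableAt (by simp)

theorem of_leftInverse (hU : IsOpen U) (hσ : ContMDiffOn 𝓘(ℝ, E) I ∞ σ U) {τ : N → E}
    (hτ : ∀ y ∈ U, MDifferentiableAt I 𝓘(ℝ, E) τ (σ y)) (hτσ : ∀ y ∈ U, τ (σ y) = y) :
    IsParam I σ U where
  isOpen := hU
  contMDiffOn := hσ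
  injective y hy := by
    have hσy : MDifferentiableAt 𝓘(ℝ, E) I σ y :=
      (hσ.contMDiffAt (hU.mem_nhds hy)).mdifferentiableAt (by simp)
    have hid : id =ᶠ[𝓝 y] τ ∘ σ := by
      filter_upwards [hU.mem_nhds hy] with z hz using (hτσ z hz).symm
    have hcomp : (mfderiv I 𝓘(ℝ, E) τ (σ y)).comp (mfderiv 𝓘(ℝ, E) I σ y)
        = ContinuousLinearMap.id ℝ (TangentSpace 𝓘(ℝ, E) y) :=
      hasMFDerivAt_unique
        (((hτ y hy).hasMFDerivAt.comp y hσy.hasMFDerivAt).congr_of_eventuallyEq hid)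
        (hasMFDerivAt_id y)
    exact Function.LeftInverse.injective (g := mfderiv I 𝓘(ℝ, E) τ (σ y)) fun a => congr($hcomp a)

variable [IsManifold I ∞ N]

theorem extChartAt_symm [I.Boundaryless] (p : N) :
    IsParam I (extChartAt I p).symm (extChartAt I p).target :=
  of_leftInverse (isOpen_extChartAt_target p) (contMDiffOn_extChartAt_symm p)
    (fun _ hy => mdifferentiableAt_extChartAt
      (extChartAt_source I p ▸ (extChartAt I p).map_target hy))
    fun _ hy => (extChartAt I p).right_inv hy

theorem contMDiffOn_mfderiv_apply (hσ : IsParam I σ U) (a : E) :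
    ContMDiffOn 𝓘(ℝ, E) (I.prod 𝓘(ℝ, E)) ∞
      (fun y => (⟨σ y, mfderiv 𝓘(ℝ, E) I σ y a⟩ : TangentBundle I N)) U := by
  have htangent := hσ.contMDiffOn.contMDiffOn_tangentMapWithin (m := ∞) (by simp)
    hσ.isOpen.uniqueMDiffOn
  have hconst : ContMDiffOn 𝓘(ℝ, E) 𝓘(ℝ, E).tangent ∞
      (fun y => (⟨y, a⟩ : TangentBundle 𝓘(ℝ, E) E)) U := fun _ _ =>
    contMDiffWithinAt_vectorSpace_iff_contDiffWithinAt.2 contDiffWithinAt_const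
  refine (htangent.comp hconst fun y hy => hy).congr fun y hy => ?_
  simp only [Function.comp_apply, tangentMapWithin, mfderivWithin_of_isOpen hσ.isOpen hy]

variable [FiniteDimensional ℝ E] [RiemannianBundle (fun x : N => TangentSpace I x)]
  [IsContMDiffRiemannianBundle I ∞ E (fun x : N => TangentSpace I x)]

theorem contDiffOn_pullbackMetric (hσ : IsParam I σ U) :
    ContDiffOn ℝ ∞ (pullbackMetric I σ) U :=
  contDiffOn_clm_apply.2 fun a => contDiffOn_clm_apply.2 fun b => contMDiffOn_iff_contDiffOn.1 <|
    ContMDiffOn.inner_bundle (IB := I) (F := E) (E := fun x : N => TangentSpace I x)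
      (b := σ) (v := fun y => mfderiv 𝓘(ℝ, E) I σ y a) (w := fun y => mfderiv 𝓘(ℝ, E) I σ y b)
      (hσ.contMDiffOn_mfderiv_apply a) (hσ.contMDiffOn_mfderiv_apply b)

theorem isMetricOn (hσ : IsParam I σ U) : IsMetricOn (pullbackMetric I σ) U where
  isOpen := hσ.isOpen
  contDiffOn := hσ.contDiffOn_pullbackMetric
  isInnerForm y hy :=
    { symm := fun a b => real_inner_comm (F := TangentSpace I (σ y))
        (mfderiv 𝓘(ℝ, E) I σ y b) (mfderiv 𝓘(ℝ, E) I σ y a)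
      pos := fun _ ha => (real_inner_self_pos (F := TangentSpace I (σ y))).2 fun hzero =>
        ha (hσ.injective y hy (hzero.trans (map_zero _).symm)) }

theorem isLocalIsometryOn {V : Set E} {ψ : E → E} (hσ : IsParam I σ U) (hτ : IsParam I τ U')
    (hV : IsOpen V) (hVU : V ⊆ U) (hψ : ContDiffOn ℝ ∞ ψ V) (hmaps : MapsTo ψ V U')
    (hστ : ∀ y ∈ V, σ y = τ (ψ y)) :
    IsLocalIsometryOn ψ (pullbackMetric I σ) V (pullbackMetric I τ) U' where
  source := hσ.isMetricOn.mono hV hVU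
  target := hτ.isMetricOn
  contDiffOn := hψ
  mapsTo := hmaps
  apply_eq y hy a b := by
    have heq : σ =ᶠ[𝓝 y] τ ∘ ψ := by
      filter_upwards [hV.mem_nhds hy] with z hz using hστ z hz
    have hderiv := mfderiv_comp_apply_of_eventuallyEq (hτ.mdifferentiableAt (hmaps hy))
      ((hψ.contDiffAt (hV.mem_nhds hy)).differentiableAt (by simp)) heq
    rw [pullbackMetric_apply, pullbackMetric_apply]
    exact (congr(riemannianMetric I N (σ y) $(hderiv a) $(hderiv b))).trans
      ((riemannianMetric I N).apply_congr (hστ y hy) _ _)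

end IsParam

theorem isChartMetric_extChartAt_symm [IsManifold I ∞ N] [I.Boundaryless] [FiniteDimensional ℝ E]
    [RiemannianBundle (fun x : N => TangentSpace I x)]
    [IsContMDiffRiemannianBundle I ∞ E (fun x : N => TangentSpace I x)] (p : N) :
    IsChartMetric (riemannianMetric I N) p (pullbackMetric I (extChartAt I p).symm)
      (extChartAt I p).target where
  isMetricOn := (IsParam.extChartAt_symm p).isMetricOn
  chartMetric_eq _ _ _ _ := rfl

end Parametrization

section NormalCoordinates

variable {E : Type*} [NormedAddCommGroup E] [NormedSpace ℝ E] [FiniteDimensional ℝ E]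
  {H : Type*} [TopologicalSpace H] {I : ModelWithCorners ℝ E H}
  {N : Type*} [TopologicalSpace N] [ChartedSpace H N]

namespace IsParam

variable {σ : E → N} {U : Set E} {u y : E} {t : ℝ}

omit [FiniteDimensional ℝ E] in
theorem velocity_ray (hσ : IsParam I σ U) (ht : t • u ∈ U) :
    (velocity (I := I) (fun s : ℝ => σ (s • u)) t : E) = mfderiv 𝓘(ℝ, E) I σ (t • u) u := by
  have hray : HasDerivAt (fun s : ℝ => s • u) u t := by
    simpa using (hasDerivAt_id t).smul_const u
  have hcomp := (hσ.mdifferentiableAt ht).hasMFDerivAt.comp t hray.hasFDerivAt.hasMFDerivAt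
  rw [velocity, show mfderiv 𝓘(ℝ, ℝ) I (fun s : ℝ => σ (s • u)) t = _ from hcomp.mfderiv]
  exact congr(mfderiv 𝓘(ℝ, E) I σ (t • u) $(one_smul ℝ u))

omit [FiniteDimensional ℝ E] in
theorem mfderiv_eq_fderiv_extChartAt_comp (hσ : IsParam I σ U) (hy : y ∈ U) :
    (mfderiv 𝓘(ℝ, E) I σ y : E →L[ℝ] E) = fderiv ℝ (extChartAt I (σ y) ∘ σ) y :=
  mfderiv_eq_fderiv_chartRep (hσ.mdifferentiableAt hy)

variable [I.Boundaryless] [IsManifold I ∞ N]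
  [RiemannianBundle (fun x : N => TangentSpace I x)]
  [IsContMDiffRiemannianBundle I ∞ E (fun x : N => TangentSpace I x)]

theorem isLocalIsometryOn_extChartAt_comp (hσ : IsParam I σ U) (p : N) :
    IsLocalIsometryOn (extChartAt I p ∘ σ) (pullbackMetric I σ)
      (U ∩ σ ⁻¹' (extChartAt I p).source) (pullbackMetric I (extChartAt I p).symm)
      (extChartAt I p).target := by
  refine hσ.isLocalIsometryOn (extChartAt_symm p)
    (hσ.contMDiffOn.continuousOn.isOpen_inter_preimage hσ.isOpen (isOpen_extChartAt_source p))
    inter_subset_left ?_ (fun y hy => (extChartAt I p).map_source hy.2)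
    fun y hy => ((extChartAt I p).left_inv hy.2).symm
  refine contMDiffOn_iff_contDiffOn.1 (ContMDiffOn.comp (t := (extChartAt I p).source) ?_
    (hσ.contMDiffOn.mono inter_subset_left) fun y hy => hy.2)
  rw [extChartAt_source]
  exact contMDiffOn_extChartAt

theorem covAccel_ray (hσ : IsParam I σ U) (ht : t • u ∈ U) :
    (covAccel (riemannianMetric I N) (fun s : ℝ => σ (s • u)) t : E)
      = mfderiv 𝓘(ℝ, E) I σ (t • u) (leviCivita (pullbackMetric I σ) (t • u) u u) := by
  have hiso := hσ.isLocalIsometryOn_extChartAt_comp (σ (t • u))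
  have hmem : t • u ∈ U ∩ σ ⁻¹' (extChartAt I (σ (t • u))).source :=
    ⟨ht, mem_extChartAt_source _⟩
  have hray : HasDerivAt (fun s : ℝ => s • u) u t := by
    simpa using (hasDerivAt_id t).smul_const u
  have hderiv : deriv (fun s : ℝ => extChartAt I (σ (t • u)) (σ (s • u))) t
      = fderiv ℝ (extChartAt I (σ (t • u)) ∘ σ) (t • u) u :=
    ((hiso.hasFDerivAt hmem).comp_hasDerivAt (f := fun s : ℝ => s • u) t hray).deriv
  have hsecond : deriv (deriv fun s : ℝ => extChartAt I (σ (t • u)) (σ (s • u))) t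
      = fderiv ℝ (fderiv ℝ (extChartAt I (σ (t • u)) ∘ σ)) (t • u) u u := by
    simpa using deriv_deriv_comp_add_smul (f := extChartAt I (σ (t • u)) ∘ σ) (x := 0) (a := u)
      (t := t) (by simpa using (hiso.contDiffAt hmem).of_le ENat.LEInfty.out)
  rw [covAccel, hderiv, hsecond]
  have hmap := hiso.map_leviCivita hmem u u
  rw [← (isChartMetric_extChartAt_symm _).christoffel_eq (hiso.mapsTo hmem)] at hmap
  exact hmap.symm.trans congr($(hσ.mfderiv_eq_fderiv_extChartAt_comp ht) _).symm

theorem riemannTensor_mfderiv (hσ : IsParam I σ U) (hy : y ∈ U) (u v w : E) :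
    (riemannTensor (riemannianMetric I N) (σ y) (mfderiv 𝓘(ℝ, E) I σ y u)
        (mfderiv 𝓘(ℝ, E) I σ y v) (mfderiv 𝓘(ℝ, E) I σ y w) : E)
      = mfderiv 𝓘(ℝ, E) I σ y
          (connectionCurvature (E := E) (leviCivita (pullbackMetric I σ)) y u v w) := by
  have hiso := hσ.isLocalIsometryOn_extChartAt_comp (σ y)
  have hmem : y ∈ U ∩ σ ⁻¹' (extChartAt I (σ y)).source := ⟨hy, mem_extChartAt_source _⟩
  rw [hσ.mfderiv_eq_fderiv_extChartAt_comp hy]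
  exact ((isChartMetric_extChartAt_symm _).riemannTensor_eq (mem_extChartAt_target _) _ _ _).trans
    (hiso.map_connectionCurvature hmem u v w).symm

theorem sectionalCurvature_mfderiv (hσ : IsParam I σ U) (hy : y ∈ U) (u v : E) :
    sectionalCurvature (riemannianMetric I N) (σ y) (mfderiv 𝓘(ℝ, E) I σ y u)
        (mfderiv 𝓘(ℝ, E) I σ y v)
      = pullbackMetric I σ y (connectionCurvature (leviCivita (pullbackMetric I σ)) y u v v) u
        / (pullbackMetric I σ y u u * pullbackMetric I σ y v v - pullbackMetric I σ y u v ^ 2) := by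
  rw [sectionalCurvature, hσ.riemannTensor_mfderiv hy]
  rfl

end IsParam

/-- `Φ` is a geodesic polar chart of radius `r` at `Φ 0`: the exponential map, read in the model
space, with the rays of unit speed as geodesics. The linear identification with the tangent space
is carried by the inner product `pullbackMetric I Φ 0`. -/
structure IsNormalChart (I : ModelWithCorners ℝ E H) {N : Type*} [TopologicalSpace N]
    [ChartedSpace H N] [RiemannianBundle (fun x : N => TangentSpace I x)]
    (Φ : OpenPartialHomeomorph E N) (r : ℝ) : Prop where
  pos : 0 < r
  contMDiffOn : ContMDiffOn 𝓘(ℝ, E) I ∞ Φ Φ.source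
  contMDiffOn_symm : ContMDiffOn I 𝓘(ℝ, E) ∞ Φ.symm Φ.target
  source_eq : Φ.source = normalBall (pullbackMetric I Φ) r
  isGeodesicOn : ∀ u, pullbackMetric I Φ 0 u u = 1 →
    IsGeodesicOn (riemannianMetric I N) (fun t : ℝ => Φ (t • u)) (Ioo (-r) r)

variable {Φ : OpenPartialHomeomorph E N} {r : ℝ}

omit [FiniteDimensional ℝ E] in
theorem isParam_of_contMDiffOn_symm (hΦ : ContMDiffOn 𝓘(ℝ, E) I ∞ Φ Φ.source)
    (hΦ' : ContMDiffOn I 𝓘(ℝ, E) ∞ Φ.symm Φ.target) : IsParam I Φ Φ.source :=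
  .of_leftInverse Φ.open_source hΦ
    (fun _ hy => (hΦ'.contMDiffAt (Φ.open_target.mem_nhds (Φ.map_source hy))).mdifferentiableAt
      (by simp))
    fun _ hy => Φ.left_inv hy

variable [RiemannianBundle (fun x : N => TangentSpace I x)]

theorem IsNormalRadius.exists_isNormalChart {x₀ : N} (hr : 0 < r)
    (h : IsNormalRadius (riemannianMetric I N) x₀ r) :
    ∃ Φ : OpenPartialHomeomorph E N, IsNormalChart I Φ r ∧ Φ 0 = x₀ := by
  obtain ⟨Φ, hsource, hΦ, hΦ', hcenter, hray⟩ := h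
  have hparam := isParam_of_contMDiffOn_symm hΦ hΦ'
  let k : E →L[ℝ] E →L[ℝ] ℝ :=
    (innerSL ℝ : TangentSpace I x₀ →L[ℝ] TangentSpace I x₀ →L[ℝ] ℝ)
  have hk : IsInnerForm k :=
    ⟨fun a b => real_inner_comm (F := TangentSpace I x₀) b a,
      fun a ha => (real_inner_self_pos (F := TangentSpace I x₀)).2 ha⟩
  have hzero : (0 : E) ∈ Φ.source := by
    rw [hsource]
    exact (map_zero (k 0)).trans_lt (pow_pos hr 2)
  have hunit (u : E) (hu : k u u = 1) : pullbackMetric I Φ 0 u u = 1 := by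
    have hu0 : (0 : ℝ) • u ∈ Φ.source := by rwa [zero_smul]
    have hspeed := congrArg (fun p : TangentBundle I N => riemannianMetric I N p.1 p.2 p.2)
      (hray u hu).2
    have hpull : pullbackMetric I Φ ((0 : ℝ) • u) u u = 1 := by
      rw [pullbackMetric_apply, ← hparam.velocity_ray hu0]
      exact hspeed.trans hu
    rwa [zero_smul] at hpull
  have hdiag (v : E) : pullbackMetric I Φ 0 v v = k v v := by
    rcases eq_or_ne v 0 with rfl | hv
    · simp
    obtain ⟨u, hu, hvu⟩ := hk.exists_sqrt_smul_eq hv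
    rw [← hvu]
    simp only [map_smul, smul_apply, smul_eq_mul, hu, hunit u hu]
  refine ⟨Φ, ⟨hr, hΦ, hΦ', ?_, fun u hu => (hray u ((hdiag u).symm.trans hu)).1⟩, hcenter⟩
  rw [hsource]
  ext v
  exact (congr($(hdiag v) < r ^ 2)).symm.to_iff

namespace IsNormalChart

variable {u v : E} {t : ℝ}

theorem isParam (hΦ : IsNormalChart I Φ r) : IsParam I Φ Φ.source :=
  isParam_of_contMDiffOn_symm hΦ.contMDiffOn hΦ.contMDiffOn_symm

variable [IsManifold I ∞ N]
  [IsContMDiffRiemannianBundle I ∞ E (fun x : N => TangentSpace I x)]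

theorem exists_eq_smul (hΦ : IsNormalChart I Φ r) (hv : v ∈ Φ.source) (hv0 : v ≠ 0) :
    ∃ t ∈ Ioo 0 r, ∃ u, pullbackMetric I Φ 0 u u = 1 ∧ v = t • u := by
  have hzero : (0 : E) ∈ Φ.source := by
    rw [hΦ.source_eq]
    simpa [normalBall] using pow_pos hΦ.pos 2
  have hinner := hΦ.isParam.isMetricOn.isInnerForm 0 hzero
  obtain ⟨u, hu, hvu⟩ := hinner.exists_sqrt_smul_eq hv0
  exact ⟨_, ⟨Real.sqrt_pos.2 (hinner.pos v hv0),
    (Real.sqrt_lt' hΦ.pos).2 (hΦ.source_eq ▸ hv : v ∈ normalBall _ r)⟩, u, hu, hvu.symm⟩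

variable [I.Boundaryless]

theorem leviCivita_self (hΦ : IsNormalChart I Φ r) (hv : v ∈ Φ.source) :
    leviCivita (pullbackMetric I Φ) v v v = 0 := by
  rcases eq_or_ne v 0 with rfl | hv0
  · simp
  obtain ⟨t, ht, u, hu, rfl⟩ := hΦ.exists_eq_smul hv hv0
  have haccel := hΦ.isParam.covAccel_ray hv
  rw [(hΦ.isGeodesicOn u hu).2 t ⟨by linarith [ht.1, hΦ.pos], ht.2⟩] at haccel
  have hray : leviCivita (pullbackMetric I Φ) (t • u) u u = 0 :=
    hΦ.isParam.injective _ hv (haccel.symm.trans (map_zero _).symm)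
  simp only [map_smul, smul_apply, hray, smul_zero]

theorem isNormalMetric (hΦ : IsNormalChart I Φ r) : IsNormalMetric (pullbackMetric I Φ) r where
  pos := hΦ.pos
  isMetricOn := hΦ.source_eq ▸ hΦ.isParam.isMetricOn
  leviCivita_self _ hv := hΦ.leviCivita_self (hΦ.source_eq ▸ hv)

theorem apply_connectionCurvature_le (hΦ : IsNormalChart I Φ r) {κ : ℝ}
    (hκ : RadialCurvatureLE (riemannianMetric I N) (Φ 0) κ) (ht : t ∈ Ioo 0 r)
    (hu : pullbackMetric I Φ 0 u u = 1) (htu : t • u ∈ Φ.source)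
    (hv : pullbackMetric I Φ (t • u) v v = 1) (huv : pullbackMetric I Φ (t • u) u v = 0) :
    pullbackMetric I Φ (t • u)
      (connectionCurvature (leviCivita (pullbackMetric I Φ)) (t • u) u v v) u ≤ κ := by
  have huu : pullbackMetric I Φ (t • u) u u = 1 :=
    (hΦ.isNormalMetric.apply_ray_self ht.1.ne' (hΦ.source_eq ▸ htu)).trans hu
  have hspeed : riemannianMetric I N (Φ ((0 : ℝ) • u))
      (velocity (fun s : ℝ => Φ (s • u)) 0) (velocity (fun s : ℝ => Φ (s • u)) 0) = 1 := by
    have hzero : (0 : ℝ) • u ∈ Φ.source := by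
      rw [zero_smul, hΦ.source_eq]
      exact hΦ.isNormalMetric.zero_mem
    have hspeed' : pullbackMetric I Φ ((0 : ℝ) • u) u u = 1 := by rwa [zero_smul]
    rwa [pullbackMetric_apply, ← hΦ.isParam.velocity_ray hzero] at hspeed'
  have hsec := hκ (fun s : ℝ => Φ (s • u)) (-r) r (neg_lt_zero.2 hΦ.pos) hΦ.pos
    (hΦ.isGeodesicOn u hu) (by simp) hspeed t ht (mfderiv 𝓘(ℝ, E) I Φ (t • u) v) hv
  rw [hΦ.isParam.velocity_ray htu] at hsec
  simpa [hΦ.isParam.sectionalCurvature_mfderiv htu, huu, hv, huv] using hsec huv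

theorem hasRadialCurvatureLE (hΦ : IsNormalChart I Φ r) {κ : ℝ}
    (hκ : RadialCurvatureLE (riemannianMetric I N) (Φ 0) κ) :
    HasRadialCurvatureLE (pullbackMetric I Φ) r κ := by
  intro v hv hv0 a hva
  rcases eq_or_ne a 0 with rfl | ha0
  · simp [connectionCurvature]
  have hinner := hΦ.isNormalMetric.isMetricOn.isInnerForm v hv
  have hvsrc : v ∈ Φ.source := hΦ.source_eq ▸ hv
  obtain ⟨t, ht, u, hu, rfl⟩ := hΦ.exists_eq_smul hvsrc hv0
  obtain ⟨b, hb, hba⟩ := hinner.exists_sqrt_smul_eq ha0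
  have huu : pullbackMetric I Φ (t • u) u u = 1 :=
    (hΦ.isNormalMetric.apply_ray_self ht.1.ne' hv).trans hu
  have hs0 := (Real.sqrt_pos.2 (hinner.pos a ha0)).ne'
  generalize √(pullbackMetric I Φ (t • u) a a) = s at hba hs0
  subst hba
  have hub : pullbackMetric I Φ (t • u) u b = 0 := by simpa [ht.1.ne', hs0] using hva
  have hle := mul_le_mul_of_nonneg_left
    (hΦ.apply_connectionCurvature_le hκ ht hu hvsrc hb hub) (sq_nonneg (t * s))
  rw [connectionCurvature_smul]
  simp only [map_smul, smul_apply, smul_eq_mul, huu, hb]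
  linarith

end IsNormalChart

end NormalCoordinates

section CentreDistance

/-- Continuous induction: a path cannot leave a compact sublevel set if it satisfies the strict
inequality as long as it has not left it. -/
theorem mem_image_sublevel_of_forall_lt {X Y : Type*} [TopologicalSpace X] [TopologicalSpace Y]
    [T2Space Y] {Φ : OpenPartialHomeomorph X Y} {f : X → ℝ} {L a b : ℝ} {γ : ℝ → Y}
    (hf : Continuous f) (hcompact : IsCompact {x | f x ≤ L}) (hsource : {x | f x ≤ L} ⊆ Φ.source)
    (hγ : Continuous γ) (ha : γ a ∈ Φ '' {x | f x ≤ L})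
    (hlt : ∀ t ∈ Icc a b, (∀ s ∈ Icc a t, γ s ∈ Φ '' {x | f x ≤ L}) → f (Φ.symm (γ t)) < L) :
    ∀ t ∈ Icc a b, γ t ∈ Φ '' {x | f x ≤ L} := by
  have htarget : Φ '' {x | f x ≤ L} ⊆ Φ.target := by
    rintro _ ⟨x, hx, rfl⟩
    exact Φ.map_source (hsource hx)
  have hclosed : IsClosed (Φ '' {x | f x ≤ L}) :=
    (hcompact.image_of_continuousOn (Φ.continuousOn.mono hsource)).isClosed
  refine IsClosed.Icc_subset_of_forall_mem_nhdsGT_of_Icc_subset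
    ((hclosed.preimage hγ).inter isClosed_Icc) ha fun t ht hmem => mem_nhdsWithin_of_mem_nhds ?_
  have hγt : γ t ∈ Φ.target := htarget (hmem ⟨ht.1, le_rfl⟩)
  have hcont : ContinuousAt (fun s => f (Φ.symm (γ s))) t :=
    hf.continuousAt.comp' ((Φ.symm.continuousAt hγt).comp' hγ.continuousAt)
  filter_upwards [hcont.eventually (gt_mem_nhds (hlt t (Ico_subset_Icc_self ht) hmem)),
    hγ.continuousAt.eventually (Φ.open_target.mem_nhds hγt)] with s hs hγs
  exact ⟨Φ.symm (γ s), hs.le, Φ.right_inv hγs⟩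

variable {E : Type*} [NormedAddCommGroup E] [NormedSpace ℝ E]
  {H : Type*} [TopologicalSpace H] {I : ModelWithCorners ℝ E H}
  {N : Type*} [TopologicalSpace N] [ChartedSpace H N]
  [RiemannianBundle (fun x : N => TangentSpace I x)]
  {γ : ℝ → N}

theorem enorm_eq_ofReal_sqrt_riemannianMetric {p q : N} (hpq : p = q) (a : TangentSpace I p)
    (b : TangentSpace I q) (hab : (a : E) = (b : E)) :
    ‖a‖ₑ = ENNReal.ofReal √(riemannianMetric I N q b b) := by
  subst hpq hab
  rw [riemannianMetric, ← norm_eq_sqrt_real_inner, ofReal_norm]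

theorem IsParam.enorm_mfderiv_eq {σ : E → N} {U : Set E} (hσ : IsParam I σ U) {β : ℝ → E} {t : ℝ}
    {w : E} (hβ : HasDerivAt β w t) (ht : β t ∈ U) (h : γ =ᶠ[𝓝 t] σ ∘ β) :
    ‖mfderiv 𝓘(ℝ, ℝ) I γ t 1‖ₑ = ENNReal.ofReal √(pullbackMetric I σ (β t) w w) := by
  have hcomp := ((hσ.mdifferentiableAt ht).hasMFDerivAt.comp t
    hβ.hasFDerivAt.hasMFDerivAt).congr_of_eventuallyEq h
  have hvelocity : (mfderiv 𝓘(ℝ, ℝ) I γ t 1 : E) = mfderiv 𝓘(ℝ, E) I σ (β t) w := by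
    rw [hcomp.mfderiv]
    exact congr(mfderiv 𝓘(ℝ, E) I σ (β t) $(one_smul ℝ w))
  exact enorm_eq_ofReal_sqrt_riemannianMetric h.eq_of_nhds _ _ hvelocity

variable [FiniteDimensional ℝ E] [I.Boundaryless] [IsManifold I ∞ N]
  [IsContMDiffRiemannianBundle I ∞ E (fun x : N => TangentSpace I x)]
  {Φ : OpenPartialHomeomorph E N} {r : ℝ}

namespace IsNormalChart

theorem enorm_sub_le_pathELength (hΦ : IsNormalChart I Φ r) {c : ℝ} (hc : 0 < c)
    (hγ : ContMDiff 𝓘(ℝ, ℝ) I 1 γ) {a b : ℝ} (hab : a ≤ b) (hmem : ∀ t ∈ Icc a b, γ t ∈ Φ.target) :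
    ‖√(c + pullbackMetric I Φ 0 (Φ.symm (γ b)) (Φ.symm (γ b)))
        - √(c + pullbackMetric I Φ 0 (Φ.symm (γ a)) (Φ.symm (γ a)))‖ₑ ≤ pathELength I γ a b := by
  have hinner := hΦ.isNormalMetric.isInnerForm_zero
  have hcoord (t) (ht : t ∈ Icc a b) : ContDiffAt ℝ 1 (fun t => Φ.symm (γ t)) t :=
    contMDiffAt_iff_contDiffAt.1 (ContMDiffAt.comp t
      ((hΦ.contMDiffOn_symm.contMDiffAt (Φ.open_target.mem_nhds (hmem t ht))).of_le (by simp))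
      (hγ t))
  have hderiv (t) (ht : t ∈ Icc a b) :=
    ((hcoord t ht).differentiableAt one_ne_zero).hasDerivAt
  have hcont : ContDiffOn ℝ 1
      (fun t => √(c + pullbackMetric I Φ 0 (Φ.symm (γ t)) (Φ.symm (γ t)))) (Icc a b) := fun t ht =>
    (ContDiffAt.sqrt (contDiffAt_const.add ((contDiffAt_const.clm_apply (hcoord t ht)).clm_apply
      (hcoord t ht))) (add_pos_of_pos_of_nonneg hc (hinner.nonneg _)).ne').contDiffWithinAt
  refine (enorm_sub_le_lintegral_deriv_of_contDiffOn_Icc hcont hab).trans ?_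
  rw [pathELength_eq_lintegral_mfderiv_Icc]
  refine MeasureTheory.setLIntegral_mono' measurableSet_Icc fun t ht => ?_
  have hsource := Φ.map_target (hmem t ht)
  have hlift : γ =ᶠ[𝓝 t] Φ ∘ fun t => Φ.symm (γ t) := by
    filter_upwards [hγ.continuous.continuousAt.eventually
      (Φ.open_target.mem_nhds (hmem t ht))] with s hs using (Φ.right_inv hs).symm
  rw [hΦ.isParam.enorm_mfderiv_eq (hderiv t ht) hsource hlift,
    (hinner.hasDerivAt_sqrt_add_apply_self hc (hderiv t ht)).deriv, Real.enorm_eq_ofReal_abs]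
  exact ENNReal.ofReal_le_ofReal
    (hΦ.isNormalMetric.abs_apply_div_sqrt_le hc (hΦ.source_eq ▸ hsource) _)

theorem zero_mem_source (hΦ : IsNormalChart I Φ r) : (0 : E) ∈ Φ.source :=
  hΦ.source_eq ▸ hΦ.isNormalMetric.zero_mem

theorem ofReal_sqrt_le_pathELength (hΦ : IsNormalChart I Φ r) (hγ : ContMDiff 𝓘(ℝ, ℝ) I 1 γ)
    {a b : ℝ} (hab : a ≤ b) (hmem : ∀ t ∈ Icc a b, γ t ∈ Φ.target) (ha : γ a = Φ 0) :
    ENNReal.ofReal √(pullbackMetric I Φ 0 (Φ.symm (γ b)) (Φ.symm (γ b)))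
      ≤ pathELength I γ a b := by
  refine ENNReal.le_of_forall_pos_le_add fun δ hδ _ => ?_
  have hδ0 : (0 : ℝ) < δ := hδ
  have hle := hΦ.enorm_sub_le_pathELength (pow_pos hδ0 2) hγ hab hmem
  rw [ha, Φ.left_inv hΦ.zero_mem_source, map_zero, add_zero, Real.sqrt_sq hδ0.le,
    Real.enorm_eq_ofReal_abs] at hle
  generalize pullbackMetric I Φ 0 (Φ.symm (γ b)) (Φ.symm (γ b)) = c at hle ⊢
  have hsqrt : √c ≤ √((δ : ℝ) ^ 2 + c) := Real.sqrt_le_sqrt (by nlinarith)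
  calc ENNReal.ofReal √c ≤ ENNReal.ofReal (|√((δ : ℝ) ^ 2 + c) - δ| + δ) :=
        ENNReal.ofReal_le_ofReal (by linarith [le_abs_self (√((δ : ℝ) ^ 2 + c) - δ)])
    _ = ENNReal.ofReal |√((δ : ℝ) ^ 2 + c) - δ| + δ := by
        rw [ENNReal.ofReal_add (abs_nonneg _) hδ0.le, ENNReal.ofReal_coe_nnreal]
    _ ≤ pathELength I γ a b + δ := by gcongr

theorem mem_target_of_riemannianEDist_lt [T2Space N] (hΦ : IsNormalChart I Φ r) {L : ℝ}
    (hL : 0 < L) (hLr : L < r) {p : N} (hp : riemannianEDist I (Φ 0) p < ENNReal.ofReal L) :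
    p ∈ Φ.target ∧ √(pullbackMetric I Φ 0 (Φ.symm p) (Φ.symm p)) < L := by
  obtain ⟨γ, hγ0, rfl, hγ, hlength, -⟩ :=
    exists_lt_locally_constant_of_riemannianEDist_lt hp zero_lt_one
  have hsource : {v | pullbackMetric I Φ 0 v v ≤ L ^ 2} ⊆ Φ.source := fun v hv => by
    rw [hΦ.source_eq]
    exact lt_of_le_of_lt hv (pow_lt_pow_left₀ hLr hL.le two_ne_zero)
  have htarget : Φ '' {v | pullbackMetric I Φ 0 v v ≤ L ^ 2} ⊆ Φ.target := by
    rintro _ ⟨v, hv, rfl⟩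
    exact Φ.map_source (hsource hv)
  have hbound (t) (ht : t ∈ Icc (0 : ℝ) 1)
      (hmem : ∀ s ∈ Icc 0 t, γ s ∈ Φ '' {v | pullbackMetric I Φ 0 v v ≤ L ^ 2}) :
      √(pullbackMetric I Φ 0 (Φ.symm (γ t)) (Φ.symm (γ t))) < L :=
    (ENNReal.ofReal_lt_ofReal_iff hL).1 <|
      calc _ ≤ pathELength I γ 0 t :=
            hΦ.ofReal_sqrt_le_pathELength hγ ht.1 (fun s hs => htarget (hmem s hs)) hγ0
        _ ≤ pathELength I γ 0 1 := pathELength_mono le_rfl ht.2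
        _ < ENNReal.ofReal L := hlength
  have hmem := mem_image_sublevel_of_forall_lt (γ := γ) (a := 0) (b := 1) (by fun_prop)
    (hΦ.isNormalMetric.isInnerForm_zero.isCompact_sublevel (L ^ 2)) hsource hγ.continuous
    ⟨0, by simp [sq_nonneg], hγ0.symm⟩ fun t ht h => (Real.sqrt_lt' hL).1 (hbound t ht h)
  have hone : (1 : ℝ) ∈ Icc (0 : ℝ) 1 := right_mem_Icc.2 zero_le_one
  exact ⟨htarget (hmem 1 hone), hbound 1 hone hmem⟩

end IsNormalChart

theorem IsNormalChart.mem_target_of_dist_lt {N : Type*} [MetricSpace N] [ChartedSpace H N]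
    [IsManifold I ∞ N] [RiemannianBundle (fun x : N => TangentSpace I x)]
    [IsContMDiffRiemannianBundle I ∞ E (fun x : N => TangentSpace I x)] [IsRiemannianManifold I N]
    {Φ : OpenPartialHomeomorph E N} (hΦ : IsNormalChart I Φ r) {p : N} (hp : dist (Φ 0) p < r) :
    p ∈ Φ.target ∧ √(pullbackMetric I Φ 0 (Φ.symm p) (Φ.symm p)) ≤ dist (Φ 0) p := by
  have hlt (L) (hL : dist (Φ 0) p < L) (hLr : L < r) :
      p ∈ Φ.target ∧ √(pullbackMetric I Φ 0 (Φ.symm p) (Φ.symm p)) < L := by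
    have hL0 : 0 < L := dist_nonneg.trans_lt hL
    refine hΦ.mem_target_of_riemannianEDist_lt hL0 hLr ?_
    rw [← IsRiemannianManifold.out (I := I) (Φ 0) p, edist_dist]
    exact (ENNReal.ofReal_lt_ofReal_iff hL0).2 hL
  obtain ⟨L, hL, hLr⟩ := exists_between hp
  refine ⟨(hlt L hL hLr).1, le_of_forall_gt_imp_ge_of_dense fun L' hL' => ?_⟩
  rcases lt_or_ge L' r with hr | hr
  · exact (hlt L' hL' hr).2.le
  · exact ((hlt L hL hLr).2.trans hLr).le.trans hr

end CentreDistance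

section ImmersionInNormalChart

theorem symm_mem_source_inter_preimage {E : Type*} [NormedAddCommGroup E] [NormedSpace ℝ E]
    {H : Type*} [TopologicalSpace H] {I : ModelWithCorners ℝ E H}
    {N : Type*} [TopologicalSpace N] [ChartedSpace H N] {Φ : OpenPartialHomeomorph E N} {p : N}
    (hp : p ∈ Φ.target) : Φ.symm p ∈ Φ.source ∩ Φ ⁻¹' (extChartAt I p).source :=
  ⟨Φ.map_target hp, by
    rw [mem_preimage, Φ.right_inv hp]
    exact mem_extChartAt_source p⟩

theorem tendsto_extChartAt_symm_nhds {E : Type*} [NormedAddCommGroup E] [NormedSpace ℝ E]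
    {H : Type*} [TopologicalSpace H] {J : ModelWithCorners ℝ E H}
    {M : Type*} [TopologicalSpace M] [ChartedSpace H M] (x : M) :
    Tendsto (extChartAt J x).symm (𝓝 (extChartAt J x x)) (𝓝 x) := by
  simpa only [extChartAt_to_inv] using (continuousAt_extChartAt_symm (I := J) x).tendsto

variable {E : Type*} [NormedAddCommGroup E] [NormedSpace ℝ E] [FiniteDimensional ℝ E]
  {H : Type*} [TopologicalSpace H] {I : ModelWithCorners ℝ E H} [I.Boundaryless]
  {N : Type*} [TopologicalSpace N] [ChartedSpace H N] [IsManifold I ∞ N]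
  [RiemannianBundle (fun x : N => TangentSpace I x)]
  [IsContMDiffRiemannianBundle I ∞ E (fun x : N => TangentSpace I x)]
  {E' : Type*} [NormedAddCommGroup E'] [NormedSpace ℝ E'] [FiniteDimensional ℝ E']
  {H' : Type*} [TopologicalSpace H'] {J : ModelWithCorners ℝ E' H'} [J.Boundaryless]
  {M : Type*} [TopologicalSpace M] [ChartedSpace H' M] [IsManifold J ∞ M]
  {Φ : OpenPartialHomeomorph E N} {r : ℝ} {φ : M → N × ℝ} {x x₁ : M}

namespace IsNormalChart

theorem injective_fderiv_lineRep (hΦ : IsNormalChart I Φ r)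
    (hφ : IsSmoothImmersion J (I.prod 𝓘(ℝ, ℝ)) φ) (hx : x ∈ (extChartAt J x₁).source)
    (hxΦ : (φ x).1 ∈ Φ.target) :
    Function.Injective (fderiv ℝ (lineRep J Φ φ x₁) (extChartAt J x₁ x)) :=
  _root_.injective_fderiv_lineRep (hΦ.isParam.isLocalIsometryOn_extChartAt_comp _)
    hΦ.contMDiffOn_symm hφ hx hxΦ (symm_mem_source_inter_preimage hxΦ)

theorem meanCurvatureNorm_eq (hΦ : IsNormalChart I Φ r)
    (hφ : IsSmoothImmersion J (I.prod 𝓘(ℝ, ℝ)) φ) (hx : x ∈ (extChartAt J x₁).source)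
    (hxΦ : (φ x).1 ∈ Φ.target) :
    meanCurvatureNorm J (prodLineMetric (riemannianMetric I N)) φ x =
      √(lineProd (pullbackMetric I Φ) (lineRep J Φ φ x₁ (extChartAt J x₁ x))
        (flatMeanCurvature (lineProd (pullbackMetric I Φ)) (lineRep J Φ φ x₁) (extChartAt J x₁ x))
        (flatMeanCurvature (lineProd (pullbackMetric I Φ)) (lineRep J Φ φ x₁)
          (extChartAt J x₁ x))) :=
  haveI : IsManifold I 1 N := .of_le (n := ∞) (by simp)
  meanCurvatureNorm_prodLineMetric (isChartMetric_extChartAt_symm _)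
    (hΦ.isParam.isLocalIsometryOn_extChartAt_comp _) hΦ.contMDiffOn_symm hφ hx hxΦ
    (symm_mem_source_inter_preimage hxΦ)

theorem continuous_meanCurvatureNorm (hΦ : IsNormalChart I Φ r)
    (hφ : IsSmoothImmersion J (I.prod 𝓘(ℝ, ℝ)) φ) (hφΦ : ∀ x, (φ x).1 ∈ Φ.target) :
    Continuous (meanCurvatureNorm J (prodLineMetric (riemannianMetric I N)) φ) := by
  refine continuous_iff_continuousAt.2 fun x₁ => ?_
  have hx₁ : x₁ ∈ (extChartAt J x₁).source := mem_extChartAt_source x₁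
  have hF := contDiffAt_lineRep hΦ.contMDiffOn_symm hφ.1 hx₁ (hφΦ x₁)
  have hFz := lineRep_extChartAt_mem_prod_univ hx₁ (Φ.map_target (hφΦ x₁))
  have hlineProd := hΦ.isParam.isMetricOn.lineProd
  have hmean := hlineProd.continuousAt_flatMeanCurvature hFz hF
    (hΦ.injective_fderiv_lineRep hφ hx₁ (hφΦ x₁))
  have hmetric : ContinuousAt (fun z => lineProd (pullbackMetric I Φ) (lineRep J Φ φ x₁ z))
      (extChartAt J x₁ x₁) :=
    (hlineProd.contDiffAt hFz).continuousAt.comp_of_eq hF.continuousAt rfl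
  have hnorm := ((hmetric.clm_apply hmean).clm_apply hmean).sqrt
  refine (hnorm.comp (continuousAt_extChartAt x₁)).congr ?_
  filter_upwards [extChartAt_source_mem_nhds (I := J) x₁] with x hx
  exact (hΦ.meanCurvatureNorm_eq hφ hx (hφΦ x)).symm

theorem sqrt_pos_of_isLocalMax (hΦ : IsNormalChart I Φ r)
    (hφ : IsSmoothImmersion J (I.prod 𝓘(ℝ, ℝ)) φ) (hxΦ : (φ x).1 ∈ Φ.target)
    (hmax : IsLocalMax (fun x => pullbackMetric I Φ 0 (Φ.symm (φ x).1) (Φ.symm (φ x).1)) x)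
    (hm : 2 ≤ Module.finrank ℝ E') :
    0 < √(pullbackMetric I Φ 0 (Φ.symm (φ x).1) (Φ.symm (φ x).1)) := by
  rw [Real.sqrt_pos]
  by_contra hnonpos
  have hzero : ∀ᶠ y in 𝓝 x, Φ.symm (φ y).1 = 0 := by
    filter_upwards [hmax] with y hy
    by_contra hne
    exact hnonpos ((hΦ.isNormalMetric.isInnerForm_zero.pos _ hne).trans_le hy)
  have hx := mem_extChartAt_source (I := J) x
  have hconst : (fun z => (lineRep J Φ φ x z).1) =ᶠ[𝓝 (extChartAt J x x)] fun _ => 0 :=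
    (tendsto_extChartAt_symm_nhds x).eventually hzero
  have hle := finrank_le_one_of_fst_eventuallyEq
    ((contDiffAt_lineRep hΦ.contMDiffOn_symm hφ.1 hx hxΦ).differentiableAt (by simp))
    (hΦ.injective_fderiv_lineRep hφ hx hxΦ) hconst
  omega

theorem ctK_mul_le_meanCurvatureNorm (hΦ : IsNormalChart I Φ r) {κ : ℝ}
    (hκ : RadialCurvatureLE (riemannianMetric I N) (Φ 0) κ)
    (hφ : IsSmoothImmersion J (I.prod 𝓘(ℝ, ℝ)) φ) (hxΦ : (φ x).1 ∈ Φ.target)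
    (hmax : IsLocalMax (fun x => pullbackMetric I Φ 0 (Φ.symm (φ x).1) (Φ.symm (φ x).1)) x)
    (hρ : √(pullbackMetric I Φ 0 (Φ.symm (φ x).1) (Φ.symm (φ x).1)) ∈ ctDomain κ)
    (hm : 1 ≤ Module.finrank ℝ E') :
    ctK κ √(pullbackMetric I Φ 0 (Φ.symm (φ x).1) (Φ.symm (φ x).1)) * (Module.finrank ℝ E' - 1)
      ≤ meanCurvatureNorm J (prodLineMetric (riemannianMetric I N)) φ x := by
  have hx := mem_extChartAt_source (I := J) x
  have hcenter : (lineRep J Φ φ x (extChartAt J x x)).1 = Φ.symm (φ x).1 :=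
    congrArg Prod.fst (lineRep_extChartAt Φ φ hx)
  have hmax' : IsLocalMax (radialEnergy (pullbackMetric I Φ) ∘ lineRep J Φ φ x)
      (extChartAt J x x) := by
    filter_upwards [(tendsto_extChartAt_symm_nhds x).eventually hmax] with z hz
    rw [Function.comp_apply, Function.comp_apply, radialEnergy_apply, radialEnergy_apply, hcenter]
    exact mul_le_mul_of_nonneg_left hz (by norm_num)
  rw [hΦ.meanCurvatureNorm_eq hφ hx hxΦ]
  rw [← hcenter] at hρ ⊢
  refine hΦ.isNormalMetric.ctK_mul_le_flatMeanCurvature ?_ (hΦ.hasRadialCurvatureLE hκ) hρ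
    (contDiffAt_lineRep hΦ.contMDiffOn_symm hφ.1 hx hxΦ)
    (hΦ.injective_fderiv_lineRep hφ hx hxΦ) hmax' hm
  rw [hcenter, ← hΦ.source_eq]
  exact Φ.map_target hxΦ

end IsNormalChart

end ImmersionInNormalChart

section ExtrinsicRadius

variable {X : Type*} [MetricSpace X] {A : Set X}

theorem subset_closedBall_extrinsicRadiusAt (hA : Bornology.IsBounded A) (x₀ : X) :
    A ⊆ Metric.closedBall x₀ (extrinsicRadiusAt x₀ A) := fun _ hp =>
  le_csInf (s := {r : ℝ | A ⊆ Metric.closedBall x₀ r}) (hA.subset_closedBall x₀) fun _ hr => hr hp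

theorem extrinsicRadiusAt_le (hA : A.Nonempty) {x₀ : X} {r : ℝ}
    (h : A ⊆ Metric.closedBall x₀ r) : extrinsicRadiusAt x₀ A ≤ r :=
  csInf_le (s := {r : ℝ | A ⊆ Metric.closedBall x₀ r})
    ⟨0, fun _ hr => dist_nonneg.trans (hr hA.some_mem)⟩ h

theorem exists_extrinsicRadiusAt_lt (hA : Bornology.IsBounded A) (hne : A.Nonempty) {R : ℝ}
    (hR : extrinsicRadius A < R) : ∃ x : X, extrinsicRadiusAt x A < R := by
  obtain ⟨r, ⟨x, hx⟩, hr⟩ := exists_lt_of_csInf_lt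
    (s := {r : ℝ | ∃ x : X, A ⊆ Metric.closedBall x r})
    ((hA.subset_closedBall hne.some).imp fun _ h => ⟨hne.some, h⟩) hR
  exact ⟨x, (extrinsicRadiusAt_le hne hx).trans_lt hr⟩

end ExtrinsicRadius

section RadiusEstimate

variable {E : Type*} [NormedAddCommGroup E] [NormedSpace ℝ E] [FiniteDimensional ℝ E]
  {H : Type*} [TopologicalSpace H] {I : ModelWithCorners ℝ E H}
  {N : Type*} [MetricSpace N] [ChartedSpace H N]
  [RiemannianBundle (fun x : N => TangentSpace I x)]

theorem exists_isNormalChart_of_lt_injRadius {x₀ : N} {R : ℝ}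
    (hR : ENNReal.ofReal R < injRadius (riemannianMetric I N) x₀) :
    ∃ (Φ : OpenPartialHomeomorph E N) (r : ℝ), IsNormalChart I Φ r ∧ Φ 0 = x₀ ∧ R < r := by
  simp only [injRadius, lt_iSup_iff] at hR
  obtain ⟨r, ⟨hr0, hr⟩, hRr⟩ := hR
  obtain ⟨Φ, hΦ, hΦ0⟩ := hr.exists_isNormalChart hr0
  exact ⟨Φ, r, hΦ, hΦ0, (ENNReal.ofReal_lt_ofReal_iff hr0).1 hRr⟩

variable [I.Boundaryless] [IsManifold I ∞ N]
  [IsContMDiffRiemannianBundle I ∞ E (fun x : N => TangentSpace I x)]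
  [IsRiemannianManifold I N]
variable {E' : Type*} [NormedAddCommGroup E'] [NormedSpace ℝ E'] [FiniteDimensional ℝ E']
  {H' : Type*} [TopologicalSpace H'] {J : ModelWithCorners ℝ E' H'} [J.Boundaryless]
  {M : Type*} [TopologicalSpace M] [CompactSpace M] [Nonempty M] [ChartedSpace H' M]
  [IsManifold J ∞ M] {φ : M → N × ℝ} {κ : ℝ}

theorem IsNormalChart.mem_image_ctK_and_ctInv_le {Φ : OpenPartialHomeomorph E N} {r R : ℝ}
    (hΦ : IsNormalChart I Φ r) (hm : 2 ≤ Module.finrank ℝ E')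
    (hφ : IsSmoothImmersion J (I.prod 𝓘(ℝ, ℝ)) φ)
    (hκ : RadialCurvatureLE (riemannianMetric I N) (Φ 0) κ)
    (hR : ∀ x, dist (Φ 0) (φ x).1 ≤ R) (hRr : R < r) :
    supMeanCurvature J (prodLineMetric (riemannianMetric I N)) φ / (Module.finrank ℝ E' - 1)
        ∈ ctK κ '' ctDomain κ ∧
      ctInv κ (supMeanCurvature J (prodLineMetric (riemannianMetric I N)) φ
        / (Module.finrank ℝ E' - 1)) ≤ R := by
  have htarget (x : M) := (hΦ.mem_target_of_dist_lt ((hR x).trans_lt hRr)).1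
  have hsymm : Continuous fun x => Φ.symm (φ x).1 :=
    Φ.continuousOn_symm.comp_continuous (continuous_fst.comp hφ.1.continuous) htarget
  have hsq : Continuous fun x => pullbackMetric I Φ 0 (Φ.symm (φ x).1) (Φ.symm (φ x).1) := by
    fun_prop
  obtain ⟨x₁, hx₁⟩ : ∃ x₁, ∀ x, pullbackMetric I Φ 0 (Φ.symm (φ x).1) (Φ.symm (φ x).1)
      ≤ pullbackMetric I Φ 0 (Φ.symm (φ x₁).1) (Φ.symm (φ x₁).1) := by
    simpa [isMaxOn_iff] using isCompact_univ.exists_isMaxOn univ_nonempty hsq.continuousOn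
  have hmax : IsLocalMax (fun x => pullbackMetric I Φ 0 (Φ.symm (φ x).1) (Φ.symm (φ x).1)) x₁ :=
    .of_forall hx₁
  have hsup : meanCurvatureNorm J (prodLineMetric (riemannianMetric I N)) φ x₁
      ≤ supMeanCurvature J (prodLineMetric (riemannianMetric I N)) φ :=
    le_ciSup (isCompact_range (hΦ.continuous_meanCurvatureNorm hφ htarget)).bddAbove x₁
  have hm' : (0 : ℝ) < Module.finrank ℝ E' - 1 :=
    sub_pos.2 (by exact_mod_cast (by omega : 1 < Module.finrank ℝ E'))
  refine _root_.mem_image_ctK_and_ctInv_le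
    (div_nonneg ((Real.sqrt_nonneg _).trans hsup) hm'.le)
    (hΦ.sqrt_pos_of_isLocalMax hφ (htarget x₁) hmax hm)
    ((hΦ.mem_target_of_dist_lt ((hR x₁).trans_lt hRr)).2.trans (hR x₁)) fun hρ => ?_
  rw [le_div_iff₀ hm']
  exact (hΦ.ctK_mul_le_meanCurvatureNorm hκ hφ (htarget x₁) hmax hρ (by omega)).trans hsup

theorem ctInv_le_extrinsicRadiusAt (hm : 2 ≤ Module.finrank ℝ E')
    (hφ : IsSmoothImmersion J (I.prod 𝓘(ℝ, ℝ)) φ) {x₀ : N}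
    (hκ : RadialCurvatureLE (riemannianMetric I N) x₀ κ)
    (hinj : ENNReal.ofReal (extrinsicRadiusAt x₀ (Prod.fst '' range φ)) <
      injRadius (riemannianMetric I N) x₀) :
    supMeanCurvature J (prodLineMetric (riemannianMetric I N)) φ / (Module.finrank ℝ E' - 1)
        ∈ ctK κ '' ctDomain κ ∧
      ctInv κ (supMeanCurvature J (prodLineMetric (riemannianMetric I N)) φ
        / (Module.finrank ℝ E' - 1)) ≤ extrinsicRadiusAt x₀ (Prod.fst '' range φ) := by
  have hbdd : Bornology.IsBounded (Prod.fst '' range φ) :=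
    ((isCompact_range hφ.1.continuous).image continuous_fst).isBounded
  obtain ⟨Φ, r, hΦ, rfl, hRr⟩ := exists_isNormalChart_of_lt_injRadius hinj
  exact hΦ.mem_image_ctK_and_ctInv_le hm hφ hκ (fun x => dist_comm (Φ 0) _ ▸
    subset_closedBall_extrinsicRadiusAt hbdd (Φ 0) (mem_image_of_mem _ (mem_range_self x))) hRr

theorem ctInv_le_extrinsicRadius (hm : 2 ≤ Module.finrank ℝ E')
    (hφ : IsSmoothImmersion J (I.prod 𝓘(ℝ, ℝ)) φ)
    (hκ : ∀ x : N, RadialCurvatureLE (riemannianMetric I N) x κ)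
    (hinj : ENNReal.ofReal (extrinsicRadius (Prod.fst '' range φ)) <
      ⨅ x : N, injRadius (riemannianMetric I N) x) :
    supMeanCurvature J (prodLineMetric (riemannianMetric I N)) φ / (Module.finrank ℝ E' - 1)
        ∈ ctK κ '' ctDomain κ ∧
      ctInv κ (supMeanCurvature J (prodLineMetric (riemannianMetric I N)) φ
        / (Module.finrank ℝ E' - 1)) ≤ extrinsicRadius (Prod.fst '' range φ) := by
  have hbdd : Bornology.IsBounded (Prod.fst '' range φ) :=
    ((isCompact_range hφ.1.continuous).image continuous_fst).isBounded
  have hne : (Prod.fst '' range φ).Nonempty := (range_nonempty φ).image _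
  obtain ⟨R, -, hRlt, hRinj⟩ := ENNReal.lt_iff_exists_real_btwn.1 hinj
  have hR := (ENNReal.ofReal_lt_ofReal_iff'.1 hRlt).1
  have hlarger (a : ℝ) (ha : extrinsicRadius (Prod.fst '' range φ) < a) (haR : a ≤ R) :
      supMeanCurvature J (prodLineMetric (riemannianMetric I N)) φ / (Module.finrank ℝ E' - 1)
          ∈ ctK κ '' ctDomain κ ∧
        ctInv κ (supMeanCurvature J (prodLineMetric (riemannianMetric I N)) φ
          / (Module.finrank ℝ E' - 1)) ≤ a := by
    obtain ⟨x, hx⟩ := exists_extrinsicRadiusAt_lt hbdd hne ha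
    refine (ctInv_le_extrinsicRadiusAt hm hφ (hκ x) ?_).imp_right hx.le.trans'
    calc _ ≤ ENNReal.ofReal R := ENNReal.ofReal_le_ofReal (hx.le.trans haR)
      _ < ⨅ x : N, injRadius (riemannianMetric I N) x := hRinj
      _ ≤ _ := iInf_le _ x
  refine ⟨(hlarger R hR le_rfl).1, le_of_forall_gt_imp_ge_of_dense fun a ha => ?_⟩
  exact (hlarger (min a R) (lt_min ha hR) (min_le_right _ _)).2.trans (min_le_left _ _)

end RadiusEstimate

theorem mainTheorem4_general
    {E : Type*} [NormedAddCommGroup E] [NormedSpace ℝ E] [FiniteDimensional ℝ E]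
    {H : Type*} [TopologicalSpace H] {I : ModelWithCorners ℝ E H} [I.Boundaryless]
    {N : Type*} [MetricSpace N] [ChartedSpace H N] [IsManifold I ∞ N]
    [RiemannianBundle (fun x : N => TangentSpace I x)]
    [IsContMDiffRiemannianBundle I ∞ E (fun x : N => TangentSpace I x)]
    [IsRiemannianManifold I N]
    {E' : Type*} [NormedAddCommGroup E'] [NormedSpace ℝ E'] [FiniteDimensional ℝ E']
    {H' : Type*} [TopologicalSpace H'] {J : ModelWithCorners ℝ E' H'} [J.Boundaryless]
    {M : Type*} [TopologicalSpace M] [CompactSpace M] [Nonempty M] [ChartedSpace H' M]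
    [IsManifold J ∞ M] {φ : M → N × ℝ} (hφ : IsSmoothImmersion J (I.prod 𝓘(ℝ, ℝ)) φ)
    {c : ℝ} (hc : 0 < c) (hcm : c ≤ Module.finrank ℝ E' - 1) (κ : ℝ) :
    (∀ x₀ : N, RadialCurvatureLE (riemannianMetric I N) x₀ κ →
      ENNReal.ofReal (extrinsicRadiusAt x₀ (Prod.fst '' range φ)) <
        injRadius (riemannianMetric I N) x₀ →
      supMeanCurvature J (prodLineMetric (riemannianMetric I N)) φ / c ∈ ctK κ '' ctDomain κ ∧
      ctInv κ (supMeanCurvature J (prodLineMetric (riemannianMetric I N)) φ / c)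
        ≤ extrinsicRadiusAt x₀ (Prod.fst '' range φ)) ∧
    ((∀ x : N, RadialCurvatureLE (riemannianMetric I N) x κ) →
      ENNReal.ofReal (extrinsicRadius (Prod.fst '' range φ)) <
        ⨅ x : N, injRadius (riemannianMetric I N) x →
      supMeanCurvature J (prodLineMetric (riemannianMetric I N)) φ / c ∈ ctK κ '' ctDomain κ ∧
      ctInv κ (supMeanCurvature J (prodLineMetric (riemannianMetric I N)) φ / c)
        ≤ extrinsicRadius (Prod.fst '' range φ)) := by
  have hm : 2 ≤ Module.finrank ℝ E' := by
    have : (1 : ℝ) < Module.finrank ℝ E' := by linarith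
    exact_mod_cast this
  have hdiv : supMeanCurvature J (prodLineMetric (riemannianMetric I N)) φ
        / (Module.finrank ℝ E' - 1)
      ≤ supMeanCurvature J (prodLineMetric (riemannianMetric I N)) φ / c :=
    div_le_div_of_nonneg_left (Real.iSup_nonneg fun _ => Real.sqrt_nonneg _) hc hcm
  exact ⟨fun _ hκ hinj =>
      mem_image_ctK_and_ctInv_le_mono hdiv (ctInv_le_extrinsicRadiusAt hm hφ hκ hinj),
    fun hκ hinj => mem_image_ctK_and_ctInv_le_mono hdiv (ctInv_le_extrinsicRadius hm hφ hκ hinj)⟩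

end

theorem mainTheorem4
    {n m : ℕ} (hm : 3 ≤ m)
    -- a complete `n`-dimensional Riemannian manifold
    {N : Type*} [MetricSpace N] [CompleteSpace N]
    [ChartedSpace (EuclideanSpace ℝ (Fin n)) N] [IsManifold (𝓡 n) ∞ N]
    [RiemannianBundle (fun x : N => TangentSpace (𝓡 n) x)]
    [IsContMDiffRiemannianBundle (𝓡 n) ∞ (EuclideanSpace ℝ (Fin n))
      (fun x : N => TangentSpace (𝓡 n) x)]
    [IsRiemannianManifold (𝓡 n) N]
    -- a compact `m`-dimensional immersed submanifold of `N × ℝ`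
    {M : Type*} [TopologicalSpace M] [T2Space M] [CompactSpace M] [Nonempty M]
    [ChartedSpace (EuclideanSpace ℝ (Fin m)) M] [IsManifold (𝓡 m) ∞ M]
    (φ : M → N × ℝ) (hφ : IsSmoothImmersion (𝓡 m) ((𝓡 n).prod 𝓘(ℝ, ℝ)) φ)
    (κ : ℝ) :
    -- the ball centred at a given point `x₀`
    (∀ x₀ : N, RadialCurvatureLE (riemannianMetric (𝓡 n) N) x₀ κ →
      ENNReal.ofReal (extrinsicRadiusAt x₀ (Prod.fst '' range φ)) <
        injRadius (riemannianMetric (𝓡 n) N) x₀ →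
      supMeanCurvature (𝓡 m) (prodLineMetric (riemannianMetric (𝓡 n) N)) φ / ((m : ℝ) - 2)
        ∈ ctK κ '' ctDomain κ ∧
      ctInv κ (supMeanCurvature (𝓡 m) (prodLineMetric (riemannianMetric (𝓡 n) N)) φ
        / ((m : ℝ) - 2)) ≤ extrinsicRadiusAt x₀ (Prod.fst '' range φ)) ∧
    -- the smallest ball of any centre
    ((∀ x : N, RadialCurvatureLE (riemannianMetric (𝓡 n) N) x κ) →
      ENNReal.ofReal (extrinsicRadius (Prod.fst '' range φ)) <
        ⨅ x : N, injRadius (riemannianMetric (𝓡 n) N) x →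
      supMeanCurvature (𝓡 m) (prodLineMetric (riemannianMetric (𝓡 n) N)) φ / ((m : ℝ) - 2)
        ∈ ctK κ '' ctDomain κ ∧
      ctInv κ (supMeanCurvature (𝓡 m) (prodLineMetric (riemannianMetric (𝓡 n) N)) φ
        / ((m : ℝ) - 2)) ≤ extrinsicRadius (Prod.fst '' range φ)) := by
  have hm' : (3 : ℝ) ≤ m := by exact_mod_cast hm
  exact mainTheorem4_general hφ (by linarith) (by rw [finrank_euclideanSpace_fin]; linarith) κ
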